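/- Theorem (Weitzenböck formula). Let $(M,g)$ be an oriented smooth pseudo-Riemannian manifold of dimension $d$, with $g$ of any signature, and let $\nabla$ be its Levi-Civita connection, extended to differential forms by the Leibniz rule. For a vector $v$ let $\flat v=g(v,\cdot)$, let $i_v$ be the interior product (zero on $0$-forms) and $j_v\alpha=\flat v\wedge\alpha$; for a one-form $\alpha$ let $\sharp\alpha$ be the vector with $g(\sharp\alpha,v)=\alpha(v)$ for all $v$. Let $\omega$ be the volume form ($\omega=e^1\wedge\dots\wedge e^d$ for every positively oriented orthonormal frame), let $(\cdot,\cdot)_g$ be the Gram inner product of $p$-forms, and let $\ast:\Lambda^p\to\Lambda^{d-p}$ be the Hodge operator, defined by $\beta\wedge\ast\alpha=(\beta,\alpha)_g\,\omega$ for all $p$-forms $\beta$. Put $\delta\alpha=(-1)^p\ast^{-1}d\ast\alpha$ for a $p$-form $\alpha$ (with $\delta=0$ on $0$-forms) and $\Box=-(d\delta+\delta d)$. In a local frame $e_a$ with $g_{ab}=g(e_a,e_b)$ and inverse matrix $g^{ab}$, put $i^a=g^{ab}i_{e_b}$, $j^a=g^{ab}j_{e_b}$ and $$\Delta=\operatorname{tr}\nabla^2=g^{ab}\bigl(\nabla_{e_a}\nabla_{e_b}-\nabla_{\nabla_{e_a}e_b}\bigr),$$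 which does not depend on the frame. Let $R(u,v)=\nabla_u\nabla_v-\nabla_v\nabla_u-\nabla_{[u,v]}$ be the curvature operator. Then, for every $p\ge 0$, every smooth $p$-form $\alpha$ on $M$ and every smooth local frame $e_1,\dots,e_d$ (not necessarily orthonormal) on an open set $U\subseteq M$, one has on $U$ $$\Box\alpha=\Delta\alpha+j^a i^b R(e_a,e_b)\alpha .$$ If $\alpha$ is a smooth one-form, then, for every $x\in M$ and every $u\in T_xM$, $$\Box\alpha(u)=\Delta\alpha(u)-r(\sharp\alpha,u),$$ where $r(u,v)=\operatorname{tr}\bigl(w\mapsto R(w,v)u\bigr)$ is the Ricci tensor. -/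

import Mathlib

open scoped Manifold ContDiff Topology Bundle

noncomputable section

namespace PseudoRiemannian

/-! ### Exterior algebra of one tangent space -/

section ExteriorAlgebra

variable {V : Type*} [AddCommGroup V] [Module ℝ V] [TopologicalSpace V]

/-- Interior product: `(i_v α)(w₁, …, w_p) = α(v, w₁, …, w_p)`. -/
def interior {p : ℕ} (v : V) (α : V [⋀^Fin (p + 1)]→L[ℝ] ℝ) : V [⋀^Fin p]→L[ℝ] ℝ where
  toMultilinearMap := (α.toAlternatingMap.curryLeft v).toMultilinearMap
  map_eq_zero_of_eq' := (α.toAlternatingMap.curryLeft v).map_eq_zero_of_eq'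
  cont := by
    change Continuous fun w : Fin p → V => α (Fin.cons v w)
    exact α.cont.comp (Continuous.finCons continuous_const continuous_id)

theorem interior_apply {p : ℕ} (v : V) (α : V [⋀^Fin (p + 1)]→L[ℝ] ℝ) (w : Fin p → V) :
    interior v α w = α (Fin.cons v w) := rfl

/-- Left exterior multiplication by a one-form, `θ ∧ α`. -/
def oneFormWedge {p : ℕ} (θ : V →L[ℝ] ℝ) (α : V [⋀^Fin p]→L[ℝ] ℝ) :
    V [⋀^Fin (p + 1)]→L[ℝ] ℝ where
  toMultilinearMap := (AlternatingMap.alternatizeUncurryFin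
    (θ.toLinearMap.smulRight α.toAlternatingMap)).toMultilinearMap
  map_eq_zero_of_eq' := (AlternatingMap.alternatizeUncurryFin
    (θ.toLinearMap.smulRight α.toAlternatingMap)).map_eq_zero_of_eq'
  cont := by
    change Continuous fun w : Fin (p + 1) → V => AlternatingMap.alternatizeUncurryFin
      (θ.toLinearMap.smulRight α.toAlternatingMap) w
    simp only [AlternatingMap.alternatizeUncurryFin_apply]
    refine continuous_finsetSum _ fun i _ => ?_
    have h : Continuous fun w : Fin (p + 1) → V => θ (w i) * α (i.removeNth w) :=
      (θ.continuous.comp (continuous_apply i)).mul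
        (α.cont.comp (continuous_pi fun j => continuous_apply _))
    exact h.const_smul ((-1 : ℤ) ^ (i : ℕ))

theorem oneFormWedge_apply {p : ℕ} (θ : V →L[ℝ] ℝ) (α : V [⋀^Fin p]→L[ℝ] ℝ)
    (w : Fin (p + 1) → V) :
    oneFormWedge θ α w = ∑ i : Fin (p + 1), (-1) ^ (i : ℕ) * (θ (w i) * α (i.removeNth w)) := by
  change AlternatingMap.alternatizeUncurryFin
      (θ.toLinearMap.smulRight α.toAlternatingMap) w = _
  simp [AlternatingMap.alternatizeUncurryFin_apply]

/-- The creator `j_v α = ♭v ∧ α`, where `♭v = g(v, ·)`. -/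
def creator {p : ℕ} (g : V →L[ℝ] V →L[ℝ] ℝ) (v : V) (α : V [⋀^Fin p]→L[ℝ] ℝ) :
    V [⋀^Fin (p + 1)]→L[ℝ] ℝ :=
  oneFormWedge (g v) α

/-- The operator `j_u i_v` on `p`-forms; `i_v` vanishes on `0`-forms. -/
def creatorInterior (g : V →L[ℝ] V →L[ℝ] ℝ) (u v : V) :
    {p : ℕ} → (V [⋀^Fin p]→L[ℝ] ℝ) → V [⋀^Fin p]→L[ℝ] ℝ
  | 0, _ => 0
  | _ + 1, α => creator g u (interior v α)

/-- The wedge product `β ∧ γ` of a `p`-form and a `q`-form with `p + q = n`, normalised by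
`(e¹ ∧ e²)(e₁, e₂) = 1` (sum over shuffles). -/
def wedge {p q n : ℕ} (h : p + q = n) (β : V [⋀^Fin p]→L[ℝ] ℝ) (γ : V [⋀^Fin q]→L[ℝ] ℝ) :
    V [⋀^Fin n]→ₗ[ℝ] ℝ :=
  ((LinearMap.mul' ℝ ℝ).compAlternatingMap
    (β.toAlternatingMap.domCoprod γ.toAlternatingMap)).domDomCongr
      (finSumFinEquiv.trans (finCongr h))

/-- The matrix `g(b_i, b_j)`. -/
def gramMatrix {ι : Type*} (g : V →L[ℝ] V →L[ℝ] ℝ) (b : ι → V) : Matrix ι ι ℝ :=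
  Matrix.of fun i j => g (b i) (b j)

/-- The Gram inner product of two `p`-forms,
`(α, β)_g = (1 / p!) g^{a₁ b₁} ⋯ g^{a_p b_p} α_{a₁ … a_p} β_{b₁ … b_p}`. It is the bilinear form
with `(α₁ ∧ ⋯ ∧ α_p, β₁ ∧ ⋯ ∧ β_p)_g = det (α_i, β_j)_g` (see `gramInner_eq_det`). -/
def gramInner {p : ℕ} [FiniteDimensional ℝ V] (g : V →L[ℝ] V →L[ℝ] ℝ) (α β : V [⋀^Fin p]→L[ℝ] ℝ) : ℝ :=
  let b := Module.finBasis ℝ V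
  (p.factorial : ℝ)⁻¹ * ∑ s : Fin p → Fin (Module.finrank ℝ V),
    ∑ t : Fin p → Fin (Module.finrank ℝ V),
      (∏ i, (gramMatrix g b)⁻¹ (s i) (t i)) * (α (b ∘ s) * β (b ∘ t))

theorem gramMatrix_det_ne_zero {n : ℕ} (g : V →L[ℝ] V →L[ℝ] ℝ)
    (hs : ∀ v w, g v w = g w v) (hn : ∀ v, (∀ w, g v w = 0) → v = 0)
    (b : Module.Basis (Fin n) ℝ V) : (gramMatrix g b).det ≠ 0 := by
  intro h0
  obtain ⟨x, hx, hGx⟩ := Matrix.exists_mulVec_eq_zero_iff.mpr h0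
  apply hx
  have hv : ∑ k, x k • b k = 0 := by
    apply hn
    intro w
    rw [← b.sum_repr w]
    rw [map_sum (g _)]
    refine Finset.sum_eq_zero fun i _ => ?_
    rw [map_smul]
    have := congrFun hGx i
    simp only [Matrix.mulVec, dotProduct, gramMatrix, Matrix.of_apply, Pi.zero_apply] at this
    rw [hs, map_sum]
    simp only [map_smul, smul_eq_mul]
    rw [show ∑ k, x k * g (b i) (b k) = 0 by
      rw [← this]; exact Finset.sum_congr rfl fun k _ => mul_comm _ _, mul_zero]
  funext k
  exact Fintype.linearIndependent_iff.mp b.linearIndependent x hv k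

/-- `(α, ♭c₁ ∧ ⋯ ∧ ♭c_p)_g = α(c₁, …, c_p)`. -/
theorem gramInner_eq_apply {p : ℕ} [FiniteDimensional ℝ V] (g : V →L[ℝ] V →L[ℝ] ℝ)
    (hs : ∀ v w, g v w = g w v) (hn : ∀ v, (∀ w, g v w = 0) → v = 0)
    (α β : V [⋀^Fin p]→L[ℝ] ℝ) (c : Fin p → V)
    (hβ : ∀ v, β v = (Matrix.of fun i j => g (c i) (v j)).det) :
    gramInner g α β = α c := by
  have hdet := gramMatrix_det_ne_zero g hs hn (Module.finBasis ℝ V)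
  set b := Module.finBasis ℝ V with hb
  have hcoord : ∀ (k) (v : V), ∑ t, (gramMatrix g b)⁻¹ k t * g v (b t) = b.repr v k := by
    intro k v
    have h1 : ∀ t, g v (b t) = ((gramMatrix g b).mulVec (b.repr v)) t := by
      intro t
      conv_lhs => rw [← b.sum_repr v, hs]
      simp only [map_sum, map_smul, Matrix.mulVec, dotProduct, gramMatrix, Matrix.of_apply,
        smul_eq_mul]
      exact Finset.sum_congr rfl fun i _ => mul_comm _ _
    have h2 : ∑ t, (gramMatrix g b)⁻¹ k t * g v (b t)
        = ((gramMatrix g b)⁻¹.mulVec ((gramMatrix g b).mulVec (b.repr v))) k := by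
      simp only [Matrix.mulVec, dotProduct] at h1 ⊢
      exact Finset.sum_congr rfl fun t _ => by rw [h1]
    rw [h2, Matrix.mulVec_mulVec, Matrix.nonsing_inv_mul _ (isUnit_iff_ne_zero.mpr hdet),
      Matrix.one_mulVec]
  have hα : ∀ w : Fin p → V, ∑ s : Fin p → Fin (Module.finrank ℝ V),
      (∏ i, b.repr (w i) (s i)) * α (b ∘ s) = α w := by
    intro w
    conv_rhs => rw [show w = fun i => ∑ k, b.repr (w i) k • b k from
      funext fun i => (b.sum_repr (w i)).symm]
    have h := α.toMultilinearMap.map_sum (fun i k => b.repr (w i) k • b k)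
    refine Eq.trans ?_ h.symm
    refine Finset.sum_congr rfl fun s _ => ?_
    exact (α.toMultilinearMap.map_smul_univ (fun i => b.repr (w i) (s i)) (fun i => b (s i))).symm
  have key : ∀ s : Fin p → Fin (Module.finrank ℝ V),
      ∑ t : Fin p → Fin (Module.finrank ℝ V),
        (∏ i, (gramMatrix g b)⁻¹ (s i) (t i)) * (α (b ∘ s) * β (b ∘ t))
      = ∑ σ : Equiv.Perm (Fin p), ((Equiv.Perm.sign σ : ℤ) : ℝ) *
          ((∏ i, b.repr (c (σ i)) (s i)) * α (b ∘ s)) := by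
    intro s
    have : ∀ σ : Equiv.Perm (Fin p), ∏ i, b.repr (c (σ i)) (s i)
        = ∑ t : Fin p → Fin (Module.finrank ℝ V),
          ∏ i, ((gramMatrix g b)⁻¹ (s i) (t i) * g (c (σ i)) (b (t i))) := by
      intro σ
      simp only [← hcoord, Finset.prod_univ_sum, Fintype.piFinset_univ]
    simp only [this, Finset.sum_mul, Finset.mul_sum]
    rw [Finset.sum_comm]
    refine Finset.sum_congr rfl fun t _ => ?_
    rw [hβ, Matrix.det_apply']
    simp only [Finset.mul_sum, Matrix.of_apply, Function.comp_apply]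
    refine Finset.sum_congr rfl fun σ _ => ?_
    rw [Finset.prod_mul_distrib]
    ring
  unfold gramInner
  simp only [← hb]
  rw [Finset.sum_congr rfl fun s _ => key s, Finset.sum_comm]
  simp only [← Finset.mul_sum, hα]
  have hσ : ∀ σ : Equiv.Perm (Fin p), ((Equiv.Perm.sign σ : ℤ) : ℝ) * α (fun i => c (σ i))
      = α c := by
    intro σ
    have h := α.toAlternatingMap.map_perm c σ
    change α (c ∘ σ) = Equiv.Perm.sign σ • α c at h
    change _ * α (c ∘ σ) = _
    rw [h]
    rcases Int.units_eq_one_or (Equiv.Perm.sign σ) with h1 | h1 <;> rw [h1] <;> simp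
  have hp : (p.factorial : ℝ) ≠ 0 := by exact_mod_cast p.factorial_ne_zero
  rw [Finset.sum_congr rfl fun σ _ => hσ σ]
  simp only [Finset.sum_const, Finset.card_univ, Fintype.card_perm, Fintype.card_fin,
    nsmul_eq_mul]
  field_simp

/-- `(♭a₁ ∧ ⋯ ∧ ♭a_p, ♭c₁ ∧ ⋯ ∧ ♭c_p)_g = det g(a_i, c_j)`. -/
theorem gramInner_eq_det {p : ℕ} [FiniteDimensional ℝ V] (g : V →L[ℝ] V →L[ℝ] ℝ)
    (hs : ∀ v w, g v w = g w v) (hn : ∀ v, (∀ w, g v w = 0) → v = 0)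
    (α β : V [⋀^Fin p]→L[ℝ] ℝ) (a c : Fin p → V)
    (hα : ∀ v, α v = (Matrix.of fun i j => g (a i) (v j)).det)
    (hβ : ∀ v, β v = (Matrix.of fun i j => g (c i) (v j)).det) :
    gramInner g α β = (Matrix.of fun i j => g (a i) (c j)).det := by
  rw [gramInner_eq_apply g hs hn α β c hβ, hα]

/-- `g`-orthonormality in arbitrary signature: `g(e_a, e_b) = η_{ab}` with `η` diagonal with
entries `±1`. -/
def IsOrthonormal {ι : Type*} (g : V →L[ℝ] V →L[ℝ] ℝ) (e : ι → V) : Prop :=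
  (∀ a b, a ≠ b → g (e a) (e b) = 0) ∧ ∀ a, g (e a) (e a) = 1 ∨ g (e a) (e a) = -1

/-- The volume form of an oriented space: `ω = e¹ ∧ ⋯ ∧ e^d` for every positively oriented
orthonormal basis `e` (with `e.det` the form `e¹ ∧ ⋯ ∧ e^d`). -/
def volumeForm {d : ℕ} (g : V →L[ℝ] V →L[ℝ] ℝ) (o : Orientation ℝ V (Fin d)) :
    V [⋀^Fin d]→ₗ[ℝ] ℝ :=
  Classical.epsilon fun vol => ∀ e : Module.Basis (Fin d) ℝ V,
    IsOrthonormal g e → e.orientation = o → vol = e.det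

/-- The Hodge operator `Λ^p → Λ^q`, `p + q = d`: `⋆α` is the `q`-form with
`β ∧ ⋆α = (β, α)_g ω` for every `p`-form `β`. -/
def hodgeStar {d p q : ℕ} [FiniteDimensional ℝ V] (h : p + q = d) (g : V →L[ℝ] V →L[ℝ] ℝ)
    (o : Orientation ℝ V (Fin d)) (α : V [⋀^Fin p]→L[ℝ] ℝ) : V [⋀^Fin q]→L[ℝ] ℝ :=
  Classical.epsilon fun γ => ∀ β : V [⋀^Fin p]→L[ℝ] ℝ,
    wedge h β γ = gramInner g β α • volumeForm g o

/-- The vector `♯α` of a one-form `α`: `g(♯α, v) = α(v)` for all `v`. -/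
def sharp (g : V →L[ℝ] V →L[ℝ] ℝ) (α : V [⋀^Fin 1]→L[ℝ] ℝ) : V :=
  Classical.epsilon fun s => ∀ v, g s v = α ![v]

end ExteriorAlgebra

/-! ### Pseudo-Riemannian manifolds -/

section Manifold

variable (d : ℕ) (M : Type*) [TopologicalSpace M] [ChartedSpace (EuclideanSpace ℝ (Fin d)) M]

instance (x : M) : FiniteDimensional ℝ (TangentSpace (𝓡 d) x) :=
  inferInstanceAs (FiniteDimensional ℝ (EuclideanSpace ℝ (Fin d)))

/-- (Not necessarily smooth) vector fields. -/
abbrev VField : Type _ := (x : M) → TangentSpace (𝓡 d) x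

/-- (Not necessarily smooth) differential `p`-forms. -/
abbrev DForm (p : ℕ) : Type _ := (x : M) → (TangentSpace (𝓡 d) x) [⋀^Fin p]→L[ℝ] ℝ

/-- A smooth pseudo-Riemannian metric (of any signature). -/
structure Metric [IsManifold (𝓡 d) ∞ M] where
  /-- the bilinear form on each tangent space -/
  val (x : M) : TangentSpace (𝓡 d) x →L[ℝ] TangentSpace (𝓡 d) x →L[ℝ] ℝ
  symm (x : M) (v w : TangentSpace (𝓡 d) x) : val x v w = val x w v
  nondegenerate (x : M) (v : TangentSpace (𝓡 d) x) : (∀ w, val x v w = 0) → v = 0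
  contMDiff : ContMDiff (𝓡 d) ((𝓡 d).prod
      𝓘(ℝ, EuclideanSpace ℝ (Fin d) →L[ℝ] EuclideanSpace ℝ (Fin d) →L[ℝ] ℝ)) ∞
    (fun x => Bundle.TotalSpace.mk'
      (EuclideanSpace ℝ (Fin d) →L[ℝ] EuclideanSpace ℝ (Fin d) →L[ℝ] ℝ)
      (E := fun x : M => TangentSpace (𝓡 d) x →L[ℝ] TangentSpace (𝓡 d) x →L[ℝ] ℝ) x (val x))

variable {d M} in
/-- Smoothness of a vector field at a point. -/
def SmoothAt [IsManifold (𝓡 d) ∞ M] (X : VField d M) (x : M) : Prop :=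
  ContMDiffAt (𝓡 d) (𝓡 d).tangent ∞ (fun y => (⟨y, X y⟩ : TangentBundle (𝓡 d) M)) x

/-- An orientation of a manifold: an orientation of every tangent space, given near each point
by a smooth local frame. -/
structure ManifoldOrientation [IsManifold (𝓡 d) ∞ M] where
  /-- the orientation of each tangent space -/
  orient (x : M) : Orientation ℝ (TangentSpace (𝓡 d) x) (Fin d)
  locallyConsistent (x : M) : ∃ X : Fin d → VField d M, (∀ i, SmoothAt (X i) x) ∧
    ∀ᶠ y in 𝓝 x, ∃ b : Module.Basis (Fin d) ℝ (TangentSpace (𝓡 d) y),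
      (∀ i, b i = X i y) ∧ b.orientation = orient y

variable {d M}

/-- A `p`-form in the preferred chart `φ` at `x₀`: the pull-back of `α` by `φ⁻¹`. -/
def DForm.inChart {p : ℕ} (α : DForm d M p) (x₀ : M) :
    EuclideanSpace ℝ (Fin d) → (EuclideanSpace ℝ (Fin d)) [⋀^Fin p]→L[ℝ] ℝ := fun y =>
  letI := chartedSpaceSelf (EuclideanSpace ℝ (Fin d))
  (α ((extChartAt (𝓡 d) x₀).symm y)).compContinuousLinearMap
    (mfderiv 𝓘(ℝ, EuclideanSpace ℝ (Fin d)) (𝓡 d) (extChartAt (𝓡 d) x₀).symm y)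

/-- Smoothness of a `p`-form, in charts. -/
def DForm.IsSmooth {p : ℕ} (α : DForm d M p) : Prop :=
  ∀ x₀ : M, ContDiffOn ℝ ∞ (α.inChart x₀) (extChartAt (𝓡 d) x₀).target

/-- The exterior derivative, computed at `x` in the preferred chart at `x`. -/
def extD {p : ℕ} (α : DForm d M p) : DForm d M (p + 1) := fun x =>
  letI := chartedSpaceSelf (EuclideanSpace ℝ (Fin d))
  (extDeriv (α.inChart x) (extChartAt (𝓡 d) x x)).compContinuousLinearMap
    (mfderiv (𝓡 d) 𝓘(ℝ, EuclideanSpace ℝ (Fin d)) (extChartAt (𝓡 d) x) x)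

/-- The derivative `X(f)` of a function along a vector field. -/
def dirDeriv (X : VField d M) (f : M → ℝ) (x : M) : ℝ := mvfderiv (𝓡 d) f x (X x)

/-- The Lie bracket of vector fields. -/
abbrev bracket (X Y : VField d M) : VField d M := VectorField.mlieBracket (𝓡 d) X Y

section Metric

variable [IsManifold (𝓡 d) ∞ M] (g : Metric d M) (o : ManifoldOrientation d M)

/-- The codifferential `δ = ⋆⁻¹ d ⋆ η̂` from `(p + 1)`-forms to `p`-forms, where `η̂ α = (-1)^k α`
on `k`-forms (there are no non-zero `(p + 1)`-forms if `d < p + 1`). -/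
def codiff {p : ℕ} (α : DForm d M (p + 1)) : DForm d M p := fun x =>
  if h : p + 1 ≤ d then
    Function.invFun
      (hodgeStar (p := p) (q := d - (p + 1) + 1) (by omega) (g.val x) (o.orient x))
      (extD (fun y : M => hodgeStar (p := p + 1) (q := d - (p + 1)) (by omega)
        (g.val y) (o.orient y) ((-1 : ℝ) ^ (p + 1) • α y)) x)
  else 0

/-- The Laplace–de Rham operator `□ = -(dδ + δd)`; `δ` vanishes on `0`-forms. -/
def laplaceDeRham : {p : ℕ} → DForm d M p → DForm d M p
  | 0, α => -codiff g o (extD α)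
  | _ + 1, α => -(extD (codiff g o α) + codiff g o (extD α))

/-- The right-hand side of the Koszul formula for `2 g(∇_X Y, Z)`. -/
def koszul (X Y Z : VField d M) (x : M) : ℝ :=
  dirDeriv X (fun y => g.val y (Y y) (Z y)) x
    + dirDeriv Y (fun y => g.val y (Z y) (X y)) x
    - dirDeriv Z (fun y => g.val y (X y) (Y y)) x
    + g.val x (bracket X Y x) (Z x)
    - g.val x (bracket Y Z x) (X x)
    + g.val x (bracket Z X x) (Y x)

/-- The Levi-Civita connection `∇_X Y`. -/
def leviCivita (X Y : VField d M) : VField d M := fun x =>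
  Classical.epsilon fun n : TangentSpace (𝓡 d) x =>
    ∀ Z : VField d M, SmoothAt Z x → 2 * g.val x n (Z x) = koszul g X Y Z x

/-- The Levi-Civita connection on `p`-forms, by the Leibniz rule
`(∇_X α)(Y₁, …, Y_p) = X(α(Y₁, …, Y_p)) - ∑ i, α(Y₁, …, ∇_X Y_i, …, Y_p)`. -/
def nabla {p : ℕ} (X : VField d M) (α : DForm d M p) : DForm d M p := fun x =>
  Classical.epsilon fun η : (TangentSpace (𝓡 d) x) [⋀^Fin p]→L[ℝ] ℝ =>
    ∀ Y : Fin p → VField d M, (∀ i, SmoothAt (Y i) x) →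
      η (fun i => Y i x) = dirDeriv X (fun y => α y (fun i => Y i y)) x
        - ∑ i, α x (Function.update (fun j => Y j x) i (leviCivita g X (Y i) x))

/-- The second covariant derivative `∇²_{XY} = ∇_X ∇_Y - ∇_{∇_X Y}` on `p`-forms. -/
def secondNabla {p : ℕ} (X Y : VField d M) (α : DForm d M p) : DForm d M p :=
  nabla g X (nabla g Y α) - nabla g (leviCivita g X Y) α

/-- The curvature operator `R(X, Y) = ∇_X ∇_Y - ∇_Y ∇_X - ∇_{[X, Y]}` on `p`-forms. -/
def curvature {p : ℕ} (X Y : VField d M) (α : DForm d M p) : DForm d M p :=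
  nabla g X (nabla g Y α) - nabla g Y (nabla g X α) - nabla g (bracket X Y) α

/-- The curvature operator `R(X, Y) = ∇_X ∇_Y - ∇_Y ∇_X - ∇_{[X, Y]}` on vector fields. -/
def curvatureField (X Y Z : VField d M) : VField d M :=
  leviCivita g X (leviCivita g Y Z) - leviCivita g Y (leviCivita g X Z)
    - leviCivita g (bracket X Y) Z

/-- The Ricci tensor `r(u, v) = tr (w ↦ R(w, v) u)`. -/
def ricci (x : M) (u v : TangentSpace (𝓡 d) x) : ℝ :=
  LinearMap.trace ℝ (TangentSpace (𝓡 d) x) <|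
    Classical.epsilon fun A : TangentSpace (𝓡 d) x →ₗ[ℝ] TangentSpace (𝓡 d) x =>
      ∀ U V W : VField d M, SmoothAt U x → SmoothAt V x → SmoothAt W x →
        U x = u → V x = v → A (W x) = curvatureField g W V U x

/-- A smooth local frame of vector fields on an open set `s`. -/
def IsFrameOn (e : Fin d → VField d M) (s : Set M) : Prop :=
  IsOpen s ∧ IsLocalFrameOn (𝓡 d) (EuclideanSpace ℝ (Fin d)) ∞ e s

/-- The inverse metric components `g^{ab}` in a frame, at `x`. -/
def invGram (e : Fin d → VField d M) (x : M) : Matrix (Fin d) (Fin d) ℝ :=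
  (gramMatrix (g.val x) fun a => e a x)⁻¹

/-- The Laplace–Beltrami operator `Δ = tr ∇²` on `p`-forms: the `p`-form equal to
`g^{ab} (∇_a ∇_b - ∇_{∇_a e_b}) α` in every local frame. -/
def laplaceBeltrami {p : ℕ} (α : DForm d M p) : DForm d M p := fun x =>
  Classical.epsilon fun η : (TangentSpace (𝓡 d) x) [⋀^Fin p]→L[ℝ] ℝ =>
    ∀ (e : Fin d → VField d M) (s : Set M), IsFrameOn e s → x ∈ s →
      η = ∑ a, ∑ b, invGram g e x a b • secondNabla g (e a) (e b) α x

/-- The vector `e^a = g^{ab} e_b` at `x`. -/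
def raised (e : Fin d → VField d M) (a : Fin d) (x : M) : TangentSpace (𝓡 d) x :=
  ∑ b, invGram g e x a b • e b x

/-- The curvature term `j^a i^b R(e_a, e_b) α`, with `j^a = g^{ac} j_{e_c}` and
`i^b = g^{bc} i_{e_c}`. -/
def curvatureTerm {p : ℕ} (e : Fin d → VField d M) (α : DForm d M p) : DForm d M p := fun x =>
  ∑ a, ∑ b, creatorInterior (g.val x) (raised g e a x) (raised g e b x)
    (curvature g (e a) (e b) α x)

end Metric

end Manifold

end PseudoRiemannian

end

open scoped Manifold ContDiff Topology Bundle

noncomputable section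

namespace PseudoRiemannian

/-! ### Interior and exterior multiplication on one vector space. -/

section Algebra

variable {V : Type*} [AddCommGroup V] [Module ℝ V] [TopologicalSpace V]

/-! Write `e^a = g^{ab} e_b` for the `g`-dual frame, `j^a`, `i^a` for exterior and interior
multiplication by `e^a`, and `∇²_{ab}` for the second covariant derivative along `e_a`, `e_b`. The
formula is a commutation of `i` past `j`, once `d` and `δ` are expressed through `∇`.

Since `∇` is torsion-free, its Christoffel symbols in a chart are symmetric and drop out of the
alternating sum for `d`; hence `dα = j^a ∇_{e_a} α` (`extD_eq`). Since `∇` is metric, the volume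
form is parallel (`nabla_volumeField`), so `∇` commutes with the Hodge operator
(`nabla_hodgeField`). With the pointwise rule `j_v ⋆ = (-1)^p ⋆ i_v` on `(p + 1)`-forms
(`creator_hodgeStar`), the formula for `d` becomes `δα = -i^a ∇_{e_a} α` (`codiff_eq`).

The tensor `e^b ⊗ e_b` is parallel (`sum_leviCivita_dual`), so differentiating once more produces
only second covariant derivatives: `∇_X dα = j^b ∇²_{X,e_b} α` and `∇_X δα = -i^b ∇²_{X,e_b} α`.
Hence `□α = i^a j^b ∇²_{ab} α + j^a i^b ∇²_{ab} α`. The anticommutation rule `i^a j^b = g^{ab} - j^b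
i^a` gives `Δα` from the first summand, and what remains is `j^a i^b (∇²_{ab} - ∇²_{ba}) α`, where
the bracket is `R(e_a, e_b)` by vanishing torsion. On `0`-forms the `j i` terms are absent.

On a one-form, `R(X, Y)α` is the flat of `R(X, Y)♯α`, because the musical isomorphism is parallel.
The curvature term at `u` is therefore `g(e^b, R(u, e_b)♯α)`, which is minus a trace and equals
`-r(♯α, u)`.

The volume form, the Hodge operator, `♯`, both connections, `Δ` and the Ricci endomorphism are
defined by choice, so each needs an existence proof before its defining property can be used.
Existence comes from tensoriality for the connections and the Ricci endomorphism, from frame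
independence for `Δ`, and from nondegeneracy of the wedge pairing for the Hodge operator. Regularity
of forms is tested on vector fields, and identities that are to be differentiated are proved on a
neighbourhood. -/

theorem form_sub_apply {p : ℕ} (α β : V [⋀^Fin p]→L[ℝ] ℝ) (w : Fin p → V) :
    (α - β) w = α w - β w := rfl

theorem form_add_apply {p : ℕ} (α β : V [⋀^Fin p]→L[ℝ] ℝ) (w : Fin p → V) :
    (α + β) w = α w + β w := rfl

theorem form_smul_apply {p : ℕ} (c : ℝ) (α : V [⋀^Fin p]→L[ℝ] ℝ) (w : Fin p → V) :
    (c • α) w = c * α w := rfl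

/-- The interior product as a bilinear map. -/
def interiorLM (p : ℕ) : V →ₗ[ℝ] (V [⋀^Fin (p + 1)]→L[ℝ] ℝ) →ₗ[ℝ] V [⋀^Fin p]→L[ℝ] ℝ :=
  LinearMap.mk₂ ℝ interior
    (fun v v' α => by
      ext w
      have h := (α.toAlternatingMap.curryLeft.map_add v v')
      exact congrArg (fun f : V [⋀^Fin p]→ₗ[ℝ] ℝ => f w) h)
    (fun c v α => by
      ext w
      have h := (α.toAlternatingMap.curryLeft.map_smul c v)
      exact congrArg (fun f : V [⋀^Fin p]→ₗ[ℝ] ℝ => f w) h)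
    (fun v α α' => rfl) (fun c v α => rfl)

@[simp] theorem interiorLM_apply {p : ℕ} (v : V) (α : V [⋀^Fin (p + 1)]→L[ℝ] ℝ) :
    interiorLM p v α = interior v α := rfl

/-- Left multiplication by a one-form as a bilinear map. -/
def oneFormWedgeLM (p : ℕ) :
    (V →L[ℝ] ℝ) →ₗ[ℝ] (V [⋀^Fin p]→L[ℝ] ℝ) →ₗ[ℝ] V [⋀^Fin (p + 1)]→L[ℝ] ℝ :=
  LinearMap.mk₂ ℝ oneFormWedge
    (fun θ θ' α => by
      refine ContinuousAlternatingMap.ext fun w => ?_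
      simp only [oneFormWedge_apply, ContinuousAlternatingMap.add_apply,
        add_apply, ← Finset.sum_add_distrib]
      exact Finset.sum_congr rfl fun i _ => by ring)
    (fun c θ α => by
      refine ContinuousAlternatingMap.ext fun w => ?_
      simp only [oneFormWedge_apply, ContinuousAlternatingMap.smul_apply,
        smul_apply, smul_eq_mul, Finset.mul_sum]
      exact Finset.sum_congr rfl fun i _ => by ring)
    (fun θ α α' => by
      refine ContinuousAlternatingMap.ext fun w => ?_
      simp only [oneFormWedge_apply, ContinuousAlternatingMap.add_apply,
        ← Finset.sum_add_distrib]
      exact Finset.sum_congr rfl fun i _ => by ring)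
    (fun c θ α => by
      refine ContinuousAlternatingMap.ext fun w => ?_
      simp only [oneFormWedge_apply, ContinuousAlternatingMap.smul_apply,
        smul_eq_mul, Finset.mul_sum]
      exact Finset.sum_congr rfl fun i _ => by ring)

@[simp] theorem oneFormWedgeLM_apply {p : ℕ} (θ : V →L[ℝ] ℝ) (α : V [⋀^Fin p]→L[ℝ] ℝ) :
    oneFormWedgeLM p θ α = oneFormWedge θ α := rfl

/-- The creator as a bilinear map. -/
def creatorLM (g : V →L[ℝ] V →L[ℝ] ℝ) (p : ℕ) :
    V →ₗ[ℝ] (V [⋀^Fin p]→L[ℝ] ℝ) →ₗ[ℝ] V [⋀^Fin (p + 1)]→L[ℝ] ℝ :=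
  (oneFormWedgeLM p).comp g.toLinearMap

@[simp] theorem creatorLM_apply (g : V →L[ℝ] V →L[ℝ] ℝ) {p : ℕ} (v : V)
    (α : V [⋀^Fin p]→L[ℝ] ℝ) : creatorLM g p v α = creator g v α := rfl

/-- This is the tool for induction on the degree: an identity between forms is checked after
contraction with every vector, where the commutation rules lower the degree. -/
theorem ext_interior {p : ℕ} {α β : V [⋀^Fin (p + 1)]→L[ℝ] ℝ}
    (h : ∀ v, interior v α = interior v β) : α = β := by
  ext w
  have := congrArg (fun f : V [⋀^Fin p]→L[ℝ] ℝ => f (Fin.tail w)) (h (w 0))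
  simpa only [interior_apply, Fin.cons_self_tail] using this

theorem ext_zero_form {α β : V [⋀^Fin 0]→L[ℝ] ℝ} (h : α ![] = β ![]) : α = β := by
  ext w
  rwa [Subsingleton.elim w ![]]

/-- Polarisation of `i_u i_u = 0`, which is the alternating property in the first two slots. -/
theorem interior_interior {p : ℕ} (v w : V) (α : V [⋀^Fin (p + 2)]→L[ℝ] ℝ) :
    interior v (interior w α) = -interior w (interior v α) := by
  have key : ∀ u, interior u (interior u α) = 0 := fun u => by
    ext c
    rw [interior_apply, interior_apply]
    exact α.map_eq_zero_of_eq _ (i := 0) (j := 1) (by simp) (by simp)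
  have h := key (v + w)
  simp only [← interiorLM_apply, map_add, LinearMap.add_apply] at h key
  simp only [← interiorLM_apply]
  rw [key v, key w] at h
  rw [eq_neg_iff_add_eq_zero, ← h]
  abel

theorem interior_oneFormWedge_zero (v : V) (θ : V →L[ℝ] ℝ) (α : V [⋀^Fin 0]→L[ℝ] ℝ) :
    interior v (oneFormWedge θ α) = θ v • α := by
  refine ContinuousAlternatingMap.ext fun w => ?_
  rw [interior_apply, oneFormWedge_apply]
  rw [Fin.sum_univ_one, Subsingleton.elim (Fin.removeNth 0 (Fin.cons v w : Fin 1 → V)) w]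
  simp

/-- In the alternating sum for the wedge, the summand in which `θ` takes the inserted vector gives
`θ(v) α`; in the others all positions shift by one, whence the minus sign. -/
theorem interior_oneFormWedge {p : ℕ} (v : V) (θ : V →L[ℝ] ℝ) (α : V [⋀^Fin (p + 1)]→L[ℝ] ℝ) :
    interior v (oneFormWedge θ α) = θ v • α - oneFormWedge θ (interior v α) := by
  refine ContinuousAlternatingMap.ext fun w => ?_
  rw [interior_apply, oneFormWedge_apply, Fin.sum_univ_succ]
  rw [form_sub_apply, form_smul_apply, oneFormWedge_apply, sub_eq_add_neg,
    ← Finset.sum_neg_distrib]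
  congr 1
  · simp
  · refine Finset.sum_congr rfl fun i _ => ?_
    have : Fin.removeNth i.succ (Fin.cons v w : Fin (p + 2) → V)
        = Fin.cons v (Fin.removeNth i w) := by
      funext j
      refine Fin.cases ?_ (fun j => ?_) j <;> simp [Fin.removeNth]
    rw [this]
    simp [pow_succ, interior_apply]

/-- Contracting with `v`, the two terms `θ(v) θ ∧ α` cancel and `θ ∧ θ ∧ i_v α` is left, which has
lower degree. -/
theorem oneFormWedge_self {p : ℕ} (θ : V →L[ℝ] ℝ) (α : V [⋀^Fin p]→L[ℝ] ℝ) :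
    oneFormWedge θ (oneFormWedge θ α) = 0 := by
  induction p with
  | zero =>
    refine ext_interior fun v => ?_
    rw [interior_oneFormWedge, interior_oneFormWedge_zero]
    simp only [← oneFormWedgeLM_apply, ← interiorLM_apply, map_smul, map_zero, sub_self]
  | succ p ih =>
    refine ext_interior fun v => ?_
    rw [interior_oneFormWedge, interior_oneFormWedge]
    have := ih (interior v α)
    simp only [← oneFormWedgeLM_apply, ← interiorLM_apply, map_sub, map_smul, map_zero] at this ⊢
    rw [this]; simp

theorem oneFormWedge_anticomm {p : ℕ} (θ θ' : V →L[ℝ] ℝ) (α : V [⋀^Fin p]→L[ℝ] ℝ) :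
    oneFormWedge θ (oneFormWedge θ' α) = -oneFormWedge θ' (oneFormWedge θ α) := by
  have h := oneFormWedge_self (θ + θ') α
  have h1 := oneFormWedge_self θ α
  have h2 := oneFormWedge_self θ' α
  simp only [← oneFormWedgeLM_apply, map_add, LinearMap.add_apply] at h h1 h2 ⊢
  rw [h1, h2] at h
  rw [eq_neg_iff_add_eq_zero, ← h]
  abel

/-- `E` is the `g`-dual basis of `e`. -/
structure IsDualFrame {n : ℕ} (g : V →L[ℝ] V →L[ℝ] ℝ) (e E : Fin n → V) : Prop where
  apply_eq : ∀ a b, g (E a) (e b) = if a = b then 1 else 0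
  sum_eq : ∀ v, ∑ a, g (E a) v • e a = v

/-- By nondegeneracy the roles of the frame and its dual can be exchanged: pair with `w` and expand
`w` in the frame. -/
theorem IsDualFrame.sum_eq' {n : ℕ} {g : V →L[ℝ] V →L[ℝ] ℝ} (hs : ∀ v w, g v w = g w v)
    (hn : ∀ v, (∀ w, g v w = 0) → v = 0) {e E : Fin n → V} (h : IsDualFrame g e E) (v : V) :
    ∑ a, g (e a) v • E a = v := by
  rw [← sub_eq_zero]
  refine hn _ fun w => ?_
  rw [map_sub, map_sum, sub_apply, sub_eq_zero]
  conv_rhs => rw [← h.sum_eq w, map_sum]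
  simp only [map_smul, sum_apply, smul_apply, smul_eq_mul]
  exact Finset.sum_congr rfl fun a _ => by rw [hs (e a) v, mul_comm]

theorem isDualFrame_of_basis {n : ℕ} {g : V →L[ℝ] V →L[ℝ] ℝ} (hs : ∀ v w, g v w = g w v)
    (hn : ∀ v, (∀ w, g v w = 0) → v = 0) (b : Module.Basis (Fin n) ℝ V) :
    IsDualFrame g b fun a => ∑ c, (gramMatrix g b)⁻¹ a c • b c := by
  have hdet := gramMatrix_det_ne_zero g hs hn b
  have h1 : ∀ a c, g (∑ k, (gramMatrix g b)⁻¹ a k • b k) (b c) = if a = c then 1 else 0 := by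
    intro a c
    have := congrFun (congrFun (Matrix.nonsing_inv_mul (gramMatrix g b)
      (isUnit_iff_ne_zero.mpr hdet)) a) c
    rw [Matrix.mul_apply, Matrix.one_apply] at this
    rw [← this]
    simp [gramMatrix]
  refine ⟨h1, fun v => ?_⟩
  conv_rhs => rw [← b.sum_repr v]
  refine Finset.sum_congr rfl fun a _ => ?_
  congr 1
  conv_lhs => rw [← b.sum_repr v, map_sum]
  simp only [map_smul, h1, smul_eq_mul]
  simp

/-- The number operator. Contracting with `v`, the scalar terms resum to `i_v α`, and the rest is
the same operator applied to `i_v α`, one degree lower. -/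
theorem sum_creator_interior {n p : ℕ} {g : V →L[ℝ] V →L[ℝ] ℝ} {e E : Fin n → V}
    (h : IsDualFrame g e E) (α : V [⋀^Fin (p + 1)]→L[ℝ] ℝ) :
    ∑ a, creator g (E a) (interior (e a) α) = ((p + 1 : ℕ) : ℝ) • α := by
  have hv : ∀ {q : ℕ} (v : V) (α : V [⋀^Fin (q + 1)]→L[ℝ] ℝ),
      ∑ a, g (E a) v • interior (e a) α = interior v α := by
    intro q v α
    conv_rhs => rw [← h.sum_eq v]
    simp only [← interiorLM_apply, map_sum, map_smul, LinearMap.sum_apply, LinearMap.smul_apply]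
  induction p with
  | zero =>
    refine ext_interior fun v => ?_
    simp only [← interiorLM_apply, map_sum]
    simp only [interiorLM_apply, creator, interior_oneFormWedge_zero, hv]
    simp
  | succ p ih =>
    refine ext_interior fun v => ?_
    have h2 := ih (interior v α)
    simp only [creator, ← interiorLM_apply, map_sum, map_smul] at h2 ⊢
    simp only [interiorLM_apply, interior_oneFormWedge, Finset.sum_sub_distrib, hv] at h2 ⊢
    have h3 : ∀ a, oneFormWedge (g (E a)) (interior v (interior (e a) α))
        = -oneFormWedge (g (E a)) (interior (e a) (interior v α)) := by
      intro a
      rw [interior_interior v (e a)]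
      simp only [← oneFormWedgeLM_apply, map_neg]
    simp only [h3, Finset.sum_neg_distrib, h2, sub_neg_eq_add]
    push_cast
    module

/-- Anticommuting turns this into `∑ g(E_a, e_a) = n` minus the number operator. -/
theorem sum_interior_creator {n p : ℕ} {g : V →L[ℝ] V →L[ℝ] ℝ} {e E : Fin n → V}
    (h : IsDualFrame g e E) (α : V [⋀^Fin p]→L[ℝ] ℝ) :
    ∑ a, interior (e a) (creator g (E a) α) = ((n : ℝ) - p) • α := by
  cases p with
  | zero =>
    simp only [creator, interior_oneFormWedge_zero, h.apply_eq]
    simp [← Nat.cast_smul_eq_nsmul ℝ]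
  | succ p =>
    have := sum_creator_interior h α
    simp only [creator] at this ⊢
    simp only [interior_oneFormWedge, h.apply_eq, Finset.sum_sub_distrib, this]
    simp only [if_true, one_smul, Finset.sum_const,
      Finset.card_univ, Fintype.card_fin, ← Nat.cast_smul_eq_nsmul ℝ]
    module

theorem form_eq_zero_of_lt {n p : ℕ} {g : V →L[ℝ] V →L[ℝ] ℝ} {e E : Fin n → V}
    (h : IsDualFrame g e E) (hp : n < p) (α : V [⋀^Fin p]→L[ℝ] ℝ) : α = 0 := by
  have hmem : ∀ v : V, v ∈ Submodule.span ℝ (Set.range e) := fun v => by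
    rw [← h.sum_eq v]
    exact Submodule.sum_mem _ fun a _ => Submodule.smul_mem _ _ (Submodule.subset_span ⟨a, rfl⟩)
  have htop : Submodule.span ℝ (Set.range e) = ⊤ := Submodule.eq_top_iff'.mpr hmem
  have hfr : Module.finrank ℝ V ≤ n := by
    rw [← finrank_top, ← htop]
    simpa [Set.finrank] using finrank_range_le_card (R := ℝ) e
  have : Module.Finite ℝ V := ⟨(Set.finite_range e).toFinset, by simpa using htop⟩
  ext w
  refine α.toAlternatingMap.map_linearDependent w fun hw => ?_
  have := hw.fintype_card_le_finrank
  simp at this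
  omega

/-- The operator `∑ i_{e_a} j_{E_a}` is the scalar `n - p`, nonzero below the top degree. Uniqueness
of Hodge duals and their commutation with `∇` both rest on this. -/
theorem creator_injective {n p : ℕ} {g : V →L[ℝ] V →L[ℝ] ℝ} {e E : Fin n → V}
    (h : IsDualFrame g e E) (hp : p < n) {α : V [⋀^Fin p]→L[ℝ] ℝ}
    (h0 : ∀ v, creator g v α = 0) : α = 0 := by
  have h1 := sum_interior_creator h α
  simp only [h0, ← interiorLM_apply, map_zero, Finset.sum_const_zero] at h1
  have h2 : ((n : ℝ) - p) ≠ 0 := sub_ne_zero.mpr (by exact_mod_cast hp.ne')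
  exact (smul_eq_zero.mp h1.symm).resolve_left h2

end Algebra

/-! ### Wedge products, computed on decomposable forms. -/

section Wedge

variable {V : Type*} [AddCommGroup V] [Module ℝ V] [TopologicalSpace V]

/-- The decomposable form `c₀ ∧ ⋯ ∧ c_{p-1}`. -/
def decomposable : {p : ℕ} → (Fin p → V →L[ℝ] ℝ) → V [⋀^Fin p]→L[ℝ] ℝ
  | 0, _ => ContinuousAlternatingMap.constOfIsEmpty ℝ V (Fin 0) 1
  | _ + 1, c => oneFormWedge (c 0) (decomposable (Fin.tail c))

theorem decomposable_apply {p : ℕ} (c : Fin p → V →L[ℝ] ℝ) (v : Fin p → V) :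
    decomposable c v = (Matrix.of fun i j => c i (v j)).det := by
  induction p with
  | zero => simp [decomposable]
  | succ p ih =>
    rw [decomposable, oneFormWedge_apply, Matrix.det_succ_row_zero]
    refine Finset.sum_congr rfl fun i _ => ?_
    rw [ih, mul_assoc]
    rfl

theorem decomposable_cons {p : ℕ} (θ : V →L[ℝ] ℝ) (c : Fin p → V →L[ℝ] ℝ) :
    decomposable (Fin.cons θ c : Fin (p + 1) → V →L[ℝ] ℝ) = oneFormWedge θ (decomposable c) := by
  rw [decomposable, Fin.cons_zero, Fin.tail_cons]

/-- Concatenation of two families of one-forms. -/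
def cat {X : Type*} {p q n : ℕ} (h : p + q = n) (c : Fin p → X) (c' : Fin q → X) : Fin n → X :=
  fun k => Sum.elim c c' ((finSumFinEquiv.trans (finCongr h)).symm k)

theorem cat_cons {X : Type*} {p q n : ℕ} (h : p + q = n) (h' : p + 1 + q = n + 1) (θ : X)
    (c : Fin p → X) (c' : Fin q → X) :
    cat h' (Fin.cons θ c : Fin (p + 1) → X) c' = Fin.cons θ (cat h c c') := by
  subst h
  funext k
  obtain ⟨k, rfl⟩ := (finSumFinEquiv.trans (finCongr h')).surjective k
  rw [cat, Equiv.symm_apply_apply]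
  rcases k with i | j
  · refine Fin.cases ?_ (fun i => ?_) i
    · rfl
    · have : (finSumFinEquiv.trans (finCongr h')) (Sum.inl i.succ)
          = Fin.succ ((finSumFinEquiv.trans (finCongr rfl)) (Sum.inl i)) := by
        ext; simp
      rw [this, Fin.cons_succ, cat, Equiv.symm_apply_apply]
      simp
  · have : (finSumFinEquiv.trans (finCongr h')) (Sum.inr j)
          = Fin.succ ((finSumFinEquiv.trans (finCongr rfl)) (Sum.inr j)) := by
        ext; simp; omega
    rw [this, Fin.cons_succ, cat, Equiv.symm_apply_apply]
    simp

theorem cat_zero {X : Type*} {q n : ℕ} (h : 0 + q = n) (h' : q = n) (c : Fin 0 → X)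
    (c' : Fin q → X) : cat h c c' = c' ∘ Fin.cast h'.symm := by
  subst h'
  funext k
  obtain ⟨k, rfl⟩ := (finSumFinEquiv.trans (finCongr h)).surjective k
  rw [cat, Equiv.symm_apply_apply]
  rcases k with i | j
  · exact i.elim0
  · simp only [Sum.elim_inr, Function.comp]
    congr 1
    ext; simp

/-- Moving `θ` past the `p` factors of `c` takes `p` transpositions of neighbouring one-forms. -/
theorem decomposable_swap {p q n : ℕ} (h : p + 1 + q = n) (h' : p + (q + 1) = n)
    (θ : V →L[ℝ] ℝ) (c : Fin p → V →L[ℝ] ℝ) (c' : Fin q → V →L[ℝ] ℝ) :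
    decomposable (cat h (Fin.cons θ c : Fin (p + 1) → V →L[ℝ] ℝ) c')
      = (-1 : ℝ) ^ p • decomposable (cat h' c (Fin.cons θ c' : Fin (q + 1) → V →L[ℝ] ℝ)) := by
  obtain ⟨n, rfl⟩ : ∃ m, n = m + 1 := ⟨p + q, by omega⟩
  induction p generalizing n with
  | zero =>
    obtain rfl : q = n := by omega
    rw [cat_cons (by omega) h, cat_zero h' rfl, cat_zero (by omega) rfl]
    simp
  | succ p ih =>
    obtain ⟨m, rfl⟩ : ∃ m, n = m + 1 := ⟨p + q, by omega⟩
    have hc : c = Fin.cons (c 0) (Fin.tail c) := (Fin.cons_self_tail c).symm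
    rw [cat_cons (by omega : p + 1 + q = m + 1) h, hc, cat_cons (by omega : p + q = m) (by omega),
      cat_cons (by omega : p + (q + 1) = m + 1) h', decomposable_cons, decomposable_cons,
      decomposable_cons, oneFormWedge_anticomm, ← decomposable_cons θ,
      ← cat_cons (by omega : p + q = m) (by omega : p + 1 + q = m + 1), ih _ m (by omega) (by omega)]
    simp only [← oneFormWedgeLM_apply, map_smul, pow_succ]
    module

/-- A decomposable form is the alternatisation of a plain product of one-forms, and the shuffle
product of two alternatisations is the alternatisation of the product. No factorials appear. -/
theorem wedge_decomposable {p q n : ℕ} (h : p + q = n) (c : Fin p → V →L[ℝ] ℝ)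
    (c' : Fin q → V →L[ℝ] ℝ) :
    wedge h (decomposable c) (decomposable c') = (decomposable (cat h c c')).toAlternatingMap := by
  have hdec : ∀ {r : ℕ} (c : Fin r → V →L[ℝ] ℝ), (decomposable c).toAlternatingMap
      = MultilinearMap.alternatization ((MultilinearMap.mkPiAlgebra ℝ (Fin r) ℝ).compLinearMap
          fun i => (c i).toLinearMap) := by
    intro r c
    ext v
    change decomposable c v = _
    rw [decomposable_apply, MultilinearMap.alternatization_apply, ← Matrix.det_transpose,
      Matrix.det_apply]
    refine Finset.sum_congr rfl fun σ _ => ?_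
    simp [MultilinearMap.domDomCongr_apply]
  rw [wedge, hdec c, hdec c', ← MultilinearMap.domCoprod_alternization]
  ext v
  change LinearMap.mul' ℝ ℝ (MultilinearMap.alternatization _
    fun i => v ((finSumFinEquiv.trans (finCongr h)) i)) = decomposable (cat h c c') v
  rw [decomposable_apply, ← Matrix.det_submatrix_equiv_self (finSumFinEquiv.trans (finCongr h)),
    ← Matrix.det_transpose, Matrix.det_apply, MultilinearMap.alternatization_apply, map_sum]
  refine Finset.sum_congr rfl fun σ _ => ?_
  rw [map_zsmul_unit]
  congr 1
  simp [MultilinearMap.domDomCongr_apply, MultilinearMap.domCoprod_apply, Fintype.prod_sum_type, cat]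

theorem wedge_add_left {p q n : ℕ} (h : p + q = n) (β β' : V [⋀^Fin p]→L[ℝ] ℝ)
    (γ : V [⋀^Fin q]→L[ℝ] ℝ) : wedge h (β + β') γ = wedge h β γ + wedge h β' γ := by
  have h1 : (β + β').toAlternatingMap = β.toAlternatingMap + β'.toAlternatingMap := rfl
  simp only [wedge, h1, ← AlternatingMap.domCoprod'_apply, TensorProduct.add_tmul, map_add]
  ext v
  exact map_add (LinearMap.mul' ℝ ℝ) _ _

theorem wedge_smul_left {p q n : ℕ} (h : p + q = n) (r : ℝ) (β : V [⋀^Fin p]→L[ℝ] ℝ)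
    (γ : V [⋀^Fin q]→L[ℝ] ℝ) : wedge h (r • β) γ = r • wedge h β γ := by
  have h1 : (r • β).toAlternatingMap = r • β.toAlternatingMap := rfl
  simp only [wedge, h1, ← AlternatingMap.domCoprod'_apply, ← TensorProduct.smul_tmul', map_smul]
  ext v
  exact map_smul (LinearMap.mul' ℝ ℝ) _ _

theorem wedge_add_right {p q n : ℕ} (h : p + q = n) (β : V [⋀^Fin p]→L[ℝ] ℝ)
    (γ γ' : V [⋀^Fin q]→L[ℝ] ℝ) : wedge h β (γ + γ') = wedge h β γ + wedge h β γ' := by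
  have h1 : (γ + γ').toAlternatingMap = γ.toAlternatingMap + γ'.toAlternatingMap := rfl
  simp only [wedge, h1, ← AlternatingMap.domCoprod'_apply, TensorProduct.tmul_add, map_add]
  ext v
  exact map_add (LinearMap.mul' ℝ ℝ) _ _

theorem wedge_smul_right {p q n : ℕ} (h : p + q = n) (r : ℝ) (β : V [⋀^Fin p]→L[ℝ] ℝ)
    (γ : V [⋀^Fin q]→L[ℝ] ℝ) : wedge h β (r • γ) = r • wedge h β γ := by
  have h1 : (r • γ).toAlternatingMap = r • γ.toAlternatingMap := rfl
  simp only [wedge, h1, ← AlternatingMap.domCoprod'_apply, TensorProduct.tmul_smul, map_smul]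
  ext v
  exact map_smul (LinearMap.mul' ℝ ℝ) _ _

/-- Forms are spanned by the decomposable forms `♭c₀ ∧ ⋯ ∧ ♭c_{p-1}`. -/
theorem form_induction {n : ℕ} {g : V →L[ℝ] V →L[ℝ] ℝ} {e E : Fin n → V}
    (h : IsDualFrame g e E) {p : ℕ} {P : (V [⋀^Fin p]→L[ℝ] ℝ) → Prop}
    (hadd : ∀ α β, P α → P β → P (α + β)) (hsmul : ∀ (r : ℝ) α, P α → P (r • α))
    (hdec : ∀ c : Fin p → V, P (decomposable fun i => g (c i))) (α : V [⋀^Fin p]→L[ℝ] ℝ) : P α := by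
  -- `P 0` is not assumed; it follows by scaling any decomposable form by zero.
  have hzero : ∀ {q : ℕ} {P : (V [⋀^Fin q]→L[ℝ] ℝ) → Prop}, (∀ (r : ℝ) α, P α → P (r • α)) →
      (∀ c : Fin q → V, P (decomposable fun i => g (c i))) → P 0 := fun h1 h2 => by
    simpa using h1 0 _ (h2 0)
  induction p with
  | zero =>
    have : α = α ![] • decomposable fun i : Fin 0 => g (i.elim0) := by
      refine ext_zero_form ?_
      rw [form_smul_apply, decomposable_apply]; simp
    rw [this]
    convert! hsmul _ _ (hdec fun i => i.elim0) using 1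
  | succ p ih =>
    have h1 : ∀ v (β : V [⋀^Fin p]→L[ℝ] ℝ), P (creator g v β) := by
      intro v β
      refine ih (P := fun β => P (creator g v β)) ?_ ?_ ?_ β
      · intro a b ha hb
        simp only [← creatorLM_apply, map_add] at ha hb ⊢
        exact hadd _ _ ha hb
      · intro r a ha
        simp only [← creatorLM_apply, map_smul] at ha ⊢
        exact hsmul _ _ ha
      · intro c
        have := hdec (Fin.cons v c)
        convert! this using 1
    -- Divided by its eigenvalue `p + 1`, the number operator displays `α` as a sum of products `♭v
    -- ∧ β` with `β` of lower degree.
    have h2 := sum_creator_interior h α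
    have h3 : α = ((p + 1 : ℕ) : ℝ)⁻¹ • ∑ a, creator g (E a) (interior (e a) α) := by
      rw [h2, smul_smul, inv_mul_cancel₀ (by positivity), one_smul]
    rw [h3]
    exact hsmul _ _ (Finset.sum_induction _ P hadd (hzero hsmul hdec) fun a _ => h1 _ _)

/-- Both sides are bilinear in `β` and `γ`, so decomposable forms suffice, and there the claim is
the reordering of a list of one-forms. -/
theorem wedge_oneFormWedge {n d : ℕ} {g : V →L[ℝ] V →L[ℝ] ℝ} {e E : Fin d → V}
    (hE : IsDualFrame g e E) {p q : ℕ} (h : p + 1 + q = n) (h' : p + (q + 1) = n)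
    (θ : V →L[ℝ] ℝ) (β : V [⋀^Fin p]→L[ℝ] ℝ) (γ : V [⋀^Fin q]→L[ℝ] ℝ) :
    wedge h (oneFormWedge θ β) γ = (-1 : ℝ) ^ p • wedge h' β (oneFormWedge θ γ) := by
  refine form_induction hE (P := fun β => wedge h (oneFormWedge θ β) γ
    = (-1 : ℝ) ^ p • wedge h' β (oneFormWedge θ γ)) ?_ ?_ (fun c => ?_) β
  · intro a b ha hb
    rw [wedge_add_left, ← oneFormWedgeLM_apply, map_add, wedge_add_left, oneFormWedgeLM_apply,
      oneFormWedgeLM_apply, ha, hb, smul_add]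
  · intro r a ha
    rw [wedge_smul_left, ← oneFormWedgeLM_apply, map_smul, wedge_smul_left, oneFormWedgeLM_apply,
      ha, smul_comm]
  refine form_induction hE (P := fun γ => wedge h (oneFormWedge θ (decomposable fun i => g (c i))) γ
    = (-1 : ℝ) ^ p • wedge h' (decomposable fun i => g (c i)) (oneFormWedge θ γ)) ?_ ?_
      (fun c' => ?_) γ
  · intro a b ha hb
    rw [wedge_add_right, ← oneFormWedgeLM_apply (α := a + b), map_add, wedge_add_right,
      oneFormWedgeLM_apply, oneFormWedgeLM_apply, ha, hb, smul_add]
  · intro r a ha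
    rw [wedge_smul_right, ← oneFormWedgeLM_apply (α := r • a), map_smul, wedge_smul_right,
      oneFormWedgeLM_apply, ha, smul_comm]
  rw [← decomposable_cons, ← decomposable_cons, wedge_decomposable, wedge_decomposable,
    decomposable_swap h h']
  rfl

theorem wedge_zero_form {n : ℕ} (h : 0 + n = n) (α : V [⋀^Fin 0]→L[ℝ] ℝ)
    (γ : V [⋀^Fin n]→L[ℝ] ℝ) {d : ℕ} {g : V →L[ℝ] V →L[ℝ] ℝ} {e E : Fin d → V}
    (hE : IsDualFrame g e E) : wedge h α γ = α ![] • γ.toAlternatingMap := by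
  have h1 : α = α ![] • decomposable (fun i : Fin 0 => (i.elim0 : V →L[ℝ] ℝ)) := by
    refine ext_zero_form ?_
    rw [form_smul_apply, decomposable_apply]; simp
  conv_lhs => rw [h1]
  rw [wedge_smul_left]
  congr 1
  refine form_induction hE (P := fun γ => wedge h (decomposable fun i : Fin 0 =>
    (i.elim0 : V →L[ℝ] ℝ)) γ = γ.toAlternatingMap) ?_ ?_ (fun c => ?_) γ
  · intro a b ha hb
    rw [wedge_add_right, ha, hb]; rfl
  · intro r a ha
    rw [wedge_smul_right, ha]; rfl
  · rw [wedge_decomposable, cat_zero h rfl]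
    rfl

end Wedge

/-! ### The volume form in arbitrary signature. -/

section Volume

variable {V : Type*} [AddCommGroup V] [Module ℝ V] [TopologicalSpace V]
  {d : ℕ} {g : V →L[ℝ] V →L[ℝ] ℝ}

/-- The pairing matrix is `UᵀGV`, with `U`, `V` the coordinate matrices in `b` and `G` the Gram
matrix of `b`. -/
theorem det_pairing (b : Module.Basis (Fin d) ℝ V) (u v : Fin d → V) :
    (Matrix.of fun i j => g (u i) (v j)).det = b.det u * (gramMatrix g b).det * b.det v := by
  have : (Matrix.of fun i j => g (u i) (v j))
      = (b.toMatrix u).transpose * gramMatrix g b * b.toMatrix v := by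
    ext i j
    rw [Matrix.of_apply]
    conv_lhs => rw [← b.sum_repr (u i), ← b.sum_repr (v j)]
    simp only [map_sum, map_smul, sum_apply, smul_apply, Matrix.mul_apply, Matrix.transpose_apply,
      Module.Basis.toMatrix_apply, gramMatrix, Matrix.of_apply, smul_eq_mul, Finset.sum_mul,
      Finset.mul_sum]
    refine Finset.sum_congr rfl fun k _ => Finset.sum_congr rfl fun l _ => ?_
    ring
  rw [this, Matrix.det_mul, Matrix.det_mul, Matrix.det_transpose, b.det_apply, b.det_apply]

theorem IsOrthonormal.abs_det {e : Module.Basis (Fin d) ℝ V} (he : IsOrthonormal g e) :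
    |(gramMatrix g e).det| = 1 := by
  have : gramMatrix g e = Matrix.diagonal fun a => g (e a) (e a) := by
    ext a b
    rcases eq_or_ne a b with rfl | h
    · simp [gramMatrix]
    · simp [gramMatrix, Matrix.diagonal_apply_ne _ h, he.1 a b h]
  rw [this, Matrix.det_diagonal, Finset.abs_prod]
  refine Finset.prod_eq_one fun a _ => ?_
  rcases he.2 a with h | h <;> rw [h] <;> simp

/-- This is the well-definedness of the volume form: the transition determinant is positive, and its
square relates two Gram determinants of absolute value one, so it equals one. -/
theorem IsOrthonormal.det_eq {e e' : Module.Basis (Fin d) ℝ V} (he : IsOrthonormal g e)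
    (he' : IsOrthonormal g e') (h : e.orientation = e'.orientation) : e.det = e'.det := by
  have hpos := (Module.Basis.orientation_eq_iff_det_pos e e').mp h
  have h1 : (gramMatrix g e').det = e.det e' * (gramMatrix g e).det * e.det e' :=
    det_pairing e e' e'
  have h2 := congrArg abs h1
  rw [abs_mul, abs_mul, he.abs_det, he'.abs_det, abs_of_pos hpos, mul_one] at h2
  have h3 : e.det e' = 1 := by nlinarith
  rw [e.det.eq_smul_basis_det e', h3, one_smul]

/-- An orthogonal basis has no isotropic member, since such a vector would be orthogonal to
everything. It can therefore be normalised by `|g(v, v)|^{-1/2}`, and sign changes correct the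
orientation without affecting orthonormality. -/
theorem exists_orthonormal_oriented [FiniteDimensional ℝ V] (hs : ∀ v w, g v w = g w v)
    (hn : ∀ v, (∀ w, g v w = 0) → v = 0) {o : Orientation ℝ V (Fin d)}
    (ho : ∃ b : Module.Basis (Fin d) ℝ V, b.orientation = o) :
    ∃ e : Module.Basis (Fin d) ℝ V, IsOrthonormal g e ∧ e.orientation = o := by
  obtain ⟨b, rfl⟩ := ho
  have hfr : Module.finrank ℝ V = d := by simpa using Module.finrank_eq_card_basis b
  let B : LinearMap.BilinForm ℝ V := (ContinuousLinearMap.coeLM ℝ).comp g.toLinearMap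
  have hB : ∀ v w, B v w = g v w := fun _ _ => rfl
  let : Invertible (2 : ℝ) := invertibleOfNonzero two_ne_zero
  obtain ⟨v, hv⟩ := LinearMap.BilinForm.exists_orthogonal_basis (B := B) ⟨fun v w => hs v w⟩
  rw [LinearMap.isOrthoᵢ_def] at hv
  subst hfr
  have hne : ∀ a, g (v a) (v a) ≠ 0 := by
    intro a h0
    refine v.ne_zero a (hn _ fun w => ?_)
    rw [← v.sum_repr w, map_sum]
    refine Finset.sum_eq_zero fun c _ => ?_
    rw [map_smul]
    rcases eq_or_ne a c with rfl | hac
    · rw [h0, smul_zero]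
    · rw [← hB, hv a c hac, smul_zero]
  have hu : ∀ a, IsUnit (Real.sqrt |g (v a) (v a)|)⁻¹ := fun a =>
    isUnit_iff_ne_zero.mpr (inv_ne_zero (Real.sqrt_ne_zero'.mpr (abs_pos.mpr (hne a))))
  let w := v.isUnitSMul hu
  have hw : IsOrthonormal g w := by
    refine ⟨fun a c hac => ?_, fun a => ?_⟩
    · simp only [w, Module.Basis.isUnitSMul_apply, map_smul, smul_apply, ← hB, hv a c hac, smul_zero]
    · simp only [w, Module.Basis.isUnitSMul_apply, map_smul, smul_apply, smul_eq_mul]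
      rw [← mul_assoc, ← mul_inv, Real.mul_self_sqrt (abs_nonneg _)]
      rcases lt_or_gt_of_ne (hne a) with h | h
      · right; rw [abs_of_neg h]; field_simp [hne a]
      · left; rw [abs_of_pos h]; field_simp
  -- In dimension zero there is no vector whose sign could be changed, but every determinant is one,
  -- so any two bases have the same orientation.
  rcases isEmpty_or_nonempty (Fin (Module.finrank ℝ V)) with hE | hN
  · refine ⟨w, hw, ?_⟩
    rw [Module.Basis.orientation_eq_iff_det_pos]
    simp
  · refine ⟨w.adjustToOrientation b.orientation, ?_, w.orientation_adjustToOrientation _⟩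
    have hsign : ∀ a, ∃ s : ℝ, s * s = 1 ∧ w.adjustToOrientation b.orientation a = s • w a := by
      intro a
      rcases w.adjustToOrientation_apply_eq_or_eq_neg b.orientation a with h | h
      · exact ⟨1, by norm_num, by rw [h, one_smul]⟩
      · exact ⟨-1, by norm_num, by rw [h, neg_one_smul]⟩
    refine ⟨fun a c hac => ?_, fun a => ?_⟩
    · obtain ⟨s, -, h1⟩ := hsign a
      obtain ⟨t, -, h2⟩ := hsign c
      rw [h1, h2, map_smul, map_smul, smul_apply, hw.1 a c hac, smul_zero, smul_zero]
    · obtain ⟨s, h0, h1⟩ := hsign a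
      rw [h1, map_smul, map_smul, smul_apply, smul_smul, h0, one_smul]
      exact hw.2 a

theorem volumeForm_eq_det [FiniteDimensional ℝ V] {o : Orientation ℝ V (Fin d)}
    (e : Module.Basis (Fin d) ℝ V)
    (he : IsOrthonormal g e) (heo : e.orientation = o) : volumeForm g o = e.det := by
  refine Classical.epsilon_spec (p := fun vol : V [⋀^Fin d]→ₗ[ℝ] ℝ =>
    ∀ e : Module.Basis (Fin d) ℝ V, IsOrthonormal g e → e.orientation = o → vol = e.det)
    ⟨e.det, fun e' he' heo' => he.det_eq he' (heo.trans heo'.symm)⟩ e he heo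

/-- The volume form on a basis `e`, in terms of a positively oriented basis `b`. -/
theorem volumeForm_apply [FiniteDimensional ℝ V] (hs : ∀ v w, g v w = g w v)
    (hn : ∀ v, (∀ w, g v w = 0) → v = 0) (b e : Module.Basis (Fin d) ℝ V) :
    volumeForm g b.orientation e
      = SignType.sign (e.det b) * Real.sqrt |(gramMatrix g e).det| := by
  obtain ⟨f, hf, hfo⟩ := exists_orthonormal_oriented hs hn ⟨b, rfl⟩
  rw [volumeForm_eq_det f hf hfo]
  have hpos := (Module.Basis.orientation_eq_iff_det_pos f b).mp hfo
  have h1 : (gramMatrix g e).det = f.det e * (gramMatrix g f).det * f.det e := det_pairing f e e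
  have h2 : Real.sqrt |(gramMatrix g e).det| = |f.det e| := by
    rw [h1, abs_mul, abs_mul, hf.abs_det, mul_one, Real.sqrt_mul_self (abs_nonneg _)]
  have h3 : f.det b = f.det e * e.det b := by
    conv_lhs => rw [f.det.eq_smul_basis_det e]
    rfl
  rw [h2]
  -- Now `f.det e * e.det b > 0`, so both factors have the same sign, which is the sign in the
  -- claim.
  rw [h3] at hpos
  rcases lt_trichotomy (f.det e) 0 with h | h | h
  · have : e.det b < 0 := by by_contra hc; push Not at hc; nlinarith
    rw [sign_neg this, abs_of_neg h]; simp
  · rw [h] at hpos; simp at hpos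
  · have : 0 < e.det b := by by_contra hc; push Not at hc; nlinarith
    rw [sign_pos this, abs_of_pos h]; simp

/-- Coordinates in a basis are pairings with the dual basis. The right-hand side is a continuous
form, so the volume form has a continuous version. -/
theorem det_eq_decomposable (b : Module.Basis (Fin d) ℝ V) {E : Fin d → V}
    (h : IsDualFrame g b E) : b.det = (decomposable fun i => g (E i)).toAlternatingMap := by
  ext v
  change _ = decomposable _ v
  rw [decomposable_apply, b.det_apply]
  congr 1
  ext i j
  rw [Module.Basis.toMatrix_apply, Matrix.of_apply]
  conv_rhs => rw [← b.sum_repr (v j), map_sum]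
  simp [h.apply_eq]

/-- The volume form as a continuous alternating map. -/
theorem exists_volume [FiniteDimensional ℝ V] (hs : ∀ v w, g v w = g w v)
    (hn : ∀ v, (∀ w, g v w = 0) → v = 0) {o : Orientation ℝ V (Fin d)}
    (ho : ∃ b : Module.Basis (Fin d) ℝ V, b.orientation = o) :
    ∃ vol : V [⋀^Fin d]→L[ℝ] ℝ, vol.toAlternatingMap = volumeForm g o ∧
      ∀ b : Module.Basis (Fin d) ℝ V, vol b ≠ 0 := by
  obtain ⟨f, hf, hfo⟩ := exists_orthonormal_oriented hs hn ho
  refine ⟨decomposable fun i => g ((fun a => ∑ c, (gramMatrix g f)⁻¹ a c • f c) i), ?_, fun b => ?_⟩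
  · rw [volumeForm_eq_det f hf hfo, det_eq_decomposable f (isDualFrame_of_basis hs hn f)]
  · have : (decomposable fun i => g ((fun a => ∑ c, (gramMatrix g f)⁻¹ a c • f c) i)) b
        = f.det b := by
      rw [det_eq_decomposable f (isDualFrame_of_basis hs hn f)]; rfl
    rw [this]
    exact (f.isUnit_det b).ne_zero

end Volume

/-! ### The Hodge operator: existence, uniqueness and commutation with exterior multiplication. -/

section Hodge

variable {V : Type*} [AddCommGroup V] [Module ℝ V] [TopologicalSpace V]
  {d : ℕ} {g : V →L[ℝ] V →L[ℝ] ℝ}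

theorem finiteDimensional_form [FiniteDimensional ℝ V] (p : ℕ) :
    FiniteDimensional ℝ (V [⋀^Fin p]→L[ℝ] ℝ) := by
  let f : (V [⋀^Fin p]→L[ℝ] ℝ) →ₗ[ℝ] MultilinearMap ℝ (fun _ : Fin p => V) ℝ :=
    { toFun := fun α => α.toMultilinearMap
      map_add' := fun _ _ => rfl
      map_smul' := fun _ _ => rfl }
  refine Module.Finite.of_injective f fun α β h => ?_
  ext w
  exact congrArg (fun m : MultilinearMap ℝ (fun _ : Fin p => V) ℝ => m w) h

theorem gramInner_add_left [FiniteDimensional ℝ V] {p : ℕ} (α α' β : V [⋀^Fin p]→L[ℝ] ℝ) :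
    gramInner g (α + α') β = gramInner g α β + gramInner g α' β := by
  simp only [gramInner, form_add_apply, add_mul, mul_add, Finset.sum_add_distrib]

theorem gramInner_smul_left [FiniteDimensional ℝ V] {p : ℕ} (r : ℝ) (α β : V [⋀^Fin p]→L[ℝ] ℝ) :
    gramInner g (r • α) β = r * gramInner g α β := by
  simp only [gramInner, form_smul_apply, Finset.mul_sum]
  refine Finset.sum_congr rfl fun s _ => Finset.sum_congr rfl fun t _ => ?_
  ring

theorem gramInner_comm [FiniteDimensional ℝ V] (hs : ∀ v w, g v w = g w v) {p : ℕ}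
    (α β : V [⋀^Fin p]→L[ℝ] ℝ) : gramInner g α β = gramInner g β α := by
  have hsymm : ((gramMatrix g (Module.finBasis ℝ V))⁻¹).IsSymm := by
    rw [Matrix.IsSymm, Matrix.transpose_nonsing_inv]
    congr 1
    ext i j
    simp [gramMatrix, hs]
  simp only [gramInner]
  congr 1
  rw [Finset.sum_comm]
  refine Finset.sum_congr rfl fun s _ => Finset.sum_congr rfl fun t _ => ?_
  rw [mul_comm (α _)]
  congr 1
  exact Finset.prod_congr rfl fun i _ => hsymm.apply _ _

theorem gramInner_decomposable [FiniteDimensional ℝ V] (hs : ∀ v w, g v w = g w v)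
    (hn : ∀ v, (∀ w, g v w = 0) → v = 0) {p : ℕ} (α : V [⋀^Fin p]→L[ℝ] ℝ) (c : Fin p → V) :
    gramInner g (decomposable fun i => g (c i)) α = α c := by
  rw [gramInner_comm hs]
  exact gramInner_eq_apply g hs hn α _ c fun v => decomposable_apply _ v

/-- The defining property of the Hodge operator, tested on decomposable forms. -/
def IsHodgeDual {p q : ℕ} (h : p + q = d) (g : V →L[ℝ] V →L[ℝ] ℝ) (vol : V [⋀^Fin d]→ₗ[ℝ] ℝ)
    (α : V [⋀^Fin p]→L[ℝ] ℝ) (γ : V [⋀^Fin q]→L[ℝ] ℝ) : Prop :=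
  ∀ c : Fin p → V, wedge h (decomposable fun i => g (c i)) γ = α c • vol

/-- On decomposable forms the Gram product with `α` is just evaluation of `α`, so with this test no
Gram sum has to be expanded. -/
theorem isHodgeDual_iff [FiniteDimensional ℝ V] (hs : ∀ v w, g v w = g w v)
    (hn : ∀ v, (∀ w, g v w = 0) → v = 0) {e E : Fin d → V} (hE : IsDualFrame g e E)
    {p q : ℕ} (h : p + q = d) {vol : V [⋀^Fin d]→ₗ[ℝ] ℝ} {α : V [⋀^Fin p]→L[ℝ] ℝ}
    {γ : V [⋀^Fin q]→L[ℝ] ℝ} :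
    IsHodgeDual h g vol α γ ↔ ∀ β : V [⋀^Fin p]→L[ℝ] ℝ, wedge h β γ = gramInner g β α • vol := by
  refine ⟨fun H β => ?_, fun H c => by rw [H, gramInner_decomposable hs hn]⟩
  refine form_induction hE (P := fun β => wedge h β γ = gramInner g β α • vol) ?_ ?_ ?_ β
  · intro a b ha hb
    rw [wedge_add_left, ha, hb, gramInner_add_left, add_smul]
  · intro r a ha
    rw [wedge_smul_left, ha, gramInner_smul_left, mul_smul]
  · intro c
    rw [H c, gramInner_decomposable hs hn]

theorem decomposable_cons_flat {p : ℕ} (v : V) (c : Fin p → V) :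
    (decomposable fun i => g ((Fin.cons v c : Fin (p + 1) → V) i))
      = oneFormWedge (g v) (decomposable fun i => g (c i)) := by
  rw [← decomposable_cons]
  congr 1
  funext i
  refine Fin.cases ?_ (fun i => ?_) i <;> simp

/-- Take the defining identity for the list `c` preceded by `v`, and move `♭v` across the remaining
`p` factors onto `γ`. -/
theorem IsHodgeDual.creator {e E : Fin d → V} (hE : IsDualFrame g e E) {p q : ℕ}
    (h : p + 1 + q = d) (h' : p + (q + 1) = d) {vol : V [⋀^Fin d]→ₗ[ℝ] ℝ}
    {α : V [⋀^Fin (p + 1)]→L[ℝ] ℝ} {γ : V [⋀^Fin q]→L[ℝ] ℝ} (H : IsHodgeDual h g vol α γ) (v : V) :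
    IsHodgeDual h' g vol ((-1 : ℝ) ^ p • interior v α) (creator g v γ) := by
  intro c
  have h1 := H (Fin.cons v c)
  rw [decomposable_cons_flat, wedge_oneFormWedge hE h h'] at h1
  rw [form_smul_apply, interior_apply, mul_smul, ← h1, smul_smul, ← mul_pow]
  simp [PseudoRiemannian.creator]

/-- Nondegeneracy of the wedge pairing, by induction on `p`: one factor `♭v` is moved onto `γ`, so
`♭v ∧ γ = 0` for all `v`, and `γ` lies below the top degree. -/
theorem eq_zero_of_wedge_eq_zero {e E : Fin d → V} (hE : IsDualFrame g e E) {p q : ℕ}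
    (h : p + q = d) {γ : V [⋀^Fin q]→L[ℝ] ℝ}
    (H : ∀ c : Fin p → V, wedge h (decomposable fun i => g (c i)) γ = 0) : γ = 0 := by
  induction p generalizing q with
  | zero =>
    obtain rfl : q = d := by omega
    have h1 := H ![]
    rw [wedge_zero_form h _ _ hE, decomposable_apply] at h1
    simp only [Matrix.det_isEmpty, one_smul] at h1
    exact ContinuousAlternatingMap.toAlternatingMap_injective h1
  | succ p ih =>
    refine creator_injective hE (by omega) fun v => ih (by omega : p + (q + 1) = d) fun c => ?_
    have h1 := H (Fin.cons v c)
    rw [decomposable_cons_flat, wedge_oneFormWedge hE h (by omega)] at h1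
    exact (smul_eq_zero.mp h1).resolve_left (pow_ne_zero _ (by norm_num))

theorem IsHodgeDual.unique {e E : Fin d → V} (hE : IsDualFrame g e E) {p q : ℕ}
    {h : p + q = d} {vol : V [⋀^Fin d]→ₗ[ℝ] ℝ} {α : V [⋀^Fin p]→L[ℝ] ℝ}
    {γ γ' : V [⋀^Fin q]→L[ℝ] ℝ} (H : IsHodgeDual h g vol α γ) (H' : IsHodgeDual h g vol α γ') :
    γ = γ' := by
  have : γ + (-1 : ℝ) • γ' = 0 := by
    refine eq_zero_of_wedge_eq_zero hE h fun c => ?_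
    rw [wedge_add_right, wedge_smul_right, H c, H' c]
    module
  rw [← sub_eq_zero, ← this]
  module

/-- Evaluated on a basis, the wedge pairing embeds the `q`-forms into the dual of the `p`-forms. By
symmetry the opposite embedding exists too, so the dimensions agree, the embedding is onto, and the
functional `β ↦ (β, α)_g vol` is represented by some `γ`. -/
theorem exists_isHodgeDual [FiniteDimensional ℝ V] (b : Module.Basis (Fin d) ℝ V)
    (hs : ∀ v w, g v w = g w v) (hn : ∀ v, (∀ w, g v w = 0) → v = 0) {p q : ℕ}
    (h : p + q = d) (vol : V [⋀^Fin d]→ₗ[ℝ] ℝ) (α : V [⋀^Fin p]→L[ℝ] ℝ) :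
    ∃ γ, IsHodgeDual h g vol α γ := by
  have hE := isDualFrame_of_basis hs hn b
  have hfd : ∀ r : ℕ, FiniteDimensional ℝ (V [⋀^Fin r]→L[ℝ] ℝ) := finiteDimensional_form
  let W : ∀ {p q : ℕ}, p + q = d → (V [⋀^Fin q]→L[ℝ] ℝ) →ₗ[ℝ] Module.Dual ℝ (V [⋀^Fin p]→L[ℝ] ℝ) :=
    fun h => LinearMap.mk₂ ℝ (fun γ β => wedge h β γ b)
      (fun γ γ' β => by rw [wedge_add_right]; rfl) (fun r γ β => by rw [wedge_smul_right]; rfl)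
      (fun γ β β' => by rw [wedge_add_left]; rfl) (fun r γ β => by rw [wedge_smul_left]; rfl)
  have hW : ∀ {p q : ℕ} (h : p + q = d) γ β, W h γ β = wedge h β γ b := fun _ _ _ => rfl
  have hinj : ∀ {p q : ℕ} (h : p + q = d), Function.Injective (W h) := by
    intro p q h
    refine (injective_iff_map_eq_zero _).mpr fun γ hγ => ?_
    refine eq_zero_of_wedge_eq_zero hE h fun c => ?_
    rw [AlternatingMap.eq_smul_basis_det b (wedge h _ γ), ← hW, hγ]
    simp
  have hle : ∀ {p q : ℕ} (h : p + q = d), Module.finrank ℝ (V [⋀^Fin q]→L[ℝ] ℝ)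
      ≤ Module.finrank ℝ (V [⋀^Fin p]→L[ℝ] ℝ) := fun h =>
    (LinearMap.finrank_le_finrank_of_injective (hinj h)).trans_eq Subspace.dual_finrank_eq
  have heq : Module.finrank ℝ (V [⋀^Fin q]→L[ℝ] ℝ)
      = Module.finrank ℝ (Module.Dual ℝ (V [⋀^Fin p]→L[ℝ] ℝ)) :=
    (le_antisymm (hle h) (hle (by omega))).trans Subspace.dual_finrank_eq.symm
  have hsurj := (LinearMap.injective_iff_surjective_of_finrank_eq_finrank heq).mp (hinj h)
  -- Top-degree forms are determined by their value on `b`, so it is enough to represent this scalar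
  -- functional.
  let φ : Module.Dual ℝ (V [⋀^Fin p]→L[ℝ] ℝ) :=
    { toFun := fun β => gramInner g β α * vol b
      map_add' := fun β β' => by rw [gramInner_add_left, add_mul]
      map_smul' := fun r β => by rw [gramInner_smul_left, mul_assoc]; rfl }
  obtain ⟨γ, hγ⟩ := hsurj φ
  refine ⟨γ, (isHodgeDual_iff hs hn hE h).mpr fun β => ?_⟩
  rw [AlternatingMap.eq_smul_basis_det b (wedge h β γ), ← hW, hγ,
    AlternatingMap.eq_smul_basis_det b vol, smul_smul]
  congr 1

theorem isHodgeDual_hodgeStar [FiniteDimensional ℝ V] (b : Module.Basis (Fin d) ℝ V)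
    (hs : ∀ v w, g v w = g w v) (hn : ∀ v, (∀ w, g v w = 0) → v = 0) (o : Orientation ℝ V (Fin d))
    {p q : ℕ} (h : p + q = d) (α : V [⋀^Fin p]→L[ℝ] ℝ) :
    IsHodgeDual h g (volumeForm g o) α (hodgeStar h g o α) := by
  have hE := isDualFrame_of_basis hs hn b
  obtain ⟨γ, hγ⟩ := exists_isHodgeDual b hs hn h (volumeForm g o) α
  rw [isHodgeDual_iff hs hn hE] at hγ ⊢
  exact Classical.epsilon_spec (p := fun γ : V [⋀^Fin q]→L[ℝ] ℝ => ∀ β : V [⋀^Fin p]→L[ℝ] ℝ,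
    wedge h β γ = gramInner g β α • volumeForm g o) ⟨γ, hγ⟩

variable [FiniteDimensional ℝ V]

theorem hodgeStar_add (b : Module.Basis (Fin d) ℝ V)
    (hs : ∀ v w, g v w = g w v) (hn : ∀ v, (∀ w, g v w = 0) → v = 0) (o : Orientation ℝ V (Fin d))
    {p q : ℕ} (h : p + q = d) (α α' : V [⋀^Fin p]→L[ℝ] ℝ) :
    hodgeStar h g o (α + α') = hodgeStar h g o α + hodgeStar h g o α' := by
  refine (isHodgeDual_hodgeStar b hs hn o h _).unique (isDualFrame_of_basis hs hn b) fun c => ?_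
  rw [wedge_add_right, isHodgeDual_hodgeStar b hs hn o h α c,
    isHodgeDual_hodgeStar b hs hn o h α' c, form_add_apply, add_smul]

theorem hodgeStar_smul (b : Module.Basis (Fin d) ℝ V)
    (hs : ∀ v w, g v w = g w v) (hn : ∀ v, (∀ w, g v w = 0) → v = 0) (o : Orientation ℝ V (Fin d))
    {p q : ℕ} (h : p + q = d) (r : ℝ) (α : V [⋀^Fin p]→L[ℝ] ℝ) :
    hodgeStar h g o (r • α) = r • hodgeStar h g o α := by
  refine (isHodgeDual_hodgeStar b hs hn o h _).unique (isDualFrame_of_basis hs hn b) fun c => ?_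
  rw [wedge_smul_right, isHodgeDual_hodgeStar b hs hn o h α c, form_smul_apply, mul_smul]

/-- The volume form does not vanish on a basis, so the coefficient `α c` can be read off from the
wedge of the decomposable form of `c` with `⋆α`. -/
theorem hodgeStar_injective (b : Module.Basis (Fin d) ℝ V)
    (hs : ∀ v w, g v w = g w v) (hn : ∀ v, (∀ w, g v w = 0) → v = 0) {o : Orientation ℝ V (Fin d)}
    (ho : ∃ b : Module.Basis (Fin d) ℝ V, b.orientation = o) {p q : ℕ} (h : p + q = d) :
    Function.Injective (hodgeStar (V := V) h g o) := by
  intro α α' hα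
  obtain ⟨vol, hvol, hvol0⟩ := exists_volume hs hn ho
  ext c
  have h1 := (isHodgeDual_hodgeStar b hs hn o h α c).symm.trans
    ((congrArg _ hα).trans (isHodgeDual_hodgeStar b hs hn o h α' c))
  have h2 := congrArg (fun f : V [⋀^Fin d]→ₗ[ℝ] ℝ => f b) h1
  rw [← hvol] at h2
  exact mul_right_cancel₀ (hvol0 b) h2

/-- Both sides are Hodge duals of the same form. This rule turns `j^a ∇_{e_a}` into `i^a ∇_{e_a}`
under the Hodge operator, and it drives the inductions on degree for fields of Hodge duals. -/
theorem creator_hodgeStar (b : Module.Basis (Fin d) ℝ V)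
    (hs : ∀ v w, g v w = g w v) (hn : ∀ v, (∀ w, g v w = 0) → v = 0) (o : Orientation ℝ V (Fin d))
    {p q : ℕ} (h : p + 1 + q = d) (h' : p + (q + 1) = d) (v : V) (α : V [⋀^Fin (p + 1)]→L[ℝ] ℝ) :
    creator g v (hodgeStar h g o α) = (-1 : ℝ) ^ p • hodgeStar h' g o (interior v α) := by
  rw [← hodgeStar_smul b hs hn]
  exact ((isHodgeDual_hodgeStar b hs hn o h α).creator (isDualFrame_of_basis hs hn b) h h' v).unique
    (isDualFrame_of_basis hs hn b) (isHodgeDual_hodgeStar b hs hn o h' _)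

theorem hodgeStar_zero_form (b : Module.Basis (Fin d) ℝ V)
    (hs : ∀ v w, g v w = g w v) (hn : ∀ v, (∀ w, g v w = 0) → v = 0) (o : Orientation ℝ V (Fin d))
    (h : 0 + d = d) (α : V [⋀^Fin 0]→L[ℝ] ℝ) {vol : V [⋀^Fin d]→L[ℝ] ℝ}
    (hvol : vol.toAlternatingMap = volumeForm g o) : hodgeStar h g o α = α ![] • vol := by
  have hE := isDualFrame_of_basis hs hn b
  refine (isHodgeDual_hodgeStar b hs hn o h _).unique hE fun c => ?_
  rw [wedge_smul_right, wedge_zero_form h _ _ hE, decomposable_apply, hvol,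
    Subsingleton.elim c ![]]
  simp

/-- Reconstruction of the Hodge dual of a `(p + 1)`-form from Hodge duals of `p`-forms. -/
theorem hodgeStar_succ (b : Module.Basis (Fin d) ℝ V)
    (hs : ∀ v w, g v w = g w v) (hn : ∀ v, (∀ w, g v w = 0) → v = 0) (o : Orientation ℝ V (Fin d))
    {p q : ℕ} (h : p + 1 + q = d) (h' : p + (q + 1) = d) {e E : Fin d → V}
    (hE : IsDualFrame g e E) (α : V [⋀^Fin (p + 1)]→L[ℝ] ℝ) :
    hodgeStar h g o α = ((-1 : ℝ) ^ p * ((p + 1 : ℕ) : ℝ)⁻¹) •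
      ∑ a, interior (e a) (hodgeStar h' g o (interior (E a) α)) := by
  -- On the `q`-form `⋆α` the operator `∑ i j` is the scalar `d - q = p + 1`, which is inverted.
  have h1 := sum_interior_creator hE (hodgeStar h g o α)
  simp only [creator_hodgeStar b hs hn o h h', ← interiorLM_apply, map_smul, ← Finset.smul_sum] at h1
  have h2 : (d : ℝ) - q = ((p + 1 : ℕ) : ℝ) := by rw [← h]; push_cast; ring
  rw [h2] at h1
  have h3 : ((p + 1 : ℕ) : ℝ) ≠ 0 := by positivity
  simp only [← interiorLM_apply]
  rw [mul_comm, mul_smul, h1, smul_smul, inv_mul_cancel₀ h3, one_smul]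

end Hodge

/-! ### Differentiability and smoothness of functions and vector fields. -/

section Regularity

/-- Differentiability of a function at a point. -/
abbrev FunDiffAt (d : ℕ) {M : Type*} [TopologicalSpace M]
    [ChartedSpace (EuclideanSpace ℝ (Fin d)) M] (f : M → ℝ) (x : M) : Prop := MDifferentiableAt (𝓡 d) 𝓘(ℝ, ℝ) f x

/-- Smoothness of a function at a point. -/
abbrev FunSmoothAt (d : ℕ) {M : Type*} [TopologicalSpace M]
    [ChartedSpace (EuclideanSpace ℝ (Fin d)) M] (f : M → ℝ) (x : M) : Prop :=
  ContMDiffAt (𝓡 d) 𝓘(ℝ, ℝ) ∞ f x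

variable {d : ℕ} {M : Type*} [TopologicalSpace M] [ChartedSpace (EuclideanSpace ℝ (Fin d)) M]

theorem FunSmoothAt.diffAt {f : M → ℝ} {x : M} (h : FunSmoothAt d f x) : FunDiffAt d f x :=
  h.mdifferentiableAt (by simp)

theorem FunSmoothAt.sum {ι : Type*} {s : Finset ι} {f : ι → M → ℝ} {x : M}
    (h : ∀ i ∈ s, FunSmoothAt d (f i) x) : FunSmoothAt d (fun y => ∑ i ∈ s, f i y) x :=
  ContMDiffAt.sum h

theorem FunSmoothAt.prod {ι : Type*} {s : Finset ι} {f : ι → M → ℝ} {x : M}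
    (h : ∀ i ∈ s, FunSmoothAt d (f i) x) : FunSmoothAt d (fun y => ∏ i ∈ s, f i y) x :=
  contMDiffAt_finsetProd h

theorem FunSmoothAt.mul {f f' : M → ℝ} {x : M} (h : FunSmoothAt d f x) (h' : FunSmoothAt d f' x) :
    FunSmoothAt d (fun y => f y * f' y) x := ContMDiffAt.mul h h'

theorem FunSmoothAt.add {f f' : M → ℝ} {x : M} (h : FunSmoothAt d f x) (h' : FunSmoothAt d f' x) :
    FunSmoothAt d (fun y => f y + f' y) x := ContMDiffAt.add h h'

theorem FunSmoothAt.sub {f f' : M → ℝ} {x : M} (h : FunSmoothAt d f x) (h' : FunSmoothAt d f' x) :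
    FunSmoothAt d (fun y => f y - f' y) x := ContMDiffAt.sub h h'

theorem FunSmoothAt.inv {f : M → ℝ} {x : M} (h : FunSmoothAt d f x) (h0 : f x ≠ 0) :
    FunSmoothAt d (fun y => (f y)⁻¹) x :=
  (contDiffAt_inv ℝ h0).contMDiffAt.comp x h

theorem FunSmoothAt.sqrt {f : M → ℝ} {x : M} (h : FunSmoothAt d f x) (h0 : f x ≠ 0) :
    FunSmoothAt d (fun y => Real.sqrt (f y)) x :=
  (Real.contDiffAt_sqrt h0).contMDiffAt.comp x h

theorem FunDiffAt.sum {ι : Type*} {s : Finset ι} {f : ι → M → ℝ} {x : M}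
    (h : ∀ i ∈ s, FunDiffAt d (f i) x) : FunDiffAt d (fun y => ∑ i ∈ s, f i y) x := by
  classical
  induction s using Finset.induction_on with
  | empty => simpa using mdifferentiableAt_const
  | insert a s ha ih =>
    simp only [Finset.sum_insert ha]
    exact MDifferentiableAt.add (h a (by simp)) (ih fun i hi => h i (by simp [hi]))

theorem FunDiffAt.prod {ι : Type*} {s : Finset ι} {f : ι → M → ℝ} {x : M}
    (h : ∀ i ∈ s, FunDiffAt d (f i) x) : FunDiffAt d (fun y => ∏ i ∈ s, f i y) x := by
  classical
  induction s using Finset.induction_on with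
  | empty => simpa using mdifferentiableAt_const
  | insert a s ha ih =>
    simp only [Finset.prod_insert ha]
    exact (h a (by simp)).mul (ih fun i hi => h i (by simp [hi]))

theorem FunDiffAt.mul {f f' : M → ℝ} {x : M} (h : FunDiffAt d f x) (h' : FunDiffAt d f' x) :
    FunDiffAt d (fun y => f y * f' y) x := MDifferentiableAt.mul h h'

theorem FunDiffAt.add {f f' : M → ℝ} {x : M} (h : FunDiffAt d f x) (h' : FunDiffAt d f' x) :
    FunDiffAt d (fun y => f y + f' y) x := MDifferentiableAt.add h h'

section DirDeriv

variable {X : VField d M} {f f' : M → ℝ} {x : M}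

theorem dirDeriv_congr (h : f =ᶠ[𝓝 x] f') : dirDeriv X f x = dirDeriv X f' x := by
  simp only [dirDeriv, mvfderiv, h.mfderiv_eq]
  rfl

theorem dirDeriv_add (h : FunDiffAt d f x) (h' : FunDiffAt d f' x) :
    dirDeriv X (fun y => f y + f' y) x = dirDeriv X f x + dirDeriv X f' x := by
  have := mvfderiv_add h h'
  exact congrArg (fun L => L (X x)) this

theorem dirDeriv_mul (h : FunDiffAt d f x) (h' : FunDiffAt d f' x) :
    dirDeriv X (fun y => f y * f' y) x = f x * dirDeriv X f' x + f' x * dirDeriv X f x := by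
  have := mvfderiv_mul h h'
  exact congrArg (fun L => L (X x)) this

theorem dirDeriv_const (c : ℝ) : dirDeriv X (fun _ => c) x = 0 := by
  have := mvfderiv_const (I := 𝓡 d) (M := M) c (x := x)
  exact congrArg (fun L => L (X x)) this

theorem dirDeriv_const_mul (c : ℝ) (h : FunDiffAt d f x) :
    dirDeriv X (fun y => c * f y) x = c * dirDeriv X f x := by
  rw [dirDeriv_mul mdifferentiableAt_const h, dirDeriv_const]; ring

theorem dirDeriv_eq_of_eq {Y : VField d M} (h : X x = Y x) : dirDeriv X f x = dirDeriv Y f x := by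
  rw [dirDeriv, dirDeriv, h]

theorem dirDeriv_add_left {Y : VField d M} :
    dirDeriv (X + Y) f x = dirDeriv X f x + dirDeriv Y f x :=
  map_add (mvfderiv (𝓡 d) f x) _ _

theorem dirDeriv_smul_left {c : M → ℝ} :
    dirDeriv (c • X) f x = c x * dirDeriv X f x :=
  map_smul (mvfderiv (𝓡 d) f x) _ _

end DirDeriv

variable [IsManifold (𝓡 d) ∞ M]

/-- Differentiability of a vector field at a point. -/
abbrev FieldDiffAt (X : VField d M) (x : M) : Prop :=
  MDifferentiableAt (𝓡 d) (𝓡 d).tangent (fun y => (⟨y, X y⟩ : TangentBundle (𝓡 d) M)) x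

section Fields

variable {X Y : VField d M} {f : M → ℝ} {x : M}

/-- Smoothness at a point gives each finite order on a neighbourhood that may shrink with the order,
so it does not itself spread to nearby points. First order does, and differentiability nearby is
what is needed to prove an identity on a neighbourhood. -/
theorem FunSmoothAt.eventually (h : FunSmoothAt d f x) : ∀ᶠ y in 𝓝 x, FunDiffAt d f y := by
  have h1 : ContMDiffAt (𝓡 d) 𝓘(ℝ, ℝ) 1 f x := h.of_le (by norm_cast)
  filter_upwards [(contMDiffAt_iff_contMDiffAt_nhds (by simp)).1 h1] with y hy
  exact hy.mdifferentiableAt (by simp)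

theorem SmoothAt.diffAt (h : SmoothAt X x) : FieldDiffAt X x :=
  ContMDiffAt.mdifferentiableAt h (by simp)

theorem SmoothAt.eventually (h : SmoothAt X x) : ∀ᶠ y in 𝓝 x, FieldDiffAt X y := by
  have h1 : ContMDiffAt (𝓡 d) (𝓡 d).tangent 1
    (fun y => (⟨y, X y⟩ : TangentBundle (𝓡 d) M)) x := ContMDiffAt.of_le h (by norm_cast)
  have : IsManifold (𝓡 d).tangent 1 (TangentBundle (𝓡 d) M) := inferInstance
  filter_upwards [(contMDiffAt_iff_contMDiffAt_nhds (by simp)).1 h1] with y hy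
  exact hy.mdifferentiableAt (by simp)

theorem SmoothAt.congr (h : SmoothAt X x) (hXY : Y =ᶠ[𝓝 x] X) : SmoothAt Y x :=
  ContMDiffAt.congr_of_eventuallyEq h (hXY.mono fun y hy => by
    change (⟨y, Y y⟩ : TangentBundle (𝓡 d) M) = ⟨y, X y⟩
    rw [hy])

theorem SmoothAt.add (hX : SmoothAt X x) (hY : SmoothAt Y x) : SmoothAt (X + Y) x :=
  ContMDiffAt.add_section hX hY

theorem SmoothAt.sub (hX : SmoothAt X x) (hY : SmoothAt Y x) : SmoothAt (X - Y) x :=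
  ContMDiffAt.sub_section hX hY

theorem SmoothAt.smul (hf : FunSmoothAt d f x) (hX : SmoothAt X x) : SmoothAt (f • X) x :=
  ContMDiffAt.smul_section hf hX

theorem SmoothAt.sum {ι : Type*} {s : Finset ι} {Z : ι → VField d M}
    (h : ∀ i ∈ s, SmoothAt (Z i) x) : SmoothAt (fun y => ∑ i ∈ s, Z i y) x :=
  ContMDiffAt.sum_section h

theorem FieldDiffAt.add (hX : FieldDiffAt X x) (hY : FieldDiffAt Y x) : FieldDiffAt (X + Y) x :=
  mdifferentiableAt_add_section hX hY

theorem FieldDiffAt.smul (hf : FunDiffAt d f x) (hX : FieldDiffAt X x) : FieldDiffAt (f • X) x :=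
  MDifferentiableAt.smul_section hf hX

theorem FieldDiffAt.sum {ι : Type*} {s : Finset ι} {Z : ι → VField d M}
    (h : ∀ i ∈ s, FieldDiffAt (Z i) x) : FieldDiffAt (fun y => ∑ i ∈ s, Z i y) x :=
  MDifferentiableAt.sum_section h

/-- An extension of a tangent vector to a vector field that is smooth at the point. -/
def ext (x : M) (v : TangentSpace (𝓡 d) x) : VField d M :=
  FiberBundle.extend (EuclideanSpace ℝ (Fin d)) v

@[simp] theorem ext_self (v : TangentSpace (𝓡 d) x) : ext x v x = v :=
  FiberBundle.extend_apply_self _ v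

theorem smoothAt_ext (v : TangentSpace (𝓡 d) x) : SmoothAt (ext x v) x :=
  FiberBundle.contMDiffAt_extend (𝓡 d) (EuclideanSpace ℝ (Fin d)) v

end Fields

section MetricRegularity

variable (g : Metric d M) {X Y : VField d M} {x : M}

theorem Metric.smoothAt (hX : SmoothAt X x) (hY : SmoothAt Y x) :
    FunSmoothAt d (fun y => g.val y (X y) (Y y)) x := by
  have : ContMDiffAt (𝓡 d) ((𝓡 d).prod 𝓘(ℝ)) ∞
      (fun m => Bundle.TotalSpace.mk' ℝ (E := Bundle.Trivial M ℝ) m (g.val m (X m) (Y m))) x := by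
    apply ContMDiffAt.clm_bundle_apply₂ (F₁ := EuclideanSpace ℝ (Fin d))
      (F₂ := EuclideanSpace ℝ (Fin d))
    · exact g.contMDiff.contMDiffAt
    · exact hX
    · exact hY
  rw [Bundle.contMDiffAt_totalSpace] at this
  exact this.2

theorem Metric.diffAt (hX : FieldDiffAt X x) (hY : FieldDiffAt Y x) :
    FunDiffAt d (fun y => g.val y (X y) (Y y)) x := by
  have : MDifferentiableAt (𝓡 d) ((𝓡 d).prod 𝓘(ℝ))
      (fun m => Bundle.TotalSpace.mk' ℝ (E := Bundle.Trivial M ℝ) m (g.val m (X m) (Y m))) x := by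
    apply MDifferentiableAt.clm_bundle_apply₂ (F₁ := EuclideanSpace ℝ (Fin d))
      (F₂ := EuclideanSpace ℝ (Fin d))
    · exact g.contMDiff.contMDiffAt.mdifferentiableAt (by simp)
    · exact hX
    · exact hY
  rw [mdifferentiableAt_totalSpace] at this
  exact this.2

end MetricRegularity

/-! ### Lie brackets of vector fields. -/

section Bracket

theorem isManifold_minSmoothness (n : ℕ) : IsManifold (𝓡 d) (minSmoothness ℝ n) M := by
  rw [minSmoothness_of_isRCLikeNormedField]
  exact IsManifold.of_le (m := n) (n := ∞) (by exact_mod_cast le_top)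

instance : IsManifold (𝓡 d) (minSmoothness ℝ 2) M := isManifold_minSmoothness 2

instance : IsManifold (𝓡 d) (minSmoothness ℝ 3) M := isManifold_minSmoothness 3

variable {X Y : VField d M} {f : M → ℝ} {x : M}

theorem bracket_smoothAt (hX : SmoothAt X x) (hY : SmoothAt Y x) : SmoothAt (bracket X Y) x := by
  -- Since `∞ + 1 = ∞`, no order of smoothness is lost.
  have : IsManifold (𝓡 d) (((⊤ : ℕ∞) : WithTop ℕ∞) + 1) M := inferInstanceAs (IsManifold (𝓡 d) ∞ M)
  exact ContMDiffAt.mlieBracket_vectorField (n := ⊤) (m := ⊤) hX hY (by simp)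

theorem bracket_smul_right (hf : FunDiffAt d f x) (hY : FieldDiffAt Y x) :
    bracket X (f • Y) x = dirDeriv X f x • Y x + f x • bracket X Y x := by
  exact VectorField.mlieBracket_smul_right hf hY

theorem bracket_smul_left (hf : FunDiffAt d f x) (hX : FieldDiffAt X x) :
    bracket (f • X) Y x = -dirDeriv Y f x • X x + f x • bracket X Y x :=
  VectorField.mlieBracket_smul_left hf hX

theorem bracket_add_right {Z : VField d M} (hY : FieldDiffAt Y x) (hZ : FieldDiffAt Z x) :
    bracket X (Y + Z) x = bracket X Y x + bracket X Z x :=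
  VectorField.mlieBracket_add_right hY hZ

theorem bracket_add_left {Z : VField d M} (hX : FieldDiffAt X x) (hZ : FieldDiffAt Z x) :
    bracket (X + Z) Y x = bracket X Y x + bracket Z Y x :=
  VectorField.mlieBracket_add_left hX hZ

theorem bracket_swap : bracket X Y x = -bracket Y X x := VectorField.mlieBracket_swap_apply

theorem bracket_congr {X' Y' : VField d M} (hX : X =ᶠ[𝓝 x] X') (hY : Y =ᶠ[𝓝 x] Y') :
    bracket X Y x = bracket X' Y' x := hX.mlieBracket_vectorField_eq hY

end Bracket

end Regularity

/-! ### Local frames and their dual frames. -/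

section Frames

variable {d : ℕ} {M : Type*} [TopologicalSpace M] [ChartedSpace (EuclideanSpace ℝ (Fin d)) M]
  [IsManifold (𝓡 d) ∞ M]

theorem finrank_tangentSpace (x : M) : Module.finrank ℝ (TangentSpace (𝓡 d) x) = d :=
  (finrank_euclideanSpace_fin (𝕜 := ℝ) (n := d))

/-- A family of vector fields that is smooth at `x` and a frame near `x`. -/
structure IsFrameAt (e : Fin d → VField d M) (x : M) : Prop where
  smoothAt (a : Fin d) : SmoothAt (e a) x
  linearIndependent : ∀ᶠ y in 𝓝 x, LinearIndependent ℝ fun a => e a y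

theorem IsFrameOn.isFrameAt {e : Fin d → VField d M} {s : Set M} (h : IsFrameOn e s) {x : M}
    (hx : x ∈ s) : IsFrameAt e x where
  smoothAt a := h.2.contMDiffAt h.1 hx a
  linearIndependent := by
    filter_upwards [h.1.mem_nhds hx] with y hy
    exact h.2.linearIndependent hy

theorem exists_isFrameOn (x : M) : ∃ (e : Fin d → VField d M) (s : Set M), IsFrameOn e s ∧ x ∈ s := by
  set t := trivializationAt (EuclideanSpace ℝ (Fin d))
    (fun y : M => TangentSpace (𝓡 d) y) x
  exact ⟨t.localFrame (EuclideanSpace.basisFun (Fin d) ℝ).toBasis, t.baseSet,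
    ⟨t.open_baseSet, t.isLocalFrameOn_localFrame_baseSet (𝓡 d) ∞ _⟩,
    FiberBundle.mem_baseSet_trivializationAt' x⟩

theorem exists_isFrameAt (x : M) : ∃ e : Fin d → VField d M, IsFrameAt e x := by
  obtain ⟨e, s, h, hx⟩ := exists_isFrameOn (d := d) x
  exact ⟨e, h.isFrameAt hx⟩

theorem isDualFrame_raised (g : Metric d M) {e : Fin d → VField d M} {x : M}
    (h : LinearIndependent ℝ fun a => e a x) :
    IsDualFrame (g.val x) (fun a => e a x) (fun a => raised g e a x) := by
  set b := basisOfLinearIndependentOfCardEqFinrank' (fun a => e a x) h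
    (by rw [finrank_tangentSpace]; simp) with hb
  have hbe : ∀ a, b a = e a x := fun a => by simp [hb]
  have := isDualFrame_of_basis (g.symm x) (g.nondegenerate x) b
  have hG : gramMatrix (g.val x) b = gramMatrix (g.val x) fun a => e a x := by
    ext i j; simp [gramMatrix, hbe]
  rw [hG, show (b : Fin d → TangentSpace (𝓡 d) x) = fun a => e a x from funext hbe] at this
  exact this

namespace IsFrameAt

variable {e : Fin d → VField d M} {x : M} (he : IsFrameAt e x) (g : Metric d M)
include he

theorem eventually : ∀ᶠ y in 𝓝 x, (∀ a, FieldDiffAt (e a) y) ∧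
    IsDualFrame (g.val y) (fun a => e a y) (fun a => raised g e a y) := by
  filter_upwards [he.linearIndependent, Filter.eventually_all.2 fun a => (he.smoothAt a).eventually]
    with y h1 h2
  exact ⟨h2, isDualFrame_raised g h1⟩

theorem isDualFrame : IsDualFrame (g.val x) (fun a => e a x) (fun a => raised g e a x) :=
  isDualFrame_raised g he.linearIndependent.self_of_nhds

theorem det_gramMatrix_ne_zero : (gramMatrix (g.val x) fun a => e a x).det ≠ 0 := by
  set b := basisOfLinearIndependentOfCardEqFinrank' (fun a => e a x)
    he.linearIndependent.self_of_nhds (by rw [finrank_tangentSpace]; simp) with hb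
  have hbe : ∀ a, b a = e a x := fun a => by simp [hb]
  have hG : gramMatrix (g.val x) b = gramMatrix (g.val x) fun a => e a x := by
    ext i j; simp [gramMatrix, hbe]
  rw [← hG]
  exact gramMatrix_det_ne_zero _ (g.symm x) (g.nondegenerate x) b

end IsFrameAt

theorem FunSmoothAt.const (c : ℝ) {x : M} : FunSmoothAt d (fun _ : M => c) x := contMDiffAt_const

theorem FunSmoothAt.det {n : ℕ} {A : M → Matrix (Fin n) (Fin n) ℝ} {x : M}
    (h : ∀ i j, FunSmoothAt d (fun y => A y i j) x) : FunSmoothAt d (fun y => (A y).det) x := by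
  simp only [Matrix.det_apply']
  exact FunSmoothAt.sum fun σ _ => (FunSmoothAt.const _).mul (FunSmoothAt.prod fun i _ => h _ _)

theorem FunSmoothAt.nonsing_inv {n : ℕ} {A : M → Matrix (Fin n) (Fin n) ℝ} {x : M}
    (h : ∀ i j, FunSmoothAt d (fun y => A y i j) x) (h0 : (A x).det ≠ 0) (i j : Fin n) :
    FunSmoothAt d (fun y => (A y)⁻¹ i j) x := by
  simp only [Matrix.inv_def, Matrix.smul_apply, smul_eq_mul, Ring.inverse_eq_inv',
    Matrix.adjugate_apply]
  refine ((FunSmoothAt.det h).inv h0).mul (FunSmoothAt.det fun k l => ?_)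
  by_cases hk : k = j
  · subst hk; simpa using FunSmoothAt.const _
  · simpa [Matrix.updateRow_ne hk] using h k l

namespace IsFrameAt

variable {e : Fin d → VField d M} {x : M} (he : IsFrameAt e x) (g : Metric d M)
include he

theorem invGram_smoothAt (a b : Fin d) : FunSmoothAt d (fun y => invGram g e y a b) x :=
  FunSmoothAt.nonsing_inv (fun i j => g.smoothAt (he.smoothAt i) (he.smoothAt j))
    (he.det_gramMatrix_ne_zero g) a b

theorem raised_smoothAt (a : Fin d) : SmoothAt (raised g e a) x :=
  SmoothAt.sum fun b _ => SmoothAt.smul (he.invGram_smoothAt g a b) (he.smoothAt b)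

theorem expansion (Y : VField d M) :
    Y =ᶠ[𝓝 x] fun y => ∑ a, g.val y (raised g e a y) (Y y) • e a y := by
  filter_upwards [he.eventually g] with y hy
  exact (hy.2.sum_eq (Y y)).symm

theorem expansion' (Y : VField d M) :
    Y =ᶠ[𝓝 x] fun y => ∑ a, g.val y (e a y) (Y y) • raised g e a y := by
  filter_upwards [he.eventually g] with y hy
  exact (hy.2.sum_eq' (g.symm y) (g.nondegenerate y) (Y y)).symm

/-- `Y = ∑ g(e_a, Y) e^a` near `x`. The lemma serves fields known only through their pairings, such
as `∇_X Y` and `♯α`. -/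
theorem smoothAt_of_pairing {Y : VField d M}
    (h : ∀ a, FunSmoothAt d (fun y => g.val y (e a y) (Y y)) x) : SmoothAt Y x :=
  SmoothAt.congr (SmoothAt.sum fun a _ => SmoothAt.smul (h a) (he.raised_smoothAt g a))
    (he.expansion' g Y)

end IsFrameAt

/-! ### Second derivatives of functions along fields, obtained from brackets. -/

section Commutator

variable (g : Metric d M) {X Y : VField d M} {f : M → ℝ} {x : M}
include g

theorem exists_pairing_ne_zero (x : M) {v : TangentSpace (𝓡 d) x} (hv : v ≠ 0) :
    ∃ w, g.val x v w ≠ 0 := by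
  by_contra! h
  exact hv (g.nondegenerate x v h)

/-- The Leibniz rule `[X, fY] - f[X, Y] = X(f) Y` recovers `X(f)` from brackets, which are known to
be smooth: pair with a field `Z` for which `g(Y, Z)` does not vanish and divide. -/
theorem dirDeriv_smoothAt (hX : SmoothAt X x) (hf : FunSmoothAt d f x) :
    FunSmoothAt d (dirDeriv X f) x := by
  -- In dimension zero no such `Y` exists, but every directional derivative vanishes.
  rcases subsingleton_or_nontrivial (EuclideanSpace ℝ (Fin d)) with hd | hd
  · have : dirDeriv X f = fun _ => 0 := by
      funext y
      have h0 : X y = 0 := Subsingleton.elim (α := EuclideanSpace ℝ (Fin d)) _ _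
      rw [dirDeriv, h0, map_zero]
    rw [this]
    exact FunSmoothAt.const 0
  · obtain ⟨v, hv⟩ : ∃ v : TangentSpace (𝓡 d) x, v ≠ 0 := exists_ne (0 : EuclideanSpace ℝ (Fin d))
    obtain ⟨w, hw⟩ := exists_pairing_ne_zero g x hv
    set Y := ext x v
    set Z := ext x w
    have hY : SmoothAt Y x := smoothAt_ext _
    have hZ : SmoothAt Z x := smoothAt_ext _
    have h0 : g.val x (Y x) (Z x) ≠ 0 := by simpa [Y, Z] using hw
    have hYZ := g.smoothAt hY hZ
    have h1 : FunSmoothAt d (fun y => g.val y ((bracket X (f • Y) - f • bracket X Y) y) (Z y)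
        * (g.val y (Y y) (Z y))⁻¹) x :=
      (g.smoothAt ((bracket_smoothAt hX (SmoothAt.smul hf hY)).sub
        (SmoothAt.smul hf (bracket_smoothAt hX hY))) hZ).mul (hYZ.inv h0)
    refine ContMDiffAt.congr_of_eventuallyEq h1 ?_
    filter_upwards [hf.eventually, hY.eventually, hYZ.continuousAt.eventually_ne h0]
      with y h2 h3 h4
    have h5 : (bracket X (f • Y) - f • bracket X Y) y = dirDeriv X f y • Y y := by
      change bracket X (f • Y) y - f y • bracket X Y y = _
      rw [bracket_smul_right h2 h3]; abel
    rw [h5, map_smul, smul_apply, smul_eq_mul, mul_assoc, mul_inv_cancel₀ h4, mul_one]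

/-- Expand the Jacobi identity for `X`, `Y`, `fZ` by the Leibniz rule and subtract `f` times the
identity for `X`, `Y`, `Z`. What is left is the claimed difference times `Z x ≠ 0`. -/
theorem dirDeriv_bracket (hX : SmoothAt X x) (hY : SmoothAt Y x) (hf : FunSmoothAt d f x) :
    dirDeriv (bracket X Y) f x = dirDeriv X (dirDeriv Y f) x - dirDeriv Y (dirDeriv X f) x := by
  rcases subsingleton_or_nontrivial (EuclideanSpace ℝ (Fin d)) with hd | hd
  · have h (X : VField d M) (f : M → ℝ) : dirDeriv X f x = 0 := by
      have h0 : X x = 0 := Subsingleton.elim (α := EuclideanSpace ℝ (Fin d)) _ _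
      rw [dirDeriv, h0, map_zero]
    simp [h]
  · obtain ⟨v, hv⟩ : ∃ v : TangentSpace (𝓡 d) x, v ≠ 0 := exists_ne (0 : EuclideanSpace ℝ (Fin d))
    set Z := ext x v
    have hZ : SmoothAt Z x := smoothAt_ext _
    have hZ0 : Z x ≠ 0 := by simpa [Z] using hv
    have hle {W : VField d M} (hW : SmoothAt W x) : ContMDiffAt (𝓡 d) (𝓡 d).tangent
        (minSmoothness ℝ 2) (fun y => (⟨y, W y⟩ : TangentBundle (𝓡 d) M)) x := by
      refine ContMDiffAt.of_le hW ?_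
      rw [minSmoothness_of_isRCLikeNormedField]
      exact WithTop.coe_le_coe.2 le_top
    have hJ := VectorField.leibniz_identity_mlieBracket_apply (hle hX) (hle hY)
      (hle (SmoothAt.smul hf hZ))
    have hJ' := VectorField.leibniz_identity_mlieBracket_apply (hle hX) (hle hY) (hle hZ)
    have key {A B : VField d M} (hA : SmoothAt A x) (hB : SmoothAt B x) :
        bracket A (bracket B (f • Z)) x = dirDeriv A (dirDeriv B f) x • Z x
          + dirDeriv B f x • bracket A Z x + dirDeriv A f x • bracket B Z x
          + f x • bracket A (bracket B Z) x := by
      have h1 : bracket B (f • Z) =ᶠ[𝓝 x] dirDeriv B f • Z + f • bracket B Z := by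
        filter_upwards [hf.eventually, hZ.eventually] with y h2 h3
        exact bracket_smul_right h2 h3
      have hBf := dirDeriv_smoothAt g hB hf
      have hBZ := bracket_smoothAt hB hZ
      refine (bracket_congr (X' := A) Filter.EventuallyEq.rfl h1).trans ?_
      rw [bracket_add_right (SmoothAt.smul hBf hZ).diffAt (SmoothAt.smul hf hBZ).diffAt,
        bracket_smul_right hBf.diffAt hZ.diffAt, bracket_smul_right hf.diffAt hBZ.diffAt]
      abel
    have e1 := key hX hY
    have e2 := key hY hX
    have e3 := bracket_smul_right (X := bracket X Y) hf.diffAt hZ.diffAt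
    simp only [bracket] at e1 e2 e3 hJ hJ'
    rw [e1, e2, e3, hJ'] at hJ
    have h4 : (dirDeriv (bracket X Y) f x
        - (dirDeriv X (dirDeriv Y f) x - dirDeriv Y (dirDeriv X f) x)) • Z x = 0 := by
      simp only [bracket]
      rw [← sub_eq_zero] at hJ
      rw [← neg_eq_zero, ← hJ]
      module
    exact sub_eq_zero.1 ((smul_eq_zero.1 h4).resolve_right hZ0)

end Commutator

end Frames

/-! ### The Levi-Civita connection from the Koszul formula. -/

section LeviCivita

variable {d : ℕ} {M : Type*} [TopologicalSpace M] [ChartedSpace (EuclideanSpace ℝ (Fin d)) M]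
  [IsManifold (𝓡 d) ∞ M] (g : Metric d M) {X X' Y Y' Z Z' : VField d M} {f : M → ℝ} {x : M}

theorem field_smul_apply (f : M → ℝ) (X : VField d M) (y : M) : (f • X) y = f y • X y := rfl

theorem field_add_apply (X Y : VField d M) (y : M) : (X + Y) y = X y + Y y := rfl

theorem Metric.ext_left {v w : TangentSpace (𝓡 d) x} (h : ∀ u, g.val x v u = g.val x w u) :
    v = w := by
  rw [← sub_eq_zero]
  refine g.nondegenerate x _ fun u => ?_
  rw [map_sub, sub_apply, h, sub_self]

/-- The derivatives of `f` from the metric terms cancel those from the brackets. Tensoriality in `Z`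
is what makes the expression a covector, which the metric then represents by `2 ∇_X Y`. -/
theorem koszul_smul_third (hX : FieldDiffAt X x) (hY : FieldDiffAt Y x) (hZ : FieldDiffAt Z x)
    (hf : FunDiffAt d f x) : koszul g X Y (f • Z) x = f x * koszul g X Y Z x := by
  simp only [koszul, field_smul_apply, map_smul, smul_apply, smul_eq_mul]
  rw [dirDeriv_mul hf (g.diffAt hY hZ), dirDeriv_mul hf (g.diffAt hZ hX), dirDeriv_smul_left,
    bracket_smul_right hf hZ, bracket_smul_left hf hZ]
  simp only [map_add, map_smul, add_apply, smul_apply, smul_eq_mul]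
  rw [g.symm x (Y x) (Z x)]
  ring

theorem koszul_add_third (hX : FieldDiffAt X x) (hY : FieldDiffAt Y x) (hZ : FieldDiffAt Z x)
    (hZ' : FieldDiffAt Z' x) :
    koszul g X Y (Z + Z') x = koszul g X Y Z x + koszul g X Y Z' x := by
  simp only [koszul, field_add_apply, map_add, add_apply]
  rw [dirDeriv_add (g.diffAt hY hZ) (g.diffAt hY hZ'),
    dirDeriv_add (g.diffAt hZ hX) (g.diffAt hZ' hX), dirDeriv_add_left,
    bracket_add_right hZ hZ', bracket_add_left hZ hZ']
  simp only [map_add, add_apply]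
  ring

theorem koszul_smul_first (hX : FieldDiffAt X x) (hY : FieldDiffAt Y x) (hZ : FieldDiffAt Z x)
    (hf : FunDiffAt d f x) : koszul g (f • X) Y Z x = f x * koszul g X Y Z x := by
  simp only [koszul, field_smul_apply, map_smul, smul_apply, smul_eq_mul]
  rw [dirDeriv_mul hf (g.diffAt hZ hX), dirDeriv_mul hf (g.diffAt hX hY), dirDeriv_smul_left,
    bracket_smul_right hf hX, bracket_smul_left hf hX]
  simp only [map_add, map_smul, add_apply, smul_apply, smul_eq_mul]
  rw [g.symm x (Z x) (X x)]
  ring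

theorem koszul_add_first (hX : FieldDiffAt X x) (hX' : FieldDiffAt X' x) (hY : FieldDiffAt Y x)
    (hZ : FieldDiffAt Z x) :
    koszul g (X + X') Y Z x = koszul g X Y Z x + koszul g X' Y Z x := by
  simp only [koszul, field_add_apply, map_add, add_apply]
  rw [dirDeriv_add (g.diffAt hZ hX) (g.diffAt hZ hX'),
    dirDeriv_add (g.diffAt hX hY) (g.diffAt hX' hY), dirDeriv_add_left,
    bracket_add_right hX hX', bracket_add_left hX hX']
  simp only [map_add, add_apply]
  ring

/-- Here the derivatives of `f` along `Z` cancel while those along `X` add up; the surplus is the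
Leibniz term of `∇_X (fY)`. -/
theorem koszul_smul_second (hX : FieldDiffAt X x) (hY : FieldDiffAt Y x) (hZ : FieldDiffAt Z x)
    (hf : FunDiffAt d f x) :
    koszul g X (f • Y) Z x = f x * koszul g X Y Z x + 2 * (dirDeriv X f x * g.val x (Y x) (Z x)) := by
  simp only [koszul, field_smul_apply, map_smul, smul_apply, smul_eq_mul]
  rw [dirDeriv_mul hf (g.diffAt hY hZ), dirDeriv_mul hf (g.diffAt hX hY), dirDeriv_smul_left,
    bracket_smul_right hf hY, bracket_smul_left hf hY]
  simp only [map_add, map_smul, add_apply, smul_apply, smul_eq_mul]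
  rw [g.symm x (Y x) (X x)]
  ring

theorem koszul_add_second (hX : FieldDiffAt X x) (hY : FieldDiffAt Y x) (hY' : FieldDiffAt Y' x)
    (hZ : FieldDiffAt Z x) :
    koszul g X (Y + Y') Z x = koszul g X Y Z x + koszul g X Y' Z x := by
  simp only [koszul, field_add_apply, map_add, add_apply]
  rw [dirDeriv_add (g.diffAt hY hZ) (g.diffAt hY' hZ),
    dirDeriv_add (g.diffAt hX hY) (g.diffAt hX hY'), dirDeriv_add_left,
    bracket_add_right hY hY', bracket_add_left hY hY']
  simp only [map_add, add_apply]
  ring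

theorem koszul_congr (hX : X =ᶠ[𝓝 x] X') (hY : Y =ᶠ[𝓝 x] Y') :
    koszul g X Y Z x = koszul g X' Y' Z x := by
  have hZ : Z =ᶠ[𝓝 x] Z := Filter.EventuallyEq.rfl
  simp only [koszul]
  have h1 : (fun y => g.val y (Y y) (Z y)) =ᶠ[𝓝 x] fun y => g.val y (Y' y) (Z y) :=
    hY.mono fun y hy => by simp only [hy]
  have h2 : (fun y => g.val y (Z y) (X y)) =ᶠ[𝓝 x] fun y => g.val y (Z y) (X' y) :=
    hX.mono fun y hy => by simp only [hy]
  have h3 : (fun y => g.val y (X y) (Y y)) =ᶠ[𝓝 x] fun y => g.val y (X' y) (Y' y) :=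
    hX.mp (hY.mono fun y h1 h2 => by simp only [h1, h2])
  rw [dirDeriv_congr h1, dirDeriv_congr h2, dirDeriv_congr h3,
    bracket_congr hX hY, bracket_congr hY hZ, bracket_congr hZ hX,
    dirDeriv_eq_of_eq hX.eq_of_nhds, dirDeriv_eq_of_eq (X := Y) hY.eq_of_nhds, hX.eq_of_nhds,
    hY.eq_of_nhds]

theorem koszul_smoothAt (hX : SmoothAt X x) (hY : SmoothAt Y x) (hZ : SmoothAt Z x) :
    FunSmoothAt d (koszul g X Y Z) x :=
  (((((dirDeriv_smoothAt g hX (g.smoothAt hY hZ)).add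
    (dirDeriv_smoothAt g hY (g.smoothAt hZ hX))).sub
    (dirDeriv_smoothAt g hZ (g.smoothAt hX hY))).add
    (g.smoothAt (bracket_smoothAt hX hY) hZ)).sub
    (g.smoothAt (bracket_smoothAt hY hZ) hX)).add
    (g.smoothAt (bracket_smoothAt hZ hX) hY)

theorem koszul_tensorialAt (hX : FieldDiffAt X x) (hY : FieldDiffAt Y x) :
    TensorialAt (𝓡 d) (EuclideanSpace ℝ (Fin d)) (fun Z : VField d M => koszul g X Y Z x) x where
  smul hf hZ := koszul_smul_third g hX hY hZ hf
  add hZ hZ' := koszul_add_third g hX hY hZ hZ'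

theorem exists_metric_dual (x : M) (φ : TangentSpace (𝓡 d) x →L[ℝ] ℝ) :
    ∃ n, ∀ w, g.val x n w = φ w := by
  obtain ⟨e, he⟩ := exists_isFrameAt (d := d) x
  have hd := he.isDualFrame g
  refine ⟨∑ a, φ (e a x) • raised g e a x, fun w => ?_⟩
  conv_rhs => rw [← hd.sum_eq w]
  simp [map_sum, sum_apply, mul_comm]

/-- The choice in `leviCivita` is satisfiable by half of the metric dual of the Koszul covector.
Tensoriality in `Z` then extends the formula from smooth to merely differentiable `Z`. -/
theorem leviCivita_spec (hX : FieldDiffAt X x) (hY : FieldDiffAt Y x) (hZ : FieldDiffAt Z x) :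
    2 * g.val x (leviCivita g X Y x) (Z x) = koszul g X Y Z x := by
  have hT := koszul_tensorialAt g hX hY
  obtain ⟨n, hn⟩ := exists_metric_dual g x (TensorialAt.mkHom _ x hT)
  have hex : ∃ n : TangentSpace (𝓡 d) x, ∀ Z : VField d M, SmoothAt Z x →
      2 * g.val x n (Z x) = koszul g X Y Z x := by
    refine ⟨(2 : ℝ)⁻¹ • n, fun Z hZ => ?_⟩
    rw [map_smul, smul_apply, hn, TensorialAt.mkHom_apply hT hZ.diffAt, smul_eq_mul]
    ring
  have h := Classical.epsilon_spec hex (ext x (Z x)) (smoothAt_ext _)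
  rw [ext_self] at h
  exact h.trans (hT.pointwise (smoothAt_ext _).diffAt hZ (ext_self _))

/-- Nondegeneracy gives uniqueness; thereby each rule for the Koszul expression becomes a rule for
`∇`. -/
theorem leviCivita_eq (hX : FieldDiffAt X x) (hY : FieldDiffAt Y x) {n : TangentSpace (𝓡 d) x}
    (h : ∀ Z : VField d M, FieldDiffAt Z x → 2 * g.val x n (Z x) = koszul g X Y Z x) :
    leviCivita g X Y x = n := by
  refine g.ext_left fun u => ?_
  have h1 := h (ext x u) (smoothAt_ext u).diffAt
  have h2 := leviCivita_spec g hX hY (smoothAt_ext u).diffAt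
  rw [ext_self] at h1 h2
  linarith

theorem leviCivita_add_left (hX : FieldDiffAt X x) (hX' : FieldDiffAt X' x)
    (hY : FieldDiffAt Y x) :
    leviCivita g (X + X') Y x = leviCivita g X Y x + leviCivita g X' Y x := by
  refine leviCivita_eq g (hX.add hX') hY fun Z hZ => ?_
  rw [koszul_add_first g hX hX' hY hZ, ← leviCivita_spec g hX hY hZ,
    ← leviCivita_spec g hX' hY hZ, map_add, add_apply]
  ring

theorem leviCivita_smul_left (hf : FunDiffAt d f x) (hX : FieldDiffAt X x)
    (hY : FieldDiffAt Y x) :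
    leviCivita g (f • X) Y x = f x • leviCivita g X Y x := by
  refine leviCivita_eq g (hX.smul hf) hY fun Z hZ => ?_
  rw [koszul_smul_first g hX hY hZ hf, ← leviCivita_spec g hX hY hZ, map_smul, smul_apply,
    smul_eq_mul]
  ring

theorem leviCivita_add_right (hX : FieldDiffAt X x) (hY : FieldDiffAt Y x)
    (hY' : FieldDiffAt Y' x) :
    leviCivita g X (Y + Y') x = leviCivita g X Y x + leviCivita g X Y' x := by
  refine leviCivita_eq g hX (hY.add hY') fun Z hZ => ?_
  rw [koszul_add_second g hX hY hY' hZ, ← leviCivita_spec g hX hY hZ,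
    ← leviCivita_spec g hX hY' hZ, map_add, add_apply]
  ring

theorem leviCivita_smul_right (hf : FunDiffAt d f x) (hX : FieldDiffAt X x)
    (hY : FieldDiffAt Y x) :
    leviCivita g X (f • Y) x = f x • leviCivita g X Y x + dirDeriv X f x • Y x := by
  refine leviCivita_eq g hX (hY.smul hf) fun Z hZ => ?_
  rw [koszul_smul_second g hX hY hZ hf, ← leviCivita_spec g hX hY hZ, map_add, map_smul, map_smul,
    add_apply, smul_apply, smul_apply, smul_eq_mul, smul_eq_mul]
  ring

theorem leviCivita_congr (hX : X =ᶠ[𝓝 x] X') (hY : Y =ᶠ[𝓝 x] Y') :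
    leviCivita g X Y x = leviCivita g X' Y' x := by
  simp only [leviCivita, koszul_congr g hX hY]

theorem leviCivita_tensorialAt (hY : FieldDiffAt Y x) :
    TensorialAt (𝓡 d) (EuclideanSpace ℝ (Fin d)) (fun X : VField d M => leviCivita g X Y x) x where
  smul hf hX := leviCivita_smul_left g hf hX hY
  add hX hX' := leviCivita_add_left g hX hX' hY

theorem leviCivita_eq_of_eq (hX : FieldDiffAt X x) (hX' : FieldDiffAt X' x)
    (hY : FieldDiffAt Y x) (h : X x = X' x) : leviCivita g X Y x = leviCivita g X' Y x :=
  (leviCivita_tensorialAt g hY).pointwise hX hX' h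

/-- Antisymmetrising the Koszul expression in `X`, `Y` cancels the derivative terms and leaves `2
g([X, Y], Z)`. -/
theorem leviCivita_torsion (hX : FieldDiffAt X x) (hY : FieldDiffAt Y x) :
    leviCivita g X Y x - leviCivita g Y X x = bracket X Y x := by
  refine g.ext_left fun u => ?_
  have hZ := (smoothAt_ext u).diffAt
  have h1 := leviCivita_spec g hX hY hZ
  have h2 := leviCivita_spec g hY hX hZ
  simp only [koszul, ext_self] at h1 h2
  rw [bracket_swap (X := Y) (Y := X), bracket_swap (X := X) (Y := ext x u),
    bracket_swap (X := ext x u) (Y := Y)] at h2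
  simp only [map_neg, neg_apply, g.symm _ (X _) (ext x u _), g.symm _ (ext x u _) (Y _),
    g.symm _ (Y _) (X _)] at h1 h2
  rw [map_sub, sub_apply]
  linarith

/-- Symmetrising the Koszul expression in `Y`, `Z` cancels the brackets and leaves `2 X(g(Y, Z))`.
-/
theorem leviCivita_metric (hX : FieldDiffAt X x) (hY : FieldDiffAt Y x) (hZ : FieldDiffAt Z x) :
    dirDeriv X (fun y => g.val y (Y y) (Z y)) x
      = g.val x (leviCivita g X Y x) (Z x) + g.val x (Y x) (leviCivita g X Z x) := by
  have h1 := leviCivita_spec g hX hY hZ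
  have h2 := leviCivita_spec g hX hZ hY
  simp only [koszul] at h1 h2
  rw [bracket_swap (X := X) (Y := Z), bracket_swap (X := Z) (Y := Y),
    bracket_swap (X := Y) (Y := X)] at h2
  simp only [map_neg, neg_apply, g.symm _ (Z _) (Y _), g.symm _ (Y _) (X _),
    g.symm _ (Z _) (X _)] at h1 h2
  rw [g.symm x (Y x) (leviCivita g X Z x)]
  linarith

theorem leviCivita_smoothAt (hX : SmoothAt X x) (hY : SmoothAt Y x) :
    SmoothAt (leviCivita g X Y) x := by
  obtain ⟨e, he⟩ := exists_isFrameAt (d := d) x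
  refine he.smoothAt_of_pairing g fun a => ?_
  have h1 : FunSmoothAt d (fun y => 2⁻¹ * koszul g X Y (e a) y) x :=
    (FunSmoothAt.const _).mul (koszul_smoothAt g hX hY (he.smoothAt a))
  refine ContMDiffAt.congr_of_eventuallyEq h1 ?_
  filter_upwards [hX.eventually, hY.eventually, (he.smoothAt a).eventually] with y h2 h3 h4
  rw [← leviCivita_spec g h2 h3 h4, g.symm]
  ring

end LeviCivita

/-! ### Regularity of differential forms, tested on vector fields. -/

section FormRegularity

variable {d : ℕ} {M : Type*} [TopologicalSpace M] [ChartedSpace (EuclideanSpace ℝ (Fin d)) M]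

theorem IsDualFrame.alternating_eq_sum {V : Type*} [AddCommGroup V] [Module ℝ V]
    [TopologicalSpace V] {n p : ℕ} {g : V →L[ℝ] V →L[ℝ] ℝ} {e E : Fin n → V}
    (h : IsDualFrame g e E) (α : V [⋀^Fin p]→ₗ[ℝ] ℝ) (w : Fin p → V) :
    α w = ∑ s : Fin p → Fin n, (∏ i, g (E (s i)) (w i)) * α fun i => e (s i) := by
  conv_lhs => rw [show w = fun i => ∑ a, g (E a) (w i) • e a from
    funext fun i => (h.sum_eq (w i)).symm]
  refine (α.toMultilinearMap.map_sum (fun i a => g (E a) (w i) • e a)).trans ?_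
  exact Finset.sum_congr rfl fun s _ =>
    α.toMultilinearMap.map_smul_univ (fun i => g (E (s i)) (w i)) (fun i => e (s i))

/-- The frame expansion is a polynomial in continuous coordinates. This supplies continuity when
`∇_X α` is built algebraically. -/
theorem IsDualFrame.continuous_alternating {V : Type*} [AddCommGroup V] [Module ℝ V]
    [TopologicalSpace V] {n p : ℕ} {g : V →L[ℝ] V →L[ℝ] ℝ} {e E : Fin n → V}
    (h : IsDualFrame g e E) (α : V [⋀^Fin p]→ₗ[ℝ] ℝ) : Continuous α := by
  rw [show (α : (Fin p → V) → ℝ) = _ from funext (h.alternating_eq_sum α)]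
  exact continuous_finsetSum _ fun s _ => (continuous_finsetProd _ fun i _ =>
    (g (E (s i))).continuous.comp (continuous_apply i)).mul continuous_const

variable [IsManifold (𝓡 d) ∞ M] {p : ℕ}

/-- Differentiability of a form at a point, tested on vector fields. -/
def FormDiffAt (α : DForm d M p) (x : M) : Prop :=
  ∀ Y : Fin p → VField d M, (∀ i, FieldDiffAt (Y i) x) →
    FunDiffAt d (fun y => α y fun i => Y i y) x

/-- Smoothness of a form at a point, tested on vector fields. -/
def FormSmoothAt (α : DForm d M p) (x : M) : Prop :=
  ∀ Y : Fin p → VField d M, (∀ i, SmoothAt (Y i) x) →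
    FunSmoothAt d (fun y => α y fun i => Y i y) x

theorem FormSmoothAt.congr {α β : DForm d M p} {x : M} (h : FormSmoothAt α x)
    (hαβ : ∀ᶠ y in 𝓝 x, β y = α y) : FormSmoothAt β x := fun Y hY =>
  ContMDiffAt.congr_of_eventuallyEq (h Y hY) (hαβ.mono fun y hy => by simp only [hy])

variable (g : Metric d M) {e : Fin d → VField d M} {x : M}

theorem formDiffAt_of_components {α : DForm d M p} (hE : ∀ a, FieldDiffAt (raised g e a) x)
    (hd : ∀ᶠ y in 𝓝 x, IsDualFrame (g.val y) (fun a => e a y) (fun a => raised g e a y))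
    (hc : ∀ s : Fin p → Fin d, FunDiffAt d (fun y => α y fun i => e (s i) y) x) :
    FormDiffAt α x := by
  intro Y hY
  have h1 : FunDiffAt d (fun y => ∑ s : Fin p → Fin d,
      (∏ i, g.val y (raised g e (s i) y) (Y i y)) * α y fun i => e (s i) y) x :=
    FunDiffAt.sum fun s _ => (FunDiffAt.prod fun i _ => g.diffAt (hE _) (hY i)).mul (hc s)
  refine MDifferentiableAt.congr_of_eventuallyEq h1 ?_
  filter_upwards [hd] with y hy
  exact hy.alternating_eq_sum (α y).toAlternatingMap _

include g in
theorem IsFrameAt.formSmoothAt_of_components (he : IsFrameAt e x) {α : DForm d M p}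
    (hc : ∀ s : Fin p → Fin d, FunSmoothAt d (fun y => α y fun i => e (s i) y) x) :
    FormSmoothAt α x := by
  intro Y hY
  have h1 : FunSmoothAt d (fun y => ∑ s : Fin p → Fin d,
      (∏ i, g.val y (raised g e (s i) y) (Y i y)) * α y fun i => e (s i) y) x :=
    FunSmoothAt.sum fun s _ =>
      (FunSmoothAt.prod fun i _ => g.smoothAt (he.raised_smoothAt g _) (hY i)).mul (hc s)
  refine ContMDiffAt.congr_of_eventuallyEq h1 ?_
  filter_upwards [he.eventually g] with y hy
  exact hy.2.alternating_eq_sum (α y).toAlternatingMap _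

-- The test runs over all fields, so no common neighbourhood is evident; a frame reduces it to
-- finitely many component functions.
include g in
theorem FormSmoothAt.eventually {α : DForm d M p} (h : FormSmoothAt α x) :
    ∀ᶠ y in 𝓝 x, FormDiffAt α y := by
  obtain ⟨e, he⟩ := exists_isFrameAt (d := d) x
  filter_upwards [Filter.eventually_all.2 fun a => (he.raised_smoothAt g a).eventually,
    (he.eventually g).eventually_nhds, Filter.eventually_all.2 fun s : Fin p → Fin d =>
      (h (fun i => e (s i)) fun i => he.smoothAt _).eventually] with y h1 h2 h3
  exact formDiffAt_of_components g h1 (h2.mono fun z hz => hz.2) h3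

include g in
theorem FormSmoothAt.diffAt {α : DForm d M p} (h : FormSmoothAt α x) : FormDiffAt α x :=
  (h.eventually g).self_of_nhds

section Operations

variable {α β : DForm d M p} {f : M → ℝ} {Z : VField d M}

theorem FormDiffAt.add (hα : FormDiffAt α x) (hβ : FormDiffAt β x) : FormDiffAt (α + β) x :=
  fun Y hY => FunDiffAt.add (hα Y hY) (hβ Y hY)

theorem FormDiffAt.smul (hf : FunDiffAt d f x) (hα : FormDiffAt α x) :
    FormDiffAt (fun y => f y • α y) x :=
  fun Y hY => FunDiffAt.mul hf (hα Y hY)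

theorem FormDiffAt.const_smul (c : ℝ) (hα : FormDiffAt α x) : FormDiffAt (c • α) x :=
  FormDiffAt.smul (f := fun _ => c) mdifferentiableAt_const hα

theorem FormDiffAt.sum {ι : Type*} {s : Finset ι} {α : ι → DForm d M p}
    (h : ∀ i ∈ s, FormDiffAt (α i) x) : FormDiffAt (fun y => ∑ i ∈ s, α i y) x := by
  classical
  induction s using Finset.induction_on with
  | empty => exact fun Y _ => mdifferentiableAt_const
  | insert a s ha ih =>
    simp only [Finset.sum_insert ha]
    exact FormDiffAt.add (h a (by simp)) (ih fun i hi => h i (by simp [hi]))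

theorem FormDiffAt.interior {α : DForm d M (p + 1)} (hZ : FieldDiffAt Z x) (hα : FormDiffAt α x) :
    FormDiffAt (fun y => interior (Z y) (α y)) x := by
  intro Y hY
  have := hα (Fin.cons Z Y) (Fin.cases hZ hY)
  refine this.congr_of_eventuallyEq (Filter.Eventually.of_forall fun y => ?_)
  simp only [interior_apply]
  congr 1
  funext i
  exact Fin.cases rfl (fun _ => rfl) i

theorem FormDiffAt.creator (hZ : FieldDiffAt Z x) (hα : FormDiffAt α x) :
    FormDiffAt (fun y => creator (g.val y) (Z y) (α y)) x := by
  intro Y hY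
  simp only [PseudoRiemannian.creator, oneFormWedge_apply]
  exact FunDiffAt.sum fun i _ => FunDiffAt.mul mdifferentiableAt_const
    ((g.diffAt hZ (hY i)).mul (hα (i.removeNth Y) fun j => hY _))

theorem FormSmoothAt.add (hα : FormSmoothAt α x) (hβ : FormSmoothAt β x) :
    FormSmoothAt (α + β) x :=
  fun Y hY => FunSmoothAt.add (hα Y hY) (hβ Y hY)

theorem FormSmoothAt.smul (hf : FunSmoothAt d f x) (hα : FormSmoothAt α x) :
    FormSmoothAt (fun y => f y • α y) x :=
  fun Y hY => FunSmoothAt.mul hf (hα Y hY)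

theorem FormSmoothAt.const_smul (c : ℝ) (hα : FormSmoothAt α x) : FormSmoothAt (c • α) x :=
  FormSmoothAt.smul (f := fun _ => c) (FunSmoothAt.const c) hα

theorem FormSmoothAt.sum {ι : Type*} {s : Finset ι} {α : ι → DForm d M p}
    (h : ∀ i ∈ s, FormSmoothAt (α i) x) : FormSmoothAt (fun y => ∑ i ∈ s, α i y) x := by
  classical
  induction s using Finset.induction_on with
  | empty => exact fun Y _ => FunSmoothAt.const 0
  | insert a s ha ih =>
    simp only [Finset.sum_insert ha]
    exact FormSmoothAt.add (h a (by simp)) (ih fun i hi => h i (by simp [hi]))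

theorem FormSmoothAt.interior {α : DForm d M (p + 1)} (hZ : SmoothAt Z x)
    (hα : FormSmoothAt α x) : FormSmoothAt (fun y => interior (Z y) (α y)) x := by
  intro Y hY
  have := hα (Fin.cons Z Y) (Fin.cases hZ hY)
  refine ContMDiffAt.congr_of_eventuallyEq this (Filter.Eventually.of_forall fun y => ?_)
  simp only [interior_apply]
  congr 1
  funext i
  exact Fin.cases rfl (fun _ => rfl) i

theorem FormSmoothAt.creator (hZ : SmoothAt Z x) (hα : FormSmoothAt α x) :
    FormSmoothAt (fun y => creator (g.val y) (Z y) (α y)) x := by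
  intro Y hY
  simp only [PseudoRiemannian.creator, oneFormWedge_apply]
  exact FunSmoothAt.sum fun i _ => FunSmoothAt.mul (FunSmoothAt.const _)
    ((g.smoothAt hZ (hY i)).mul (hα (i.removeNth Y) fun j => hY _))

end Operations

section CoordinateFields

/-- The vector field with constant components `v` in the preferred chart at `x`. -/
def coordField (x : M) (v : EuclideanSpace ℝ (Fin d)) : VField d M := fun y =>
  (trivializationAt (EuclideanSpace ℝ (Fin d)) (fun y : M => TangentSpace (𝓡 d) y) x).symmL ℝ y v

theorem coordField_eq {x y : M} (hy : y ∈ (chartAt (EuclideanSpace ℝ (Fin d)) x).source)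
    (v : EuclideanSpace ℝ (Fin d)) :
    coordField x v y = mfderiv 𝓘(ℝ, EuclideanSpace ℝ (Fin d)) (𝓡 d) (extChartAt (𝓡 d) x).symm
      (extChartAt (𝓡 d) x y) v := by
  rw [coordField, TangentBundle.symmL_trivializationAt hy]
  simp only [ModelWithCorners.Boundaryless.range_eq_univ, mfderivWithin_univ]
  rfl

theorem coordField_isFrameAt (x : M) :
    IsFrameAt (fun a => coordField x (EuclideanSpace.basisFun (Fin d) ℝ a)) x := by
  set t := trivializationAt (EuclideanSpace ℝ (Fin d)) (fun y : M => TangentSpace (𝓡 d) y) x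
    with ht
  set b := (EuclideanSpace.basisFun (Fin d) ℝ).toBasis with hb
  have h1 := t.isLocalFrameOn_localFrame_baseSet (𝓡 d) ∞ b
  have hx : x ∈ t.baseSet := FiberBundle.mem_baseSet_trivializationAt' x
  have h2 : IsFrameOn (fun a => coordField x (EuclideanSpace.basisFun (Fin d) ℝ a)) t.baseSet :=
    ⟨t.open_baseSet, h1.congr fun a y hy => by
      rw [t.localFrame_apply_of_mem_baseSet b hy]
      simp [coordField, Bundle.Trivialization.basisAt, hb, ← ht, t.symmL_apply hy]⟩
  exact h2.isFrameAt hx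

end CoordinateFields

-- Components on the coordinate fields are components of the chart representative composed with the
-- chart, so smoothness in charts gives smoothness on fields.
include g in
theorem DForm.IsSmooth.formSmoothAt {α : DForm d M p} (hα : α.IsSmooth) (x : M) :
    FormSmoothAt α x := by
  refine (coordField_isFrameAt x).formSmoothAt_of_components g fun s => ?_
  have hφ : ContMDiffAt (𝓡 d) 𝓘(ℝ, EuclideanSpace ℝ (Fin d)) ∞ (extChartAt (𝓡 d) x) x :=
    contMDiffAt_extChartAt
  have h1 : ContDiffAt ℝ ∞ (α.inChart x) (extChartAt (𝓡 d) x x) :=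
    (hα x).contDiffAt ((isOpen_extChartAt_target x).mem_nhds (mem_extChartAt_target x))
  have h2 : ContDiffAt ℝ ∞ (fun z => α.inChart x z
      fun i => EuclideanSpace.basisFun (Fin d) ℝ (s i)) (extChartAt (𝓡 d) x x) :=
    (ContinuousAlternatingMap.apply ℝ (EuclideanSpace ℝ (Fin d)) ℝ
      (fun i => EuclideanSpace.basisFun (Fin d) ℝ (s i))).contDiff.contDiffAt.comp _ h1
  have h3 := h2.contMDiffAt.comp x hφ
  refine ContMDiffAt.congr_of_eventuallyEq h3 ?_
  filter_upwards [(chartAt (EuclideanSpace ℝ (Fin d)) x).open_source.mem_nhds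
    (mem_chart_source _ x)] with y hy
  have hy' : (extChartAt (𝓡 d) x).symm (extChartAt (𝓡 d) x y) = y :=
    (extChartAt (𝓡 d) x).left_inv (by rwa [extChartAt_source])
  simp only [Function.comp_apply, DForm.inChart,
    coordField_eq hy]
  rw [hy']
  rfl

end FormRegularity

/-! ### The covariant derivative of differential forms. -/

section Nabla

variable {d : ℕ} {M : Type*} [TopologicalSpace M] [ChartedSpace (EuclideanSpace ℝ (Fin d)) M]
  [IsManifold (𝓡 d) ∞ M] (g : Metric d M) {p : ℕ} {X X' : VField d M} {α β : DForm d M p} {x : M}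

/-- The Leibniz expression `X(α(Y)) - ∑ i, α(Y₁, …, ∇_X Y_i, …, Y_p)` at `x`. -/
def nablaLeibniz (X : VField d M) (α : DForm d M p) (x : M) (Y : Fin p → VField d M) : ℝ :=
  dirDeriv X (fun y => α y (fun i => Y i y)) x
    - ∑ i, α x (Function.update (fun j => Y j x) i (leviCivita g X (Y i) x))

theorem update_field_apply (Y : Fin p → VField d M) (i : Fin p) (Z : VField d M) (y : M) :
    (fun j => Function.update Y i Z j y) = Function.update (fun j => Y j y) i (Z y) := by
  funext j
  by_cases h : j = i
  · subst h; simp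
  · simp [h]

theorem fieldDiffAt_update {Y : Fin p → VField d M} (hY : ∀ i, FieldDiffAt (Y i) x) (i : Fin p)
    {Z : VField d M} (hZ : FieldDiffAt Z x) (j : Fin p) :
    FieldDiffAt (Function.update Y i Z j) x := by
  by_cases h : j = i
  · subst h; simpa using hZ
  · simpa [h] using hY j

/-- The term `X(f) α(…)` from differentiating the function cancels the one from `∇_X (fZ)` in slot
`i`; the other slots are linear over functions. -/
theorem nablaLeibniz_tensorialAt (hX : FieldDiffAt X x) (hα : FormDiffAt α x)
    {Y : Fin p → VField d M} (hY : ∀ i, FieldDiffAt (Y i) x) (i : Fin p) :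
    TensorialAt (𝓡 d) (EuclideanSpace ℝ (Fin d))
      (fun Z : VField d M => nablaLeibniz g X α x (Function.update Y i Z)) x where
  smul {f Z} hf hZ := by
    have h1 : (fun y => α y fun j => Function.update Y i (f • Z) j y)
        = fun y => f y * α y fun j => Function.update Y i Z j y := by
      funext y
      rw [update_field_apply, update_field_apply, field_smul_apply,
        ContinuousAlternatingMap.map_update_smul, smul_eq_mul]
    have h2 : ∀ k, α x (Function.update (fun j => Function.update Y i (f • Z) j x) k
          (leviCivita g X (Function.update Y i (f • Z) k) x))
        = f x * α x (Function.update (fun j => Function.update Y i Z j x) k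
          (leviCivita g X (Function.update Y i Z k) x))
          + if k = i then dirDeriv X f x * α x (fun j => Function.update Y i Z j x) else 0 := by
      intro k
      simp only [update_field_apply]
      by_cases h : k = i
      · subst h
        simp only [Function.update_self, Function.update_idem, if_true]
        rw [leviCivita_smul_right g hf hX hZ, ContinuousAlternatingMap.map_update_add,
          ContinuousAlternatingMap.map_update_smul, ContinuousAlternatingMap.map_update_smul,
          smul_eq_mul, smul_eq_mul]
      · rw [Function.update_of_ne h, Function.update_of_ne h, if_neg h, add_zero,
          Function.update_comm (Ne.symm h), Function.update_comm (Ne.symm h), field_smul_apply,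
          ContinuousAlternatingMap.map_update_smul, smul_eq_mul]
    have h3 := hα _ (fieldDiffAt_update hY i hZ)
    simp only [nablaLeibniz, h1, h2]
    rw [dirDeriv_mul hf h3, Finset.sum_add_distrib, ← Finset.mul_sum, Finset.sum_ite_eq',
      if_pos (Finset.mem_univ i), smul_eq_mul]
    ring
  add {Z Z'} hZ hZ' := by
    have h1 : (fun y => α y fun j => Function.update Y i (Z + Z') j y)
        = fun y => (α y fun j => Function.update Y i Z j y)
          + α y fun j => Function.update Y i Z' j y := by
      funext y
      rw [update_field_apply, update_field_apply, update_field_apply, field_add_apply,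
        ContinuousAlternatingMap.map_update_add]
    have h2 : ∀ k, α x (Function.update (fun j => Function.update Y i (Z + Z') j x) k
          (leviCivita g X (Function.update Y i (Z + Z') k) x))
        = α x (Function.update (fun j => Function.update Y i Z j x) k
            (leviCivita g X (Function.update Y i Z k) x))
          + α x (Function.update (fun j => Function.update Y i Z' j x) k
            (leviCivita g X (Function.update Y i Z' k) x)) := by
      intro k
      simp only [update_field_apply]
      by_cases h : k = i
      · subst h
        simp only [Function.update_self, Function.update_idem]
        rw [leviCivita_add_right g hX hZ hZ', ContinuousAlternatingMap.map_update_add]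
      · rw [Function.update_of_ne h, Function.update_of_ne h, Function.update_of_ne h,
          Function.update_comm (Ne.symm h), Function.update_comm (Ne.symm h),
          Function.update_comm (Ne.symm h), field_add_apply,
          ContinuousAlternatingMap.map_update_add]
    simp only [nablaLeibniz, h1, h2]
    rw [dirDeriv_add (hα _ (fieldDiffAt_update hY i hZ)) (hα _ (fieldDiffAt_update hY i hZ')),
      Finset.sum_add_distrib]
    ring

theorem nablaLeibniz_eq_of_eq (hX : FieldDiffAt X x) (hα : FormDiffAt α x)
    {Y Y' : Fin p → VField d M} (hY : ∀ i, FieldDiffAt (Y i) x) (hY' : ∀ i, FieldDiffAt (Y' i) x)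
    (h : ∀ i, Y i x = Y' i x) : nablaLeibniz g X α x Y = nablaLeibniz g X α x Y' := by
  classical
  -- `Y` is replaced by `Y'` one slot at a time, with tensoriality in the slot that changes.
  have key : ∀ s : Finset (Fin p),
      nablaLeibniz g X α x (s.piecewise Y' Y) = nablaLeibniz g X α x Y := by
    intro s
    induction s using Finset.induction_on with
    | empty => simp
    | insert a s ha ih =>
      have hs : ∀ i, FieldDiffAt (s.piecewise Y' Y i) x := fun i => by
        by_cases hi : i ∈ s
        · simpa [hi] using hY' i
        · simpa [hi] using hY i
      rw [Finset.piecewise_insert, ← ih]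
      have := (nablaLeibniz_tensorialAt g hX hα hs a).pointwise (hY' a) (hs a)
        (by simp [Finset.piecewise_eq_of_notMem _ _ _ ha, h])
      rwa [Function.update_eq_self] at this
  rw [← key Finset.univ, Finset.piecewise_univ]

/-- The function `α(Y)` is identically zero, and only the slots `i` and `j` contribute to the sum.
Their contributions differ by a transposition of the arguments and so cancel. -/
theorem nablaLeibniz_eq_zero {Y : Fin p → VField d M} {i j : Fin p} (hij : i ≠ j)
    (h : Y i = Y j) : nablaLeibniz g X α x Y = 0 := by
  have h1 : (fun y => α y fun k => Y k y) = fun _ => 0 := by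
    funext y
    exact (α y).map_eq_zero_of_eq _ (congrFun h y) hij
  rw [nablaLeibniz, h1, dirDeriv_const, zero_sub, neg_eq_zero,
    ← Finset.sum_subset (Finset.subset_univ {i, j}), Finset.sum_pair hij]
  · have h2 : Function.update (fun k => Y k x) i (leviCivita g X (Y i) x)
        = Function.update (fun k => Y k x) j (leviCivita g X (Y j) x) ∘ Equiv.swap i j := by
      funext k
      by_cases hi : k = i
      · subst hi; simp [h]
      · by_cases hj : k = j
        · subst hj
          simp [hi, hij, h]
        · simp [Equiv.swap_apply_of_ne_of_ne hi hj, hi, hj]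
    rw [h2]
    have h3 := (α x).toAlternatingMap.map_swap
      (Function.update (fun k => Y k x) j (leviCivita g X (Y j) x)) hij
    change α x _ = - α x _ at h3
    rw [h3, neg_add_cancel]
  · intro k _ hk
    simp only [Finset.mem_insert, Finset.mem_singleton, not_or] at hk
    refine (α x).map_eq_zero_of_eq _ (i := i) (j := j) ?_ hij
    rw [Function.update_of_ne (Ne.symm hk.1), Function.update_of_ne (Ne.symm hk.2), h]

/-- The value on tangent vectors is the Leibniz expression on arbitrary extensions; tensoriality
makes it multilinear and independent of the extensions. -/
theorem exists_nabla (hX : FieldDiffAt X x) (hα : FormDiffAt α x) :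
    ∃ η : (TangentSpace (𝓡 d) x) [⋀^Fin p]→L[ℝ] ℝ, ∀ Y : Fin p → VField d M,
      (∀ i, FieldDiffAt (Y i) x) → η (fun i => Y i x) = nablaLeibniz g X α x Y := by
  have hext (w : Fin p → TangentSpace (𝓡 d) x) (i) : FieldDiffAt (ext x (w i)) x :=
    (smoothAt_ext _).diffAt
  have hup (w : Fin p → TangentSpace (𝓡 d) x) (i : Fin p) (v : TangentSpace (𝓡 d) x) :
      (fun j => ext x (Function.update w i v j))
        = Function.update (fun j => ext x (w j)) i (ext x v) := by
    funext j
    by_cases h : j = i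
    · subst h; simp
    · simp [h]
  let A : (TangentSpace (𝓡 d) x) [⋀^Fin p]→ₗ[ℝ] ℝ :=
    { toFun := fun w => nablaLeibniz g X α x fun i => ext x (w i)
      map_update_add' := by
        intro inst w i u v
        rw [Subsingleton.elim inst (instDecidableEqFin p), hup, hup, hup]
        have hT := nablaLeibniz_tensorialAt g hX hα (hext w) i
        rw [← hT.add (smoothAt_ext u).diffAt (smoothAt_ext v).diffAt]
        exact hT.pointwise (smoothAt_ext _).diffAt
          ((smoothAt_ext u).diffAt.add (smoothAt_ext v).diffAt) (by simp)
      map_update_smul' := by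
        intro inst w i c v
        rw [Subsingleton.elim inst (instDecidableEqFin p), hup, hup]
        have hT := nablaLeibniz_tensorialAt g hX hα (hext w) i
        have hc : FunDiffAt d (fun _ : M => c) x := mdifferentiableAt_const
        rw [← hT.smul hc (smoothAt_ext v).diffAt]
        exact hT.pointwise (smoothAt_ext _).diffAt
          ((smoothAt_ext v).diffAt.smul hc) (by simp)
      map_eq_zero_of_eq' := fun w i j h hij => nablaLeibniz_eq_zero g hij (by simp only [h]) }
  obtain ⟨e, he⟩ := exists_isFrameAt (d := d) x
  refine ⟨{ A with cont := (he.isDualFrame g).continuous_alternating A }, fun Y hY => ?_⟩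
  exact nablaLeibniz_eq_of_eq g hX hα (fun i => (smoothAt_ext _).diffAt) hY fun i => ext_self _

theorem form_ext_fields {η θ : (TangentSpace (𝓡 d) x) [⋀^Fin p]→L[ℝ] ℝ}
    (h : ∀ Y : Fin p → VField d M, (∀ i, SmoothAt (Y i) x) →
      η (fun i => Y i x) = θ fun i => Y i x) : η = θ := by
  refine ContinuousAlternatingMap.ext fun w => ?_
  have := h (fun i => ext x (w i)) fun i => smoothAt_ext _
  simpa using this

/-- The choice in `nabla` constrains smooth fields only. They already determine the form at `x`, so
it is the one of `exists_nabla`, which obeys the rule on differentiable fields. -/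
theorem nabla_apply (hX : FieldDiffAt X x) (hα : FormDiffAt α x) {Y : Fin p → VField d M}
    (hY : ∀ i, FieldDiffAt (Y i) x) :
    nabla g X α x (fun i => Y i x) = dirDeriv X (fun y => α y (fun i => Y i y)) x
      - ∑ i, α x (Function.update (fun j => Y j x) i (leviCivita g X (Y i) x)) := by
  obtain ⟨η, hη⟩ := exists_nabla g hX hα
  have h1 : nabla g X α x = η := by
    have hex : ∃ η : (TangentSpace (𝓡 d) x) [⋀^Fin p]→L[ℝ] ℝ, ∀ Y : Fin p → VField d M,
        (∀ i, SmoothAt (Y i) x) → η (fun i => Y i x)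
          = dirDeriv X (fun y => α y (fun i => Y i y)) x
            - ∑ i, α x (Function.update (fun j => Y j x) i (leviCivita g X (Y i) x)) :=
      ⟨η, fun Y hY => hη Y fun i => (hY i).diffAt⟩
    refine form_ext_fields fun Y hY => ?_
    rw [hη Y fun i => (hY i).diffAt]
    exact Classical.epsilon_spec hex Y hY
  rw [h1, hη Y hY, nablaLeibniz]

theorem nabla_eq (hX : FieldDiffAt X x) (hα : FormDiffAt α x)
    {η : (TangentSpace (𝓡 d) x) [⋀^Fin p]→L[ℝ] ℝ}
    (h : ∀ Y : Fin p → VField d M, (∀ i, SmoothAt (Y i) x) →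
      η (fun i => Y i x) = dirDeriv X (fun y => α y (fun i => Y i y)) x
        - ∑ i, α x (Function.update (fun j => Y j x) i (leviCivita g X (Y i) x))) :
    nabla g X α x = η :=
  form_ext_fields fun Y hY => by rw [h Y hY, nabla_apply g hX hα fun i => (hY i).diffAt]

theorem nabla_congr (hX : X =ᶠ[𝓝 x] X') (hα : ∀ᶠ y in 𝓝 x, α y = β y) :
    nabla g X α x = nabla g X' β x := by
  have h1 (Y : Fin p → VField d M) : dirDeriv X (fun y => α y (fun i => Y i y)) x
      = dirDeriv X' (fun y => β y (fun i => Y i y)) x := by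
    rw [dirDeriv_eq_of_eq hX.eq_of_nhds]
    exact dirDeriv_congr (hα.mono fun y hy => by simp only [hy])
  have h2 (Y : VField d M) : leviCivita g X Y x = leviCivita g X' Y x :=
    leviCivita_congr g hX Filter.EventuallyEq.rfl
  simp only [nabla, h1, h2, hα.self_of_nhds]

theorem nabla_smoothAt (hX : SmoothAt X x) (hα : FormSmoothAt α x) :
    FormSmoothAt (nabla g X α) x := by
  intro Y hY
  have h1 : FunSmoothAt d (fun y => dirDeriv X (fun z => α z (fun i => Y i z)) y
      - ∑ i, α y (fun j => Function.update Y i (leviCivita g X (Y i)) j y)) x := by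
    refine (dirDeriv_smoothAt g hX (hα Y hY)).sub (FunSmoothAt.sum fun i _ => hα _ fun j => ?_)
    by_cases h : j = i
    · subst h; simpa using leviCivita_smoothAt g hX (hY j)
    · simpa [h] using hY j
  refine ContMDiffAt.congr_of_eventuallyEq h1 ?_
  filter_upwards [hX.eventually, hα.eventually g,
    Filter.eventually_all.2 fun i => (hY i).eventually] with y h2 h3 h4
  rw [nabla_apply g h2 h3 h4]
  simp only [update_field_apply]

section Linearity

theorem nabla_add_left (hX : FieldDiffAt X x) (hX' : FieldDiffAt X' x) (hα : FormDiffAt α x) :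
    nabla g (X + X') α x = nabla g X α x + nabla g X' α x := by
  refine nabla_eq g (hX.add hX') hα fun Y hY => ?_
  have hY' := fun i => (hY i).diffAt
  rw [form_add_apply, nabla_apply g hX hα hY', nabla_apply g hX' hα hY', dirDeriv_add_left]
  simp only [leviCivita_add_left g hX hX' (hY' _), ContinuousAlternatingMap.map_update_add,
    Finset.sum_add_distrib]
  ring

theorem nabla_smul_left {f : M → ℝ} (hf : FunDiffAt d f x) (hX : FieldDiffAt X x)
    (hα : FormDiffAt α x) : nabla g (f • X) α x = f x • nabla g X α x := by
  refine nabla_eq g (hX.smul hf) hα fun Y hY => ?_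
  have hY' := fun i => (hY i).diffAt
  rw [form_smul_apply, nabla_apply g hX hα hY', dirDeriv_smul_left]
  simp only [leviCivita_smul_left g hf hX (hY' _), ContinuousAlternatingMap.map_update_smul,
    smul_eq_mul, ← Finset.mul_sum]
  ring

theorem nabla_tensorialAt (hα : FormDiffAt α x) :
    TensorialAt (𝓡 d) (EuclideanSpace ℝ (Fin d)) (fun X : VField d M => nabla g X α x) x where
  smul hf hX := nabla_smul_left g hf hX hα
  add hX hX' := nabla_add_left g hX hX' hα

theorem nabla_eq_of_eq (hX : FieldDiffAt X x) (hX' : FieldDiffAt X' x) (hα : FormDiffAt α x)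
    (h : X x = X' x) : nabla g X α x = nabla g X' α x :=
  (nabla_tensorialAt g hα).pointwise hX hX' h

theorem nabla_add (hX : FieldDiffAt X x) (hα : FormDiffAt α x) (hβ : FormDiffAt β x) :
    nabla g X (α + β) x = nabla g X α x + nabla g X β x := by
  refine nabla_eq g hX (hα.add hβ) fun Y hY => ?_
  have hY' := fun i => (hY i).diffAt
  rw [form_add_apply, nabla_apply g hX hα hY', nabla_apply g hX hβ hY']
  have h1 : (fun y => (α + β) y fun i => Y i y)
      = fun y => (α y fun i => Y i y) + β y fun i => Y i y := rfl
  have h2 (w) : (α + β) x w = α x w + β x w := rfl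
  rw [h1, dirDeriv_add (hα Y hY') (hβ Y hY')]
  simp only [h2, Finset.sum_add_distrib]
  ring

theorem nabla_smul {f : M → ℝ} (hf : FunDiffAt d f x) (hX : FieldDiffAt X x)
    (hα : FormDiffAt α x) :
    nabla g X (fun y => f y • α y) x = f x • nabla g X α x + dirDeriv X f x • α x := by
  refine nabla_eq g hX (hα.smul hf) fun Y hY => ?_
  have hY' := fun i => (hY i).diffAt
  rw [form_add_apply, form_smul_apply, form_smul_apply, nabla_apply g hX hα hY']
  have h1 : (fun y => (f y • α y) fun i => Y i y) = fun y => f y * α y fun i => Y i y := rfl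
  have h2 (w) : (f x • α x) w = f x * α x w := rfl
  rw [h1, dirDeriv_mul hf (hα Y hY')]
  simp only [h2, ← Finset.mul_sum]
  ring

theorem nabla_const_smul (c : ℝ) (hX : FieldDiffAt X x) (hα : FormDiffAt α x) :
    nabla g X (c • α) x = c • nabla g X α x := by
  have := nabla_smul g (f := fun _ => c) mdifferentiableAt_const hX hα
  rw [dirDeriv_const, zero_smul, add_zero] at this
  exact this

theorem nabla_zero (hX : FieldDiffAt X x) : nabla g X (0 : DForm d M p) x = 0 := by
  have h0 : FormDiffAt (0 : DForm d M p) x := fun Y _ => mdifferentiableAt_const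
  have := nabla_const_smul g 0 hX h0
  rwa [zero_smul, zero_smul] at this

theorem nabla_sum {ι : Type*} {s : Finset ι} {α : ι → DForm d M p} (hX : FieldDiffAt X x)
    (h : ∀ i ∈ s, FormDiffAt (α i) x) :
    nabla g X (fun y => ∑ i ∈ s, α i y) x = ∑ i ∈ s, nabla g X (α i) x := by
  classical
  induction s using Finset.induction_on with
  | empty => exact nabla_zero g hX
  | insert a s ha ih =>
    have h1 : ∀ i ∈ s, FormDiffAt (α i) x := fun i hi => h i (by simp [hi])
    simp only [Finset.sum_insert ha]
    rw [← ih h1]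
    exact nabla_add g hX (h a (by simp)) (FormDiffAt.sum h1)

end Linearity

end Nabla

section BilinearRules

variable {V : Type*} [AddCommGroup V] [Module ℝ V] [TopologicalSpace V] {p : ℕ}
  (g : V →L[ℝ] V →L[ℝ] ℝ)

theorem interior_add (v : V) (α β : V [⋀^Fin (p + 1)]→L[ℝ] ℝ) :
    interior v (α + β) = interior v α + interior v β := map_add (interiorLM p v) α β

theorem interior_sub (v : V) (α β : V [⋀^Fin (p + 1)]→L[ℝ] ℝ) :
    interior v (α - β) = interior v α - interior v β := map_sub (interiorLM p v) α β

theorem interior_smul (v : V) (c : ℝ) (α : V [⋀^Fin (p + 1)]→L[ℝ] ℝ) :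
    interior v (c • α) = c • interior v α := map_smul (interiorLM p v) c α

theorem interior_sum {ι : Type*} (s : Finset ι) (v : V) (α : ι → V [⋀^Fin (p + 1)]→L[ℝ] ℝ) :
    interior v (∑ i ∈ s, α i) = ∑ i ∈ s, interior v (α i) := map_sum (interiorLM p v) α s

theorem creator_add (v : V) (α β : V [⋀^Fin p]→L[ℝ] ℝ) :
    creator g v (α + β) = creator g v α + creator g v β := map_add (creatorLM g p v) α β

theorem creator_sub (v : V) (α β : V [⋀^Fin p]→L[ℝ] ℝ) :
    creator g v (α - β) = creator g v α - creator g v β := map_sub (creatorLM g p v) α β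

theorem creator_neg (v : V) (α : V [⋀^Fin p]→L[ℝ] ℝ) :
    creator g v (-α) = -creator g v α := map_neg (creatorLM g p v) α

theorem creator_sum {ι : Type*} (s : Finset ι) (v : V) (α : ι → V [⋀^Fin p]→L[ℝ] ℝ) :
    creator g v (∑ i ∈ s, α i) = ∑ i ∈ s, creator g v (α i) := map_sum (creatorLM g p v) α s

end BilinearRules

/-! ### Leibniz rules for interior and exterior multiplication. -/

section NablaLeibniz

variable {d : ℕ} {M : Type*} [TopologicalSpace M] [ChartedSpace (EuclideanSpace ℝ (Fin d)) M]
  [IsManifold (𝓡 d) ∞ M] (g : Metric d M) {p : ℕ} {X Z : VField d M} {x : M}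

theorem fin_cons_field (Z : VField d M) (Y : Fin p → VField d M) (y : M) :
    (fun i => (Fin.cons Z Y : Fin (p + 1) → VField d M) i y)
      = Fin.cons (Z y) fun i => Y i y := by
  funext i
  exact Fin.cases rfl (fun _ => rfl) i

/-- In the Leibniz formula for `α(Z, Y₁, …)` the summand of slot zero is the term with `∇_X Z`. -/
theorem nabla_interior {α : DForm d M (p + 1)} (hX : FieldDiffAt X x) (hZ : FieldDiffAt Z x)
    (hα : FormDiffAt α x) :
    nabla g X (fun y => interior (Z y) (α y)) x
      = interior (Z x) (nabla g X α x) + interior (leviCivita g X Z x) (α x) := by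
  refine nabla_eq g hX (hα.interior hZ) fun Y hY => ?_
  rw [form_add_apply, interior_apply, interior_apply, ← fin_cons_field,
    nabla_apply g hX hα (Fin.cases hZ fun i => (hY i).diffAt), Fin.sum_univ_succ]
  simp only [interior_apply, fin_cons_field, Fin.cons_zero, Fin.cons_succ, Fin.update_cons_zero,
    ← Fin.cons_update]
  ring

/-- Induction on the degree. Contraction with a field `V` turns `♭Z ∧ α` into `g(Z, V) α - ♭Z ∧ i_V
α`; metric compatibility differentiates the first term and the induction hypothesis the second, and
the `∇_X V` terms cancel. -/
theorem nabla_creator {α : DForm d M p} (hX : FieldDiffAt X x) (hZ : FieldDiffAt Z x)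
    (hα : FormDiffAt α x) :
    nabla g X (fun y => creator (g.val y) (Z y) (α y)) x
      = creator (g.val x) (Z x) (nabla g X α x)
        + creator (g.val x) (leviCivita g X Z x) (α x) := by
  induction p with
  | zero =>
    refine ext_interior fun v => ?_
    set V := ext x v with hV
    have hVd : FieldDiffAt V x := (smoothAt_ext v).diffAt
    have hVx : V x = v := ext_self v
    have h1 := nabla_interior g hX hVd (hα.creator g hZ)
    simp only [creator, interior_oneFormWedge_zero] at h1
    rw [nabla_smul g (g.diffAt hZ hVd) hX hα, leviCivita_metric g hX hZ hVd, hVx] at h1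
    rw [interior_add]
    simp only [creator, interior_oneFormWedge_zero]
    rw [← sub_eq_iff_eq_add] at h1
    rw [← h1]
    module
  | succ p ih =>
    refine ext_interior fun v => ?_
    set V := ext x v with hV
    have hVd : FieldDiffAt V x := (smoothAt_ext v).diffAt
    have hVx : V x = v := ext_self v
    have h1 := nabla_interior g hX hVd (hα.creator g hZ)
    have hI := nabla_interior g hX hVd hα
    have h2 := ih (hα.interior hVd)
    have h3 := nabla_add g hX (hα.smul (g.diffAt hZ hVd))
      (FormDiffAt.const_smul (-1) ((hα.interior hVd).creator g hZ))
    rw [nabla_smul g (g.diffAt hZ hVd) hX hα, nabla_const_smul g (-1) hX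
      ((hα.interior hVd).creator g hZ), h2, leviCivita_metric g hX hZ hVd, hVx, hI] at h3
    simp only [creator, interior_oneFormWedge] at h1
    have h4 : nabla g X ((fun y => g.val y (Z y) (V y) • α y)
        + (-1 : ℝ) • fun y => creator (g.val y) (Z y) (interior (V y) (α y))) x
      = nabla g X (fun y => g.val y (Z y) (V y) • α y
        - oneFormWedge (g.val y (Z y)) (interior (V y) (α y))) x := by
      refine nabla_congr g Filter.EventuallyEq.rfl (Filter.Eventually.of_forall fun y => ?_)
      change _ • α y + (-1 : ℝ) • creator (g.val y) (Z y) (interior (V y) (α y)) = _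
      rw [creator]
      module
    rw [← h4, h3, ← sub_eq_iff_eq_add, hVx] at h1
    rw [interior_add]
    simp only [creator, interior_oneFormWedge]
    rw [← h1]
    change _ • _ + (_ + _) • _ + (-1 : ℝ) • _ - (_ • _ - creator (g.val x) (Z x) _)
      = _ • _ - creator (g.val x) (Z x) _ + (_ • _ - creator (g.val x) (leviCivita g X Z x) _)
    rw [creator_add]
    module

end NablaLeibniz

/-! ### Coordinate fields and the exterior derivative in a chart. -/

section CoordinateFields

variable {d : ℕ} {M : Type*} [TopologicalSpace M] [ChartedSpace (EuclideanSpace ℝ (Fin d)) M]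
  [IsManifold (𝓡 d) ∞ M] {x : M}

theorem coordField_add (x : M) (u v : EuclideanSpace ℝ (Fin d)) :
    coordField x (u + v) = coordField x u + coordField x v := by
  funext y
  exact map_add _ u v

theorem coordField_smul (x : M) (c : ℝ) (v : EuclideanSpace ℝ (Fin d)) :
    coordField x (c • v) = (fun _ : M => c) • coordField x v := by
  funext y
  exact map_smul _ c v

theorem coordField_smoothAt (x : M) (v : EuclideanSpace ℝ (Fin d)) :
    SmoothAt (coordField x v) x := by
  have h : coordField x v
      = fun y => ∑ a, v a • coordField x (EuclideanSpace.basisFun (Fin d) ℝ a) y := by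
    funext y
    conv_lhs => rw [← (EuclideanSpace.basisFun (Fin d) ℝ).sum_repr v]
    simp only [coordField, map_sum, map_smul]
    rfl
  rw [h]
  exact SmoothAt.sum fun a _ => SmoothAt.smul (f := fun _ => v a) (FunSmoothAt.const _)
    ((coordField_isFrameAt x).smoothAt a)

theorem coordField_self (x : M) (v : EuclideanSpace ℝ (Fin d)) : coordField x v x = v := by
  rw [coordField, TangentBundle.symmL_trivializationAt (mem_chart_source _ x),
    mfderivWithin_range_extChartAt_symm]
  rfl

theorem coordField_symm {z : EuclideanSpace ℝ (Fin d)} (hz : z ∈ (extChartAt (𝓡 d) x).target)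
    (v : EuclideanSpace ℝ (Fin d)) :
    coordField x v ((extChartAt (𝓡 d) x).symm z)
      = mfderiv 𝓘(ℝ, EuclideanSpace ℝ (Fin d)) (𝓡 d) (extChartAt (𝓡 d) x).symm z v := by
  have h1 := (extChartAt (𝓡 d) x).map_target hz
  rw [extChartAt_source] at h1
  rw [coordField_eq h1]
  have h2 := (extChartAt (𝓡 d) x).right_inv hz
  exact congrArg (fun z' => (show EuclideanSpace ℝ (Fin d) from
    mfderiv 𝓘(ℝ, EuclideanSpace ℝ (Fin d)) (𝓡 d) (extChartAt (𝓡 d) x).symm z' v)) h2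

theorem lieBracketWithin_eq_zero_of_const {E : Type*} [NormedAddCommGroup E] [NormedSpace ℝ E]
    {V W : E → E} {s : Set E} {z u v : E} (hs : s = Set.univ) (hV : V =ᶠ[𝓝 z] fun _ => u)
    (hW : W =ᶠ[𝓝 z] fun _ => v) : VectorField.lieBracketWithin ℝ V W s z = 0 := by
  rw [hs, VectorField.lieBracketWithin_univ, hV.lieBracket_vectorField_eq hW]
  simp [VectorField.lieBracket]

/-- Pulled back to the chart, both fields are constant near the base point. -/
theorem bracket_coordField (u v : EuclideanSpace ℝ (Fin d)) :
    bracket (coordField x u) (coordField x v) x = 0 := by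
  have h (w : EuclideanSpace ℝ (Fin d)) :
      VectorField.mpullbackWithin 𝓘(ℝ, EuclideanSpace ℝ (Fin d)) (𝓡 d) (extChartAt (𝓡 d) x).symm
        (coordField x w) (Set.range (𝓡 d)) =ᶠ[𝓝 (extChartAt (𝓡 d) x x)] fun _ => w := by
    filter_upwards [(isOpen_extChartAt_target x).mem_nhds (mem_extChartAt_target x)] with z hz
    have hi := isInvertible_mfderivWithin_extChartAt_symm (I := 𝓡 d) hz
    rw [VectorField.mpullbackWithin_apply, coordField_symm hz,
      ← mfderivWithin_univ, ← ModelWithCorners.Boundaryless.range_eq_univ (I := 𝓡 d)]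
    exact hi.inverse_apply_self w
  rw [bracket, ← VectorField.mlieBracketWithin_univ, VectorField.mlieBracketWithin_apply]
  have h0 := lieBracketWithin_eq_zero_of_const
    (s := (extChartAt (𝓡 d) x).symm ⁻¹' Set.univ ∩ Set.range (𝓡 d)) (by simp) (h u) (h v)
  exact (congrArg (mfderiv (𝓡 d) 𝓘(ℝ, EuclideanSpace ℝ (Fin d)) (extChartAt (𝓡 d) x) x).inverse
    h0).trans (ContinuousLinearMap.map_zero _)

theorem inChart_apply {p : ℕ} (α : DForm d M p) {z : EuclideanSpace ℝ (Fin d)}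
    (hz : z ∈ (extChartAt (𝓡 d) x).target) (v : Fin p → EuclideanSpace ℝ (Fin d)) :
    α.inChart x z v = α ((extChartAt (𝓡 d) x).symm z)
      fun i => coordField x (v i) ((extChartAt (𝓡 d) x).symm z) := by
  simp only [coordField_symm hz]
  rfl

theorem inChart_apply_differentiableAt {p : ℕ} {α : DForm d M p} (hα : FormDiffAt α x)
    (v : Fin p → EuclideanSpace ℝ (Fin d)) :
    DifferentiableAt ℝ (fun z => α.inChart x z v) (extChartAt (𝓡 d) x x) := by
  rw [← mdifferentiableAt_iff_differentiableAt]
  have h1 := hα (fun i => coordField x (v i)) fun i => (coordField_smoothAt x _).diffAt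
  have h2 : MDifferentiableAt 𝓘(ℝ, EuclideanSpace ℝ (Fin d)) (𝓡 d) (extChartAt (𝓡 d) x).symm
      (extChartAt (𝓡 d) x x) := by
    have := mdifferentiableWithinAt_extChartAt_symm (I := 𝓡 d) (mem_extChartAt_target x)
    rwa [ModelWithCorners.Boundaryless.range_eq_univ, mdifferentiableWithinAt_univ] at this
  have h3 : (extChartAt (𝓡 d) x).symm (extChartAt (𝓡 d) x x) = x := extChartAt_to_inv x
  have h4 := MDifferentiableAt.comp_of_eq (extChartAt (𝓡 d) x x) h1 h2 h3
  refine h4.congr_of_eventuallyEq ?_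
  filter_upwards [(isOpen_extChartAt_target x).mem_nhds (mem_extChartAt_target x)] with z hz
  exact inChart_apply α hz v

/-- The chain rule; the derivative of the preferred chart at its base point is the identity of the
model space. -/
theorem fderiv_inChart_apply {p : ℕ} {α : DForm d M p} (hα : FormDiffAt α x)
    (u : EuclideanSpace ℝ (Fin d)) (v : Fin p → EuclideanSpace ℝ (Fin d)) :
    fderiv ℝ (fun z => α.inChart x z v) (extChartAt (𝓡 d) x x) u
      = dirDeriv (coordField x u) (fun y => α y fun i => coordField x (v i) y) x := by
  have h1 : (fun y => α y fun i => coordField x (v i) y)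
      =ᶠ[𝓝 x] (fun z => α.inChart x z v) ∘ extChartAt (𝓡 d) x := by
    filter_upwards [extChartAt_source_mem_nhds (I := 𝓡 d) x] with y hy
    rw [Function.comp_apply, inChart_apply α ((extChartAt (𝓡 d) x).map_source hy)]
    have := (extChartAt (𝓡 d) x).left_inv hy
    exact congrArg (fun y' => α y' fun i => coordField x (v i) y') this.symm
  have hd := (inChart_apply_differentiableAt hα v).mdifferentiableAt
  have hφ : MDifferentiableAt (𝓡 d) 𝓘(ℝ, EuclideanSpace ℝ (Fin d)) (extChartAt (𝓡 d) x) x :=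
    mdifferentiableAt_extChartAt (mem_chart_source _ x)
  rw [dirDeriv_congr h1, dirDeriv, coordField_self, mvfderiv, mfderiv_comp x hd hφ,
    mfderiv_extChartAt_self, mfderiv_eq_fderiv]
  rfl

/-- Evaluation on basis vectors embeds the forms linearly in a finite-dimensional coordinate space.
A linear left inverse is continuous, so componentwise differentiability suffices. -/
theorem inChart_differentiableAt {p : ℕ} {α : DForm d M p} (hα : FormDiffAt α x) :
    DifferentiableAt ℝ (α.inChart x) (extChartAt (𝓡 d) x x) := by
  set E := EuclideanSpace ℝ (Fin d)
  set b := (EuclideanSpace.basisFun (Fin d) ℝ).toBasis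
  let ev : (E [⋀^Fin p]→L[ℝ] ℝ) →ₗ[ℝ] ((Fin p → Fin d) → ℝ) :=
    { toFun := fun A s => A fun i => b (s i)
      map_add' := fun _ _ => rfl
      map_smul' := fun _ _ => rfl }
  have hev : LinearMap.ker ev = ⊥ := by
    rw [LinearMap.ker_eq_bot]
    intro A B hAB
    refine ContinuousAlternatingMap.ext fun w => ?_
    have : A.toMultilinearMap = B.toMultilinearMap :=
      Module.Basis.ext_multilinear (fun _ => b) fun s => congrFun hAB s
    exact congrArg (fun f : MultilinearMap ℝ (fun _ : Fin p => E) ℝ => f w) this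
  obtain ⟨L, hL⟩ := ev.exists_leftInverse_of_injective hev
  have h1 : α.inChart x = fun z => L.toContinuousLinearMap (ev (α.inChart x z)) := by
    funext z
    exact (LinearMap.congr_fun hL _).symm
  rw [h1]
  refine L.toContinuousLinearMap.differentiableAt.comp _ ?_
  rw [differentiableAt_pi]
  exact fun s => inChart_apply_differentiableAt hα _

theorem extD_apply {p : ℕ} {α : DForm d M p} (hα : FormDiffAt α x)
    (w : Fin (p + 1) → EuclideanSpace ℝ (Fin d)) :
    extD α x w = ∑ i : Fin (p + 1), (-1) ^ (i : ℕ) * dirDeriv (coordField x (w i))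
      (fun y => α y fun j => coordField x (i.removeNth w j) y) x := by
  have h1 : extD α x w = extDeriv (α.inChart x) (extChartAt (𝓡 d) x x) w := by
    change extDeriv (α.inChart x) (extChartAt (𝓡 d) x x)
      (fun i => mfderiv (𝓡 d) 𝓘(ℝ, EuclideanSpace ℝ (Fin d)) (extChartAt (𝓡 d) x) x (w i)) = _
    rw [mfderiv_extChartAt_self]
    rfl
  rw [h1, extDeriv_apply (inChart_differentiableAt hα)]
  refine Finset.sum_congr rfl fun i _ => ?_
  rw [fderiv_inChart_apply hα, zsmul_eq_mul]
  simp

/-- The coordinate field in the preferred chart at `x` that extends a tangent vector at `x`. -/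
def tangentField (x : M) (v : TangentSpace (𝓡 d) x) : VField d M := coordField x v

theorem tangentField_self (x : M) (v : TangentSpace (𝓡 d) x) : tangentField x v x = v :=
  coordField_self x v

theorem tangentField_add (x : M) (u v : TangentSpace (𝓡 d) x) :
    tangentField x (u + v) = tangentField x u + tangentField x v := coordField_add x u v

theorem tangentField_smul (x : M) (c : ℝ) (v : TangentSpace (𝓡 d) x) :
    tangentField x (c • v) = (fun _ : M => c) • tangentField x v := coordField_smul x c v

theorem tangentField_diffAt (x : M) (v : TangentSpace (𝓡 d) x) :
    FieldDiffAt (tangentField x v) x := (coordField_smoothAt x v).diffAt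

theorem bracket_tangentField (u v : TangentSpace (𝓡 d) x) :
    bracket (tangentField x u) (tangentField x v) x = 0 := bracket_coordField u v

theorem extD_apply_tangentField {p : ℕ} {α : DForm d M p} (hα : FormDiffAt α x)
    (w : Fin (p + 1) → TangentSpace (𝓡 d) x) :
    extD α x w = ∑ i : Fin (p + 1), (-1) ^ (i : ℕ) * dirDeriv (tangentField x (w i))
      (fun y => α y fun j => tangentField x (i.removeNth w j) y) x := extD_apply hα w

end CoordinateFields

/-! ### The exterior derivative through the connection. -/

section ExteriorDerivative

/-- The sum alternatises twice an expression symmetric in two of its arguments. With `Γ` the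
Christoffel symbols, this is how vanishing torsion removes the connection from `d`. -/
theorem sum_update_symmetric_eq_zero {V : Type*} [AddCommGroup V] [Module ℝ V] {p : ℕ}
    (α : V [⋀^Fin p]→ₗ[ℝ] ℝ) (Γ : V →ₗ[ℝ] V →ₗ[ℝ] V) (hΓ : ∀ u v, Γ u v = Γ v u)
    (w : Fin (p + 1) → V) :
    ∑ i : Fin (p + 1), (-1) ^ (i : ℕ) * ∑ k,
      α (Function.update (i.removeNth w) k (Γ (w i) (i.removeNth w k))) = 0 := by
  cases p with
  | zero => simp
  | succ p =>
    let f : V →ₗ[ℝ] V →ₗ[ℝ] V [⋀^Fin p]→ₗ[ℝ] ℝ := Γ.compr₂ α.curryLeft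
    have h := congrArg (fun A : V [⋀^Fin (p + 2)]→ₗ[ℝ] ℝ => A w)
      (AlternatingMap.alternatizeUncurryFin_alternatizeUncurryFinLM_comp_of_symmetric
        (f := f) fun u v => by simp only [f, LinearMap.compr₂_apply, hΓ u v])
    simp only [AlternatingMap.alternatizeUncurryFin_apply, LinearMap.comp_apply,
      AlternatingMap.alternatizeUncurryFinLM_apply, AlternatingMap.zero_apply] at h
    rw [← h]
    refine Finset.sum_congr rfl fun i _ => ?_
    rw [zsmul_eq_mul]
    push_cast
    congr 1
    refine Finset.sum_congr rfl fun k _ => ?_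
    -- Moving slot `k` to the front costs `(-1)^k`, the sign of the inner alternatisation.
    rw [← Fin.insertNth_removeNth, AlternatingMap.map_insertNth]
    simp [f]

variable {d : ℕ} {M : Type*} [TopologicalSpace M] [ChartedSpace (EuclideanSpace ℝ (Fin d)) M]
  [IsManifold (𝓡 d) ∞ M] (g : Metric d M) {p : ℕ} {x : M}

theorem tensorialAt_expansion {A : Type*} [AddCommGroup A] [Module ℝ A]
    {Φ : VField d M → A} (hΦ : TensorialAt (𝓡 d) (EuclideanSpace ℝ (Fin d)) Φ x)
    {e : Fin d → VField d M} (he : IsFrameAt e x) {X : VField d M} (hX : FieldDiffAt X x) :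
    Φ X = ∑ a, g.val x (raised g e a x) (X x) • Φ (e a) := by
  set c : Fin d → M → ℝ := fun a _ => g.val x (raised g e a x) (X x)
  have hc : ∀ a, FunDiffAt d (c a) x := fun a => mdifferentiableAt_const
  have h1 : ∀ a ∈ Finset.univ, FieldDiffAt (c a • e a) x :=
    fun a _ => (he.smoothAt a).diffAt.smul (hc a)
  have h2 := hΦ.pointwise hX (FieldDiffAt.sum h1)
    (((he.isDualFrame g).sum_eq (X x)).symm)
  rw [h2, hΦ.sum _ h1]
  exact Finset.sum_congr rfl fun a _ => hΦ.smul (hc a) (he.smoothAt a).diffAt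

theorem nabla_expansion {e : Fin d → VField d M} (he : IsFrameAt e x) {X : VField d M}
    (hX : FieldDiffAt X x) {α : DForm d M p} (hα : FormDiffAt α x) :
    nabla g X α x = ∑ a, g.val x (raised g e a x) (X x) • nabla g (e a) α x :=
  tensorialAt_expansion g (nabla_tensorialAt g hα) he hX

/-- The exterior derivative through the Levi-Civita connection, `dα = ∑ a, ♭(e^a) ∧ ∇_{e_a} α`. -/
theorem extD_eq {e : Fin d → VField d M} (he : IsFrameAt e x) {α : DForm d M p}
    (hα : FormDiffAt α x) :
    extD α x = ∑ a, creator (g.val x) (raised g e a x) (nabla g (e a) α x) := by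
  have hW := tangentField_diffAt (d := d) x
  refine ContinuousAlternatingMap.ext fun w => ?_
  -- Summing `g(e^a, w_i) ∇_{e_a}` over `a` gives the derivative in the direction `w_i`, so the
  -- frame disappears.
  have h1 : (∑ a, creator (g.val x) (raised g e a x) (nabla g (e a) α x)) w
      = ∑ i : Fin (p + 1), (-1) ^ (i : ℕ) *
        nabla g (tangentField x (w i)) α x (i.removeNth w) := by
    rw [ContinuousAlternatingMap.sum_apply]
    simp only [creator, oneFormWedge_apply]
    rw [Finset.sum_comm]
    refine Finset.sum_congr rfl fun i _ => ?_
    rw [nabla_expansion g he (hW (w i)) hα, ContinuousAlternatingMap.sum_apply, Finset.mul_sum]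
    simp only [tangentField_self]
    rfl
  -- The Christoffel symbols at `x` in the preferred chart. Coordinate fields commute at `x`, so
  -- vanishing torsion makes `Γ` symmetric.
  let Γ : TangentSpace (𝓡 d) x →ₗ[ℝ] TangentSpace (𝓡 d) x →ₗ[ℝ] TangentSpace (𝓡 d) x :=
    LinearMap.mk₂ ℝ (fun u v => leviCivita g (tangentField x u) (tangentField x v) x)
      (fun u u' v => by
        rw [← leviCivita_add_left g (hW u) (hW u') (hW v), ← tangentField_add])
      (fun c u v => by
        rw [← leviCivita_smul_left g (f := fun _ => c) mdifferentiableAt_const (hW u) (hW v),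
          ← tangentField_smul])
      (fun u v v' => by
        rw [← leviCivita_add_right g (hW u) (hW v) (hW v'), ← tangentField_add])
      (fun c u v => by
        have := leviCivita_smul_right g (f := fun _ => c) mdifferentiableAt_const (hW u) (hW v)
        rw [dirDeriv_const, zero_smul, add_zero] at this
        rw [← this, ← tangentField_smul])
  have hΓ : ∀ u v, Γ u v = Γ v u := fun u v => by
    have := leviCivita_torsion g (hW u) (hW v)
    rw [bracket_tangentField] at this
    exact sub_eq_zero.1 this
  have h2 := sum_update_symmetric_eq_zero (α x).toAlternatingMap Γ hΓ w
  rw [h1, extD_apply_tangentField hα, ← sub_eq_zero, ← Finset.sum_sub_distrib, ← h2]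
  refine Finset.sum_congr rfl fun i _ => ?_
  have h3 := nabla_apply g (hW (w i)) hα (Y := fun j => tangentField x (i.removeNth w j))
    fun j => hW _
  simp only [tangentField_self] at h3
  have h4 : nabla g (tangentField x (w i)) α x (i.removeNth w) = _ := h3
  rw [h4, ← mul_sub, sub_sub_cancel]
  rfl

-- The formula of `extD_eq` is needed at all points near `x`. A frame on an open set is used,
-- because fields smooth at `x` need not be smooth at nearby points.
include g in
theorem extD_smoothAt {α : DForm d M p} (hα : FormSmoothAt α x) : FormSmoothAt (extD α) x := by
  obtain ⟨e, s, hes, hx⟩ := exists_isFrameOn (d := d) x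
  have he := hes.isFrameAt hx
  have h1 : FormSmoothAt
      (fun y => ∑ a, creator (g.val y) (raised g e a y) (nabla g (e a) α y)) x :=
    FormSmoothAt.sum fun a _ => FormSmoothAt.creator g (he.raised_smoothAt g a)
      (nabla_smoothAt g (he.smoothAt a) hα)
  refine h1.congr ?_
  filter_upwards [hes.1.mem_nhds hx, hα.eventually g] with y hy hαy
  exact extD_eq g (hes.isFrameAt hy) hαy

end ExteriorDerivative

/-! ### The volume form is smooth and parallel. -/

section VolumeField

/-- The number `s` is the Gram determinant of an oriented orthonormal basis. The identity expresses
a product of two values of the volume form through the metric alone, up to sign. -/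
theorem exists_volume_pairing {V : Type*} [AddCommGroup V] [Module ℝ V] [TopologicalSpace V]
    {d : ℕ} {g : V →L[ℝ] V →L[ℝ] ℝ} [FiniteDimensional ℝ V] (hs : ∀ v w, g v w = g w v)
    (hn : ∀ v, (∀ w, g v w = 0) → v = 0) {o : Orientation ℝ V (Fin d)}
    (ho : ∃ b : Module.Basis (Fin d) ℝ V, b.orientation = o) {vol : V [⋀^Fin d]→L[ℝ] ℝ}
    (hvol : vol.toAlternatingMap = volumeForm g o) :
    ∃ s : ℝ, |s| = 1 ∧ ∀ v w : Fin d → V,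
      decomposable (fun i => g (v i)) w = s * (vol v * vol w) := by
  obtain ⟨f, hf, hfo⟩ := exists_orthonormal_oriented hs hn ho
  have h1 : ∀ v, vol v = f.det v := fun v => by
    rw [← volumeForm_eq_det f hf hfo, ← hvol]; rfl
  refine ⟨(gramMatrix g f).det, hf.abs_det, fun v w => ?_⟩
  rw [decomposable_apply, det_pairing f, h1, h1]
  ring

variable {d : ℕ} {M : Type*} [TopologicalSpace M] [ChartedSpace (EuclideanSpace ℝ (Fin d)) M]

/-- The standard basis of a tangent space. -/
def tangentBasis (x : M) : Module.Basis (Fin d) ℝ (TangentSpace (𝓡 d) x) :=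
  (EuclideanSpace.basisFun (Fin d) ℝ).toBasis

variable [IsManifold (𝓡 d) ∞ M] (g : Metric d M) (o : ManifoldOrientation d M) {x : M}

theorem ManifoldOrientation.exists_basis (x : M) :
    ∃ b : Module.Basis (Fin d) ℝ (TangentSpace (𝓡 d) x), b.orientation = o.orient x := by
  obtain ⟨_, -, h⟩ := o.locallyConsistent x
  obtain ⟨b, -, hb⟩ := h.self_of_nhds
  exact ⟨b, hb⟩

theorem exists_volumeField (x : M) : ∃ vol : (TangentSpace (𝓡 d) x) [⋀^Fin d]→L[ℝ] ℝ,
    vol.toAlternatingMap = volumeForm (g.val x) (o.orient x) ∧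
      ∀ b : Module.Basis (Fin d) ℝ (TangentSpace (𝓡 d) x), vol b ≠ 0 :=
  exists_volume (g.symm x) (g.nondegenerate x) (o.exists_basis x)

/-- The volume form of an oriented pseudo-Riemannian manifold. -/
def volumeField : DForm d M d := fun x => Classical.choose (exists_volumeField g o x)

theorem volumeField_toAlternatingMap (x : M) :
    (volumeField g o x).toAlternatingMap = volumeForm (g.val x) (o.orient x) :=
  (Classical.choose_spec (exists_volumeField g o x)).1

theorem volumeField_basis_ne_zero (x : M)
    (b : Module.Basis (Fin d) ℝ (TangentSpace (𝓡 d) x)) : volumeField g o x b ≠ 0 :=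
  (Classical.choose_spec (exists_volumeField g o x)).2 b

/-- Near each point there is an oriented frame, on which the volume form is `√|det g_{ab}|`. -/
theorem exists_isFrameAt_volumeField (x : M) : ∃ e : Fin d → VField d M, IsFrameAt e x ∧
    ∀ᶠ y in 𝓝 x, volumeField g o y (fun a => e a y)
      = Real.sqrt |(gramMatrix (g.val y) fun a => e a y).det| := by
  obtain ⟨e, he, hb⟩ := o.locallyConsistent x
  refine ⟨e, ⟨he, ?_⟩, ?_⟩
  · filter_upwards [hb] with y hy
    obtain ⟨b, hbe, -⟩ := hy
    rw [show (fun a => e a y) = b from funext fun a => (hbe a).symm]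
    exact b.linearIndependent
  · filter_upwards [hb] with y hy
    obtain ⟨b, hbe, hbo⟩ := hy
    rw [show (fun a => e a y) = b from funext fun a => (hbe a).symm]
    have h1 := volumeForm_apply (g.symm y) (g.nondegenerate y) b b
    have h2 : volumeField g o y b = volumeForm (g.val y) b.orientation b := by
      rw [hbo, ← volumeField_toAlternatingMap g o y]; rfl
    rw [h2, h1, b.det_self]
    simp

theorem FunSmoothAt.abs {f : M → ℝ} (h : FunSmoothAt d f x) (h0 : f x ≠ 0) :
    FunSmoothAt d (fun y => |f y|) x :=
  (contDiffAt_abs h0).contMDiffAt.comp x h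

theorem IsFrameAt.exists_basis {e : Fin d → VField d M} (he : IsFrameAt e x) :
    ∃ b : Module.Basis (Fin d) ℝ (TangentSpace (𝓡 d) x), ⇑b = fun a => e a x :=
  ⟨basisOfLinearIndependentOfCardEqFinrank' (fun a => e a x)
    he.linearIndependent.self_of_nhds (by rw [finrank_tangentSpace]; simp), by simp⟩

theorem IsFrameAt.volumeField_ne_zero {e : Fin d → VField d M} (he : IsFrameAt e x) :
    volumeField g o x (fun a => e a x) ≠ 0 := by
  obtain ⟨b, hb⟩ := he.exists_basis
  rw [← hb]
  exact volumeField_basis_ne_zero g o x b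

/-- The sign `s` is that of the Gram determinant of a frame, a continuous function without zeros
near `x`, so it is locally constant. -/
theorem eventually_volume_pairing (x : M) : ∃ s : ℝ, |s| = 1 ∧ ∀ᶠ y in 𝓝 x,
    ∀ v w : Fin d → TangentSpace (𝓡 d) y, decomposable (fun i => g.val y (v i)) w
      = s * (volumeField g o y v * volumeField g o y w) := by
  obtain ⟨e, he⟩ := exists_isFrameAt (d := d) x
  set D : M → ℝ := fun y => (gramMatrix (g.val y) fun a => e a y).det with hD
  have hDs : FunSmoothAt d D x :=
    FunSmoothAt.det fun i j => g.smoothAt (he.smoothAt i) (he.smoothAt j)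
  have hpair : ∀ y, ∃ s : ℝ, |s| = 1 ∧ ∀ v w : Fin d → TangentSpace (𝓡 d) y,
      decomposable (fun i => g.val y (v i)) w
        = s * (volumeField g o y v * volumeField g o y w) := fun y =>
    exists_volume_pairing (g.symm y) (g.nondegenerate y) (o.exists_basis y)
      (volumeField_toAlternatingMap g o y)
  choose s hs1 hs using hpair
  have hDe : ∀ y, D y = s y * (volumeField g o y (fun a => e a y)) ^ 2 := fun y => by
    rw [pow_two, ← hs y, decomposable_apply, hD]
    rfl
  refine ⟨s x, hs1 x, ?_⟩
  have hsgn : ∀ᶠ y in 𝓝 x, 0 < D x * D y := by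
    have hc : ContinuousAt (fun y => D x * D y) x := continuousAt_const.mul hDs.continuousAt
    exact hc.eventually (lt_mem_nhds (mul_self_pos.2 (he.det_gramMatrix_ne_zero g)))
  filter_upwards [hsgn] with y hy v w
  have : s y = s x := by
    rw [hDe x, hDe y] at hy
    have h1 : 0 < s x * s y := by
      by_contra hc
      push Not at hc
      have : (s x * s y) * ((volumeField g o x fun a => e a x) *
        (volumeField g o y fun a => e a y)) ^ 2 ≤ 0 := mul_nonpos_of_nonpos_of_nonneg hc (sq_nonneg _)
      nlinarith
    rcases eq_or_eq_neg_of_abs_eq (hs1 x) with h2 | h2 <;>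
      rcases eq_or_eq_neg_of_abs_eq (hs1 y) with h3 | h3 <;> rw [h2, h3] at h1 ⊢ <;> linarith
  rw [hs y, this]

/-- On an oriented frame the value is `√|det g_{ab}|`, smooth since the determinant does not vanish.
On other fields, the pairing identity gives `vol(Y) = det g(e_i, Y_j) / (s vol(e))`. -/
theorem volumeField_smoothAt (x : M) : FormSmoothAt (volumeField g o) x := by
  obtain ⟨e, he, hv⟩ := exists_isFrameAt_volumeField g o x
  obtain ⟨s, hs1, hs⟩ := eventually_volume_pairing g o x
  have hs0 : s ≠ 0 := fun h => by simp [h] at hs1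
  have hφ : FunSmoothAt d (fun y => volumeField g o y fun a => e a y) x := by
    have h0 := he.det_gramMatrix_ne_zero g
    have h1 : FunSmoothAt d (fun y => (gramMatrix (g.val y) fun a => e a y).det) x :=
      FunSmoothAt.det fun i j => g.smoothAt (he.smoothAt i) (he.smoothAt j)
    exact ContMDiffAt.congr_of_eventuallyEq ((h1.abs h0).sqrt (abs_ne_zero.2 h0)) hv
  have h0 := he.volumeField_ne_zero g o
  intro Y hY
  have h1 : FunSmoothAt d (fun y => s⁻¹ * ((volumeField g o y fun a => e a y)⁻¹ *
      (Matrix.of fun i j => g.val y (e i y) (Y j y)).det)) x :=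
    (FunSmoothAt.const _).mul ((hφ.inv h0).mul
      (FunSmoothAt.det fun i j => g.smoothAt (he.smoothAt i) (hY j)))
  refine ContMDiffAt.congr_of_eventuallyEq h1 ?_
  filter_upwards [hs, hφ.continuousAt.eventually_ne h0] with y h2 h3
  have := h2 (fun i => e i y) fun i => Y i y
  rw [decomposable_apply] at this
  rw [this]
  field_simp

theorem decomposable_diffAt {p : ℕ} {Y : Fin p → VField d M} (hY : ∀ i, FieldDiffAt (Y i) x) :
    FormDiffAt (fun y => decomposable fun i => g.val y (Y i y)) x := by
  induction p with
  | zero => exact fun Y _ => mdifferentiableAt_const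
  | succ p ih => exact FormDiffAt.creator g (hY 0) (ih (Y := Fin.tail Y) fun i => hY _)

theorem nabla_decomposable {p : ℕ} {X : VField d M} (hX : FieldDiffAt X x)
    {Y : Fin p → VField d M} (hY : ∀ i, FieldDiffAt (Y i) x) :
    nabla g X (fun y => decomposable fun i => g.val y (Y i y)) x
      = ∑ i, decomposable fun j => g.val x
          (Function.update (fun k => Y k x) i (leviCivita g X (Y i) x) j) := by
  induction p with
  | zero =>
    refine nabla_eq g hX (decomposable_diffAt g hY) fun Z _ => ?_
    have : (fun y => (decomposable fun i => g.val y (Y i y)) fun i => Z i y) = fun _ => 1 := by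
      funext y; simp [decomposable]
    rw [this, dirDeriv_const]
    simp
  | succ p ih =>
    have h1 := nabla_creator g hX (hY 0) (decomposable_diffAt g (Y := Fin.tail Y) fun i => hY _)
    rw [ih (Y := Fin.tail Y) fun i => hY _] at h1
    refine h1.trans ?_
    rw [Fin.sum_univ_succ, creator_sum]
    refine (add_comm _ _).trans (congrArg₂ _ ?_ ?_)
    · rw [creator, decomposable, Function.update_self]
      congr 2
    refine Finset.sum_congr rfl fun i _ => ?_
    rw [decomposable, creator]
    have h2 : (Fin.tail fun j => g.val x
        (Function.update (fun k => Y k x) i.succ (leviCivita g X (Y i.succ) x) j))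
      = fun j => g.val x (Function.update (fun k => Fin.tail Y k x) i
          (leviCivita g X (Fin.tail Y i) x) j) := by
      funext j
      by_cases h : j = i
      · subst h; simp [Fin.tail]
      · simp [Fin.tail, h]
    rw [h2, Function.update_of_ne (Fin.succ_ne_zero i).symm]

/-- With `φ = vol(e)` and `S = ∑ vol(…, ∇_X e_i, …)`, differentiate `(♭e_1 ∧ ⋯ ∧ ♭e_d)(e) = s φ²`.
The derivatives of the flat vectors and of the arguments each contribute `s φ S`, so `2 s φ (X(φ) -
S) = 0`; and `X(φ) - S` is the value of `∇_X vol` on the frame. -/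
theorem nabla_volumeField {X : VField d M} (hX : FieldDiffAt X x) :
    nabla g X (volumeField g o) x = 0 := by
  obtain ⟨e, he⟩ := exists_isFrameAt (d := d) x
  obtain ⟨s, hs1, hs⟩ := eventually_volume_pairing g o x
  have hs0 : s ≠ 0 := fun h => by simp [h] at hs1
  have hed := fun a => (he.smoothAt a).diffAt
  have hv := (volumeField_smoothAt g o x).diffAt g
  have hx := hs.self_of_nhds
  set φ : M → ℝ := fun y => volumeField g o y fun a => e a y with hφ
  have hφd : FunDiffAt d φ x := hv e hed
  set S := ∑ i, volumeField g o x
    (Function.update (fun j => e j x) i (leviCivita g X (e i) x)) with hS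
  have h1 := nabla_apply g hX (decomposable_diffAt g hed) hed
  rw [nabla_decomposable g hX hed, ContinuousAlternatingMap.sum_apply] at h1
  simp only [hx] at h1
  have h2 : dirDeriv X (fun y => (decomposable fun i => g.val y (e i y)) fun i => e i y) x
      = s * (2 * φ x * dirDeriv X φ x) := by
    rw [dirDeriv_congr (f' := fun y => s * (φ y * φ y)) (hs.mono fun y hy => hy _ _),
      dirDeriv_const_mul _ (hφd.mul hφd), dirDeriv_mul hφd hφd]
    ring
  rw [h2, ← Finset.mul_sum, ← Finset.mul_sum, ← Finset.sum_mul, ← Finset.mul_sum] at h1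
  change s * (S * φ x) = s * (2 * φ x * dirDeriv X φ x) - s * (φ x * S) at h1
  have h3 : nabla g X (volumeField g o) x (fun a => e a x) = 0 := by
    rw [nabla_apply g hX hv hed]
    change dirDeriv X φ x - S = 0
    have hφ0 : φ x ≠ 0 := he.volumeField_ne_zero g o
    have : (2 * s * φ x) * (dirDeriv X φ x - S) = 0 := by linear_combination -h1
    exact (mul_eq_zero.1 this).resolve_left (by simp [hs0, hφ0])
  obtain ⟨b, hb⟩ := he.exists_basis
  have h4 := (nabla g X (volumeField g o) x).toAlternatingMap.eq_smul_basis_det b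
  have h5 : (nabla g X (volumeField g o) x).toAlternatingMap b = 0 := by rw [hb]; exact h3
  rw [h5, zero_smul] at h4
  exact ContinuousAlternatingMap.ext fun w => congrArg (fun A => A w) h4

end VolumeField

/-! ### The Hodge operator commutes with the covariant derivative. -/

section HodgeField

variable {d : ℕ} {M : Type*} [TopologicalSpace M] [ChartedSpace (EuclideanSpace ℝ (Fin d)) M]
  [IsManifold (𝓡 d) ∞ M] (g : Metric d M) (o : ManifoldOrientation d M) {x : M}

/-- The Hodge dual of a field of forms. -/
def hodgeField {p q : ℕ} (h : p + q = d) (α : DForm d M p) : DForm d M q := fun y =>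
  hodgeStar h (g.val y) (o.orient y) (α y)

theorem hodgeField_zero_form (h : 0 + d = d) (α : DForm d M 0) (y : M) :
    hodgeField g o h α y = α y ![] • volumeField g o y :=
  hodgeStar_zero_form (tangentBasis y) (g.symm y) (g.nondegenerate y) _ h _
    (volumeField_toAlternatingMap g o y)

/-- Induction on the degree: `⋆f = f ω` on functions, and `hodgeStar_succ` builds higher degrees
from contractions of lower ones. -/
theorem hodgeField_smoothAt {p q : ℕ} (h : p + q = d) {α : DForm d M p} (hα : FormSmoothAt α x) :
    FormSmoothAt (hodgeField g o h α) x := by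
  induction p generalizing q with
  | zero =>
    obtain rfl : q = d := by omega
    refine FormSmoothAt.congr (FormSmoothAt.smul (f := fun y => α y ![]) ?_
      (volumeField_smoothAt g o x)) (Filter.Eventually.of_forall (hodgeField_zero_form g o h α))
    have := hα (fun i => i.elim0) fun i => i.elim0
    refine ContMDiffAt.congr_of_eventuallyEq this (Filter.Eventually.of_forall fun y => ?_)
    exact congrArg (α y) (Subsingleton.elim _ _)
  | succ p ih =>
    obtain ⟨e, he⟩ := exists_isFrameAt (d := d) x
    have h1 : FormSmoothAt (fun y => ((-1 : ℝ) ^ p * ((p + 1 : ℕ) : ℝ)⁻¹) • ∑ a, interior (e a y)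
        (hodgeField g o (p := p) (q := q + 1) (by omega)
          (fun z => interior (raised g e a z) (α z)) y)) x :=
      FormSmoothAt.smul (FunSmoothAt.const _) (FormSmoothAt.sum fun a _ =>
        FormSmoothAt.interior (he.smoothAt a) (ih _ (hα.interior (he.raised_smoothAt g a))))
    refine h1.congr ?_
    filter_upwards [he.eventually g] with y hy
    exact hodgeStar_succ (tangentBasis y) (g.symm y) (g.nondegenerate y) _ h (by omega) hy.2 (α y)

/-- On functions this is `∇ω = 0`. In higher degree the difference is tested by multiplication with
`♭v`, which by `creator_hodgeStar` replaces `α` by `i_V α`; the terms with `∇_X V` agree on both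
sides. -/
theorem nabla_hodgeField {p q : ℕ} (h : p + q = d) {X : VField d M} (hX : FieldDiffAt X x)
    {α : DForm d M p} (hα : FormSmoothAt α x) :
    nabla g X (hodgeField g o h α) x = hodgeField g o h (nabla g X α) x := by
  induction p generalizing q with
  | zero =>
    obtain rfl : q = d := by omega
    have hv := (volumeField_smoothAt g o x).diffAt g
    have h0 : nabla g X α x ![] = dirDeriv X (fun y => α y ![]) x := by
      have := nabla_apply g hX (hα.diffAt g) (Y := fun i => i.elim0) fun i => i.elim0
      rw [Finset.univ_eq_empty, Finset.sum_empty, sub_zero] at this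
      refine (congrArg _ (Subsingleton.elim _ _)).trans (this.trans (dirDeriv_congr
        (Filter.Eventually.of_forall fun y => ?_)))
      exact congrArg (α y) (Subsingleton.elim _ _)
    have hf : FunDiffAt q (fun y => α y ![]) x := by
      have := (hα.diffAt g) (fun i => i.elim0) fun i => i.elim0
      refine this.congr_of_eventuallyEq (Filter.Eventually.of_forall fun y => ?_)
      exact congrArg (α y) (Subsingleton.elim _ _)
    refine (nabla_congr g (X' := X) Filter.EventuallyEq.rfl
      (Filter.Eventually.of_forall (hodgeField_zero_form g o h α))).trans ?_
    rw [hodgeField_zero_form, nabla_smul g hf hX hv, nabla_volumeField g o hX, smul_zero, zero_add, h0]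
  | succ p ih =>
    obtain ⟨e, he⟩ := exists_isFrameAt (d := d) x
    rw [← sub_eq_zero]
    -- The dual has degree `q < d`, because `α` has positive degree.
    refine creator_injective (he.isDualFrame g) (by omega) fun v => ?_
    set V := ext x v with hV
    have hVs : SmoothAt V x := smoothAt_ext v
    have hVx : V x = v := ext_self v
    have h' : p + (q + 1) = d := by omega
    have hcr : ∀ y (u : TangentSpace (𝓡 d) y) (β : (TangentSpace (𝓡 d) y) [⋀^Fin (p + 1)]→L[ℝ] ℝ),
        creator (g.val y) u (hodgeStar h (g.val y) (o.orient y) β)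
          = (-1 : ℝ) ^ p • hodgeStar h' (g.val y) (o.orient y) (interior u β) := fun y u β =>
      creator_hodgeStar (tangentBasis y) (g.symm y) (g.nondegenerate y) _ h h' u β
    have h1 := nabla_creator g hX hVs.diffAt ((hodgeField_smoothAt g o h hα).diffAt g)
    have h2 : nabla g X (fun y => creator (g.val y) (V y) (hodgeField g o h α y)) x
        = (-1 : ℝ) ^ p • nabla g X (hodgeField g o h' fun y => interior (V y) (α y)) x := by
      rw [← nabla_const_smul g _ hX ((hodgeField_smoothAt g o h' (hα.interior hVs)).diffAt g)]
      exact nabla_congr g Filter.EventuallyEq.rfl (Filter.Eventually.of_forall fun y => hcr y _ _)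
    rw [h2, ih h' (hα.interior hVs)] at h1
    simp only [hodgeField] at h1 ⊢
    rw [nabla_interior g hX hVs.diffAt (hα.diffAt g), hcr,
      hodgeStar_add (tangentBasis x) (g.symm x) (g.nondegenerate x), hVx] at h1
    rw [creator_sub, hcr, sub_eq_zero]
    have h3 := eq_sub_of_add_eq h1.symm
    refine h3.trans ?_
    module

end HodgeField

/-! ### The codifferential through the connection. -/

section Codifferential

variable {d : ℕ} {M : Type*} [TopologicalSpace M] [ChartedSpace (EuclideanSpace ℝ (Fin d)) M]
  [IsManifold (𝓡 d) ∞ M] (g : Metric d M) (o : ManifoldOrientation d M) {x : M} {p : ℕ}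

/-- The codifferential is `δα = -∑ a, i_{e^a} ∇_{e_a} α`. -/
theorem codiff_eq {e : Fin d → VField d M} (he : IsFrameAt e x) {α : DForm d M (p + 1)}
    (hα : FormSmoothAt α x) :
    codiff g o α x = -∑ a, interior (raised g e a x) (nabla g (e a) α x) := by
  rw [codiff]
  split_ifs with h
  · have h1 : p + 1 + (d - (p + 1)) = d := by omega
    have h2 : p + (d - (p + 1) + 1) = d := by omega
    set b := tangentBasis (d := d) x
    have hinj := hodgeStar_injective (p := p) (q := d - (p + 1) + 1) b (g.symm x)
      (g.nondegenerate x) (o.exists_basis x) h2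
    have hβ := hα.const_smul ((-1 : ℝ) ^ (p + 1))
    have key : extD (hodgeField g o h1 ((-1 : ℝ) ^ (p + 1) • α)) x
        = hodgeStar h2 (g.val x) (o.orient x)
          (-∑ a, interior (raised g e a x) (nabla g (e a) α x)) := by
      rw [extD_eq g he ((hodgeField_smoothAt g o h1 hβ).diffAt g)]
      have hadd : ∀ A B, hodgeStar h2 (g.val x) (o.orient x) (A + B)
          = hodgeStar h2 (g.val x) (o.orient x) A + hodgeStar h2 (g.val x) (o.orient x) B :=
        hodgeStar_add b (g.symm x) (g.nondegenerate x) (o.orient x) h2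
      let S : _ →+ _ := AddMonoidHom.mk' (hodgeStar h2 (g.val x) (o.orient x)) hadd
      change _ = S _
      rw [map_neg, map_sum, ← Finset.sum_neg_distrib]
      refine Finset.sum_congr rfl fun a _ => ?_
      have hea := (he.smoothAt a).diffAt
      rw [nabla_hodgeField g o h1 hea hβ, hodgeField, nabla_const_smul g _ hea (hα.diffAt g),
        creator_hodgeStar b (g.symm x) (g.nondegenerate x) _ h1 h2, interior_smul,
        hodgeStar_smul b (g.symm x) (g.nondegenerate x), smul_smul, ← pow_add]
      change _ = -hodgeStar h2 (g.val x) (o.orient x) _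
      -- The factor `(-1)^p` comes from moving `j` past `⋆`, the factor `(-1)^{p+1}` from the
      -- definition of the codifferential.
      have : (-1 : ℝ) ^ (p + (p + 1)) = -1 := by
        rw [show p + (p + 1) = 2 * p + 1 by ring, pow_succ, pow_mul]; simp
      rw [this]
      module
    have h3 := Function.leftInverse_invFun hinj
      (-∑ a, interior (raised g e a x) (nabla g (e a) α x))
    rw [← key] at h3
    exact h3
  -- Above the dimension every form vanishes, so the formula agrees with the default value zero.
  · have h0 : ∀ a, nabla g (e a) α x = 0 := fun a =>
      form_eq_zero_of_lt (he.isDualFrame g) (by omega) _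
    simp only [h0, ← interiorLM_apply, map_zero, Finset.sum_const_zero, neg_zero]

theorem codiff_smoothAt {α : DForm d M (p + 1)} (hα : ∀ y, FormSmoothAt α y) :
    FormSmoothAt (codiff g o α) x := by
  obtain ⟨e, s, hes, hx⟩ := exists_isFrameOn (d := d) x
  have he := hes.isFrameAt hx
  have h1 : FormSmoothAt ((-1 : ℝ) •
      fun y => ∑ a, interior (raised g e a y) (nabla g (e a) α y)) x :=
    FormSmoothAt.const_smul _ (FormSmoothAt.sum fun a _ => FormSmoothAt.interior
      (he.raised_smoothAt g a) (nabla_smoothAt g (he.smoothAt a) (hα x)))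
  refine h1.congr ?_
  filter_upwards [hes.1.mem_nhds hx] with y hy
  rw [codiff_eq g o (hes.isFrameAt hy) (hα y)]
  exact (neg_one_smul ℝ _).symm

end Codifferential

/-! ### Tensoriality for smooth fields, and the parallel identity tensor. -/

section Tensoriality

variable {d : ℕ} {M : Type*} [TopologicalSpace M] [ChartedSpace (EuclideanSpace ℝ (Fin d)) M]
  [IsManifold (𝓡 d) ∞ M] (g : Metric d M) {x : M}

/-- A local operation on vector fields that is linear over functions at `x`, for fields and
functions that are smooth at `x`. -/
structure SmoothTensorialAt {A : Type*} [AddCommGroup A] [Module ℝ A] (Φ : VField d M → A) (x : M) :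
    Prop where
  smul {f : M → ℝ} {X : VField d M} : FunSmoothAt d f x → SmoothAt X x → Φ (f • X) = f x • Φ X
  add {X Y : VField d M} : SmoothAt X x → SmoothAt Y x → Φ (X + Y) = Φ X + Φ Y
  congr {X Y : VField d M} : X =ᶠ[𝓝 x] Y → Φ X = Φ Y

namespace SmoothTensorialAt

variable {A : Type*} [AddCommGroup A] [Module ℝ A] {Φ Ψ : VField d M → A}

theorem sum (hΦ : SmoothTensorialAt Φ x) {ι : Type*} {s : Finset ι} {X : ι → VField d M}
    (h : ∀ i ∈ s, SmoothAt (X i) x) : Φ (fun y => ∑ i ∈ s, X i y) = ∑ i ∈ s, Φ (X i) := by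
  classical
  induction s using Finset.induction_on with
  | empty =>
    have h0 : SmoothAt (fun _ => 0 : VField d M) x :=
      SmoothAt.sum (s := (∅ : Finset ι)) (Z := X) (by simp)
    have := hΦ.smul (FunSmoothAt.const 0) h0
    rw [zero_smul] at this
    simp only [Finset.sum_empty]
    rw [← this]
    refine hΦ.congr (Filter.Eventually.of_forall fun y => ?_)
    exact (zero_smul ℝ (0 : TangentSpace (𝓡 d) y)).symm
  | insert a s ha ih =>
    have h1 : ∀ i ∈ s, SmoothAt (X i) x := fun i hi => h i (by simp [hi])
    simp only [Finset.sum_insert ha]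
    rw [← ih h1]
    exact hΦ.add (h a (by simp)) (SmoothAt.sum h1)

/-- The frame expansion of `X` holds only near `x`; this is where locality of `Φ` enters. -/
theorem expansion (hΦ : SmoothTensorialAt Φ x) {e : Fin d → VField d M} (he : IsFrameAt e x)
    {X : VField d M} (hX : SmoothAt X x) :
    Φ X = ∑ a, g.val x (raised g e a x) (X x) • Φ (e a) := by
  have hc : ∀ a, FunSmoothAt d (fun y => g.val y (raised g e a y) (X y)) x :=
    fun a => g.smoothAt (he.raised_smoothAt g a) hX
  rw [hΦ.congr (he.expansion g X)]
  refine (hΦ.sum (X := fun a => (fun y => g.val y (raised g e a y) (X y)) • e a)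
    fun a _ => SmoothAt.smul (hc a) (he.smoothAt a)).trans ?_
  exact Finset.sum_congr rfl fun a _ => hΦ.smul (hc a) (he.smoothAt a)

include g in
theorem eq_of_eq (hΦ : SmoothTensorialAt Φ x) {X Y : VField d M} (hX : SmoothAt X x)
    (hY : SmoothAt Y x) (h : X x = Y x) : Φ X = Φ Y := by
  obtain ⟨e, he⟩ := exists_isFrameAt (d := d) x
  rw [hΦ.expansion g he hX, hΦ.expansion g he hY, h]

end SmoothTensorialAt

theorem leviCivita_eventuallyEq {X X' Y Y' : VField d M} (hX : X =ᶠ[𝓝 x] X')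
    (hY : Y =ᶠ[𝓝 x] Y') : leviCivita g X Y =ᶠ[𝓝 x] leviCivita g X' Y' := by
  filter_upwards [hX.eventuallyEq_nhds, hY.eventuallyEq_nhds] with y h1 h2
  exact leviCivita_congr g h1 h2

variable {p : ℕ} {α : DForm d M p}

/-- The covariant derivative at `x` as a linear map in the direction. -/
def nablaLM (hα : FormDiffAt α x) :
    TangentSpace (𝓡 d) x →ₗ[ℝ] (TangentSpace (𝓡 d) x) [⋀^Fin p]→L[ℝ] ℝ where
  toFun v := nabla g (ext x v) α x
  map_add' u v := by
    rw [← nabla_add_left g (smoothAt_ext u).diffAt (smoothAt_ext v).diffAt hα]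
    exact nabla_eq_of_eq g (smoothAt_ext _).diffAt
      ((smoothAt_ext u).diffAt.add (smoothAt_ext v).diffAt) hα (by simp)
  map_smul' c v := by
    have hc : FunDiffAt d (fun _ : M => c) x := mdifferentiableAt_const
    rw [RingHom.id_apply, ← nabla_smul_left g hc (smoothAt_ext v).diffAt hα]
    exact nabla_eq_of_eq g (smoothAt_ext _).diffAt
      ((smoothAt_ext v).diffAt.smul hc) hα (by simp)

theorem nablaLM_apply (hα : FormDiffAt α x) {X : VField d M} (hX : FieldDiffAt X x) :
    nablaLM g hα (X x) = nabla g X α x :=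
  nabla_eq_of_eq g (smoothAt_ext _).diffAt hX hα (ext_self _)

/-- The tensor `∑ b, e^b ⊗ e_b` is parallel. -/
theorem sum_leviCivita_dual {A : Type*} [AddCommGroup A] [Module ℝ A]
    (B : TangentSpace (𝓡 d) x →ₗ[ℝ] TangentSpace (𝓡 d) x →ₗ[ℝ] A)
    {e : Fin d → VField d M} (he : IsFrameAt e x) {X : VField d M} (hX : FieldDiffAt X x) :
    ∑ b, B (leviCivita g X (raised g e b) x) (e b x)
      = -∑ b, B (raised g e b x) (leviCivita g X (e b) x) := by
  have hd := he.isDualFrame g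
  have hE := fun b => (he.raised_smoothAt g b).diffAt
  have hed := fun b => (he.smoothAt b).diffAt
  -- Differentiate the constant function `g(e^b, e_c)`.
  have h1 : ∀ b c, g.val x (e c x) (leviCivita g X (raised g e b) x)
      = -g.val x (raised g e b x) (leviCivita g X (e c) x) := fun b c => by
    have h := leviCivita_metric g hX (hE b) (hed c)
    have h0 : (fun y => g.val y (raised g e b y) (e c y)) =ᶠ[𝓝 x]
        fun _ => if b = c then 1 else 0 := by
      filter_upwards [he.eventually g] with y hy
      exact hy.2.apply_eq b c
    rw [dirDeriv_congr h0, dirDeriv_const] at h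
    rw [g.symm x (e c x)]
    linarith
  have h2 : ∀ b, B (leviCivita g X (raised g e b) x) (e b x)
      = ∑ c, -(g.val x (raised g e b x) (leviCivita g X (e c) x) •
        B (raised g e c x) (e b x)) := fun b => by
    conv_lhs => rw [← hd.sum_eq' (g.symm x) (g.nondegenerate x)
      (leviCivita g X (raised g e b) x)]
    simp only [h1, map_sum, map_smul, map_neg, LinearMap.sum_apply, LinearMap.smul_apply,
      LinearMap.neg_apply, neg_smul]
  have h3 : ∀ c, B (raised g e c x) (leviCivita g X (e c) x)
      = ∑ b, g.val x (raised g e b x) (leviCivita g X (e c) x) •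
        B (raised g e c x) (e b x) := fun c => by
    conv_lhs => rw [← hd.sum_eq (leviCivita g X (e c) x)]
    simp only [map_sum, map_smul]
  simp only [h2, h3, Finset.sum_neg_distrib]
  rw [Finset.sum_comm]

end Tensoriality

/-! ### The second covariant derivative and the Laplace–Beltrami operator. -/

section LaplaceBeltrami

variable {d : ℕ} {M : Type*} [TopologicalSpace M] [ChartedSpace (EuclideanSpace ℝ (Fin d)) M]
  [IsManifold (𝓡 d) ∞ M] (g : Metric d M) {x : M} {p : ℕ} {α : DForm d M p}

theorem secondNabla_apply (X Y : VField d M) :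
    secondNabla g X Y α x = nabla g X (nabla g Y α) x - nabla g (leviCivita g X Y) α x := rfl

theorem secondNabla_tensorialAt_left {Y : VField d M} (hY : SmoothAt Y x)
    (hα : FormSmoothAt α x) : SmoothTensorialAt (fun X => secondNabla g X Y α x) x where
  smul {f X} hf hX := by
    have hα' := hα.diffAt g
    simp only [secondNabla_apply]
    rw [nabla_smul_left g hf.diffAt hX.diffAt ((nabla_smoothAt g hY hα).diffAt g),
      ← nablaLM_apply g hα' (leviCivita_smoothAt g (SmoothAt.smul hf hX) hY).diffAt,
      ← nablaLM_apply g hα' (leviCivita_smoothAt g hX hY).diffAt,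
      leviCivita_smul_left g hf.diffAt hX.diffAt hY.diffAt, map_smul]
    module
  add {X X'} hX hX' := by
    have hα' := hα.diffAt g
    simp only [secondNabla_apply]
    rw [nabla_add_left g hX.diffAt hX'.diffAt ((nabla_smoothAt g hY hα).diffAt g),
      ← nablaLM_apply g hα' (leviCivita_smoothAt g (hX.add hX') hY).diffAt,
      ← nablaLM_apply g hα' (leviCivita_smoothAt g hX hY).diffAt,
      ← nablaLM_apply g hα' (leviCivita_smoothAt g hX' hY).diffAt,
      leviCivita_add_left g hX.diffAt hX'.diffAt hY.diffAt, map_add]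
    module
  congr {X X'} h := by
    simp only [secondNabla_apply]
    rw [nabla_congr g h (Filter.Eventually.of_forall fun _ => rfl),
      nabla_congr g (leviCivita_eventuallyEq g (Y' := Y) h Filter.EventuallyEq.rfl)
        (Filter.Eventually.of_forall fun _ => rfl)]

/-- The term `X(f) ∇_Y α` from the product rule is cancelled by the one in `∇_{∇_X (fY)} α`; this is
the purpose of the correction term in `secondNabla`. -/
theorem secondNabla_tensorialAt_right {X : VField d M} (hX : SmoothAt X x)
    (hα : FormSmoothAt α x) : SmoothTensorialAt (fun Y => secondNabla g X Y α x) x where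
  smul {f Y} hf hY := by
    have hα' := hα.diffAt g
    have h1 : nabla g X (nabla g (f • Y) α) x
        = nabla g X (fun y => f y • nabla g Y α y) x := by
      refine nabla_congr g Filter.EventuallyEq.rfl ?_
      filter_upwards [hf.eventually, hY.eventually, hα.eventually g] with y h1 h2 h3
      exact nabla_smul_left g h1 h2 h3
    simp only [secondNabla_apply]
    rw [h1, nabla_smul g hf.diffAt hX.diffAt ((nabla_smoothAt g hY hα).diffAt g),
      ← nablaLM_apply g hα' (leviCivita_smoothAt g hX (SmoothAt.smul hf hY)).diffAt,
      ← nablaLM_apply g hα' (leviCivita_smoothAt g hX hY).diffAt,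
      leviCivita_smul_right g hf.diffAt hX.diffAt hY.diffAt, map_add, map_smul, map_smul,
      nablaLM_apply g hα' hY.diffAt]
    module
  add {Y Y'} hY hY' := by
    have hα' := hα.diffAt g
    have h1 : nabla g X (nabla g (Y + Y') α) x
        = nabla g X (nabla g Y α + nabla g Y' α) x := by
      refine nabla_congr g Filter.EventuallyEq.rfl ?_
      filter_upwards [hY.eventually, hY'.eventually, hα.eventually g] with y h1 h2 h3
      exact nabla_add_left g h1 h2 h3
    simp only [secondNabla_apply]
    rw [h1, nabla_add g hX.diffAt ((nabla_smoothAt g hY hα).diffAt g)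
        ((nabla_smoothAt g hY' hα).diffAt g),
      ← nablaLM_apply g hα' (leviCivita_smoothAt g hX (hY.add hY')).diffAt,
      ← nablaLM_apply g hα' (leviCivita_smoothAt g hX hY).diffAt,
      ← nablaLM_apply g hα' (leviCivita_smoothAt g hX hY').diffAt,
      leviCivita_add_right g hX.diffAt hY.diffAt hY'.diffAt, map_add]
    module
  congr {Y Y'} h := by
    simp only [secondNabla_apply]
    have h1 : ∀ᶠ y in 𝓝 x, nabla g Y α y = nabla g Y' α y := by
      filter_upwards [h.eventuallyEq_nhds] with y hy
      exact nabla_congr g hy (Filter.Eventually.of_forall fun _ => rfl)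
    rw [nabla_congr g (X' := X) Filter.EventuallyEq.rfl h1,
      nabla_congr g (leviCivita_eventuallyEq g (X' := X) Filter.EventuallyEq.rfl h)
        (Filter.Eventually.of_forall fun _ => rfl)]

theorem IsFrameAt.raised_raised {e : Fin d → VField d M} (he : IsFrameAt e x) (a b : Fin d) :
    g.val x (raised g e a x) (raised g e b x) = invGram g e x b a := by
  have hd := he.isDualFrame g
  conv_lhs => rw [raised.eq_def g e b]
  simp [map_sum, hd.apply_eq]

/-- `∇²` is bilinear over functions at `x`, so its components transform covariantly, and the inverse
Gram matrix transforms in the opposite way. -/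
theorem laplaceBeltrami_frame_independent (hα : FormSmoothAt α x) {e e' : Fin d → VField d M}
    (he : IsFrameAt e x) (he' : IsFrameAt e' x) :
    ∑ i, ∑ j, invGram g e' x i j • secondNabla g (e' i) (e' j) α x
      = ∑ a, ∑ b, invGram g e x a b • secondNabla g (e a) (e b) α x := by
  have hd := he.isDualFrame g
  have hd' := he'.isDualFrame g
  have h1 : ∀ i j, secondNabla g (e' i) (e' j) α x
      = ∑ a, ∑ b, (g.val x (raised g e a x) (e' i x) * g.val x (raised g e b x) (e' j x)) •
        secondNabla g (e a) (e b) α x := fun i j => by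
    rw [(secondNabla_tensorialAt_left g (he'.smoothAt j) hα).expansion g he (he'.smoothAt i)]
    refine Finset.sum_congr rfl fun a _ => ?_
    rw [(secondNabla_tensorialAt_right g (he.smoothAt a) hα).expansion g he (he'.smoothAt j),
      Finset.smul_sum]
    exact Finset.sum_congr rfl fun b _ => smul_smul _ _ _
  have h2 : ∀ a b, ∑ i, ∑ j, invGram g e' x i j *
      (g.val x (raised g e a x) (e' i x) * g.val x (raised g e b x) (e' j x))
        = invGram g e x a b := fun a b => by
    have h3 : ∀ i, ∑ j, invGram g e' x i j *
        (g.val x (raised g e a x) (e' i x) * g.val x (raised g e b x) (e' j x))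
        = g.val x (e' i x) (raised g e a x) * g.val x (raised g e b x) (raised g e' i x) :=
      fun i => by
        conv_rhs => rw [raised.eq_def g e' i]
        simp only [map_sum, map_smul, smul_eq_mul, Finset.mul_sum]
        rw [g.symm x (e' i x)]
        exact Finset.sum_congr rfl fun j _ => by ring
    simp only [h3]
    rw [← he.raised_raised g b a]
    conv_rhs => rw [← hd'.sum_eq' (g.symm x) (g.nondegenerate x) (raised g e a x)]
    simp only [map_sum, map_smul, smul_eq_mul]
  simp only [← h2, h1, Finset.smul_sum, Finset.sum_smul, smul_smul]
  calc _ = ∑ i, ∑ a, ∑ j, ∑ b, (invGram g e' x i j * (g.val x (raised g e a x) (e' i x) *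
        g.val x (raised g e b x) (e' j x))) • secondNabla g (e a) (e b) α x :=
      Finset.sum_congr rfl fun i _ => Finset.sum_comm
    _ = ∑ a, ∑ i, ∑ b, ∑ j, (invGram g e' x i j * (g.val x (raised g e a x) (e' i x) *
        g.val x (raised g e b x) (e' j x))) • secondNabla g (e a) (e b) α x := by
      rw [Finset.sum_comm]
      exact Finset.sum_congr rfl fun a _ => Finset.sum_congr rfl fun i _ => Finset.sum_comm
    _ = _ := Finset.sum_congr rfl fun a _ => Finset.sum_comm

theorem laplaceBeltrami_eq (hα : FormSmoothAt α x) {e : Fin d → VField d M} {s : Set M}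
    (hes : IsFrameOn e s) (hx : x ∈ s) :
    laplaceBeltrami g α x = ∑ a, ∑ b, invGram g e x a b • secondNabla g (e a) (e b) α x := by
  have hex : ∃ η : (TangentSpace (𝓡 d) x) [⋀^Fin p]→L[ℝ] ℝ,
      ∀ (e : Fin d → VField d M) (s : Set M), IsFrameOn e s → x ∈ s →
        η = ∑ a, ∑ b, invGram g e x a b • secondNabla g (e a) (e b) α x :=
    ⟨_, fun e' s' hes' hx' =>
      laplaceBeltrami_frame_independent g hα (hes'.isFrameAt hx') (hes.isFrameAt hx)⟩
  exact Classical.epsilon_spec hex e s hes hx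

end LaplaceBeltrami

/-! ### The Weitzenböck identity. -/

section Weitzenboeck

variable {d : ℕ} {M : Type*} [TopologicalSpace M] [ChartedSpace (EuclideanSpace ℝ (Fin d)) M]
  [IsManifold (𝓡 d) ∞ M] (g : Metric d M) (o : ManifoldOrientation d M) {x : M} {p : ℕ}
  {e : Fin d → VField d M} {s : Set M}

/-- The parallel tensor `∑ e^b ⊗ e_b`, fed into the bilinear map `(v, w) ↦ i_v ∇_w α`. -/
theorem sum_interior_leviCivita_raised (he : IsFrameAt e x) {α : DForm d M (p + 1)}
    (hα : FormDiffAt α x) {X : VField d M} (hX : SmoothAt X x) :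
    ∑ b, interior (leviCivita g X (raised g e b) x) (nabla g (e b) α x)
      = -∑ b, interior (raised g e b x) (nabla g (leviCivita g X (e b)) α x) := by
  have h := sum_leviCivita_dual g ((interiorLM p).compl₂ (nablaLM g hα)) he hX.diffAt
  simp only [LinearMap.compl₂_apply, interiorLM_apply] at h
  simpa only [nablaLM_apply g hα (he.smoothAt _).diffAt,
    nablaLM_apply g hα (leviCivita_smoothAt g hX (he.smoothAt _)).diffAt] using h

theorem sum_creator_leviCivita_raised (he : IsFrameAt e x) {α : DForm d M p}
    (hα : FormDiffAt α x) {X : VField d M} (hX : SmoothAt X x) :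
    ∑ b, creator (g.val x) (leviCivita g X (raised g e b) x) (nabla g (e b) α x)
      = -∑ b, creator (g.val x) (raised g e b x) (nabla g (leviCivita g X (e b)) α x) := by
  have h := sum_leviCivita_dual g ((creatorLM (g.val x) p).compl₂ (nablaLM g hα)) he hX.diffAt
  simp only [LinearMap.compl₂_apply, creatorLM_apply] at h
  simpa only [nablaLM_apply g hα (he.smoothAt _).diffAt,
    nablaLM_apply g hα (leviCivita_smoothAt g hX (he.smoothAt _)).diffAt] using h

/-- Differentiating `-i^b ∇_{e_b} α`, the terms with `∇_X e^b` become the missing `-∇_{∇_X e_b} α`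
of the second covariant derivative. -/
theorem nabla_codiff (hes : IsFrameOn e s) (hx : x ∈ s) {α : DForm d M (p + 1)}
    (hα : ∀ y, FormSmoothAt α y) {X : VField d M} (hX : SmoothAt X x) :
    nabla g X (codiff g o α) x = -∑ b, interior (raised g e b x) (secondNabla g X (e b) α x) := by
  have he := hes.isFrameAt hx
  have hn := fun b => (nabla_smoothAt g (he.smoothAt b) (hα x)).diffAt g
  have hE := fun b => (he.raised_smoothAt g b).diffAt
  have hi := fun b => FormDiffAt.interior (hE b) (hn b)
  have h1 : nabla g X (codiff g o α) x = nabla g X ((-1 : ℝ) •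
      fun y => ∑ b, interior (raised g e b y) (nabla g (e b) α y)) x := by
    refine nabla_congr g Filter.EventuallyEq.rfl ?_
    filter_upwards [hes.1.mem_nhds hx] with y hy
    rw [codiff_eq g o (hes.isFrameAt hy) (hα y)]
    exact (neg_one_smul ℝ _).symm
  rw [h1, nabla_const_smul g _ hX.diffAt (FormDiffAt.sum fun b _ => hi b),
    nabla_sum g hX.diffAt fun b _ => hi b]
  simp only [nabla_interior g hX.diffAt (hE _) (hn _), secondNabla_apply, interior_sub,
    Finset.sum_add_distrib, Finset.sum_sub_distrib]
  rw [sum_interior_leviCivita_raised g he ((hα x).diffAt g) hX]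
  module

theorem nabla_extD (hes : IsFrameOn e s) (hx : x ∈ s) {α : DForm d M p}
    (hα : FormSmoothAt α x) {X : VField d M} (hX : SmoothAt X x) :
    nabla g X (extD α) x
      = ∑ b, creator (g.val x) (raised g e b x) (secondNabla g X (e b) α x) := by
  have he := hes.isFrameAt hx
  have hn := fun b => (nabla_smoothAt g (he.smoothAt b) hα).diffAt g
  have hE := fun b => (he.raised_smoothAt g b).diffAt
  have hi := fun b => FormDiffAt.creator g (hE b) (hn b)
  have h1 : nabla g X (extD α) x = nabla g X
      (fun y => ∑ b, creator (g.val y) (raised g e b y) (nabla g (e b) α y)) x := by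
    refine nabla_congr g Filter.EventuallyEq.rfl ?_
    filter_upwards [hes.1.mem_nhds hx, hα.eventually g] with y hy hαy
    exact extD_eq g (hes.isFrameAt hy) hαy
  rw [h1, nabla_sum g hX.diffAt fun b _ => hi b]
  simp only [nabla_creator g hX.diffAt (hE _) (hn _), secondNabla_apply, creator_sub,
    Finset.sum_add_distrib, Finset.sum_sub_distrib]
  rw [sum_creator_leviCivita_raised g he (hα.diffAt g) hX]
  module

/-- The correction terms differ by `∇_{∇_X Y - ∇_Y X} = ∇_{[X, Y]}`, by vanishing torsion. -/
theorem secondNabla_sub_secondNabla {X Y : VField d M} (hX : SmoothAt X x) (hY : SmoothAt Y x)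
    {α : DForm d M p} (hα : FormDiffAt α x) :
    secondNabla g X Y α x - secondNabla g Y X α x = curvature g X Y α x := by
  have h1 := congrArg (nablaLM g hα) (leviCivita_torsion g hX.diffAt hY.diffAt)
  rw [map_sub, nablaLM_apply g hα (leviCivita_smoothAt g hX hY).diffAt,
    nablaLM_apply g hα (leviCivita_smoothAt g hY hX).diffAt,
    nablaLM_apply g hα (bracket_smoothAt hX hY).diffAt] at h1
  change _ = nabla g X (nabla g Y α) x - nabla g Y (nabla g X α) x - nabla g (bracket X Y) α x
  rw [← h1, secondNabla_apply, secondNabla_apply]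
  module

theorem laplaceBeltrami_eq_sum_raised (hes : IsFrameOn e s) (hx : x ∈ s) {α : DForm d M p}
    (hα : FormSmoothAt α x) :
    laplaceBeltrami g α x = ∑ a, ∑ b, g.val x (raised g e b x) (raised g e a x) •
      secondNabla g (e a) (e b) α x := by
  rw [laplaceBeltrami_eq g hα hes hx]
  simp only [(hes.isFrameAt hx).raised_raised]

theorem weitzenboeck (hes : IsFrameOn e s) (hx : x ∈ s) {α : DForm d M p}
    (hα : ∀ y, FormSmoothAt α y) :
    laplaceDeRham g o α x = laplaceBeltrami g α x + curvatureTerm g e α x := by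
  have he := hes.isFrameAt hx
  have hdα : ∀ y, FormSmoothAt (extD α) y := fun y => extD_smoothAt g (hα y)
  have h1 : codiff g o (extD α) x = -∑ a, ∑ b, interior (raised g e a x)
      (creator (g.val x) (raised g e b x) (secondNabla g (e a) (e b) α x)) := by
    rw [codiff_eq g o he (hdα x)]
    congr 1
    refine Finset.sum_congr rfl fun a _ => ?_
    rw [nabla_extD g hes hx (hα x) (he.smoothAt a), interior_sum]
  rw [laplaceBeltrami_eq_sum_raised g hes hx (hα x)]
  cases p with
  | zero =>
    change -codiff g o (extD α) x = _
    -- On functions there is no contraction, and `i_v (θ f) = θ(v) f` already produces the trace.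
    have h2 : curvatureTerm g e α x = 0 := by
      simp only [curvatureTerm, creatorInterior, Finset.sum_const_zero]
    rw [h1, h2, neg_neg, add_zero]
    simp only [creator, interior_oneFormWedge_zero]
  | succ p =>
    change -(extD (codiff g o α) x + codiff g o (extD α) x) = _
    have h3 : extD (codiff g o α) x = -∑ a, ∑ b, creator (g.val x) (raised g e a x)
        (interior (raised g e b x) (secondNabla g (e a) (e b) α x)) := by
      rw [extD_eq g he ((codiff_smoothAt g o hα).diffAt g), ← Finset.sum_neg_distrib]
      refine Finset.sum_congr rfl fun a _ => ?_
      rw [nabla_codiff g o hes hx hα (he.smoothAt a), creator_neg, creator_sum]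
    -- The curvature is the antisymmetric part of `∇²`; in the second summand the names `a` and `b`
    -- are exchanged to match the terms of `δd`.
    have h4 : curvatureTerm g e α x = ∑ a, ∑ b, creator (g.val x) (raised g e a x)
        (interior (raised g e b x) (secondNabla g (e a) (e b) α x))
        - ∑ a, ∑ b, creator (g.val x) (raised g e b x)
          (interior (raised g e a x) (secondNabla g (e a) (e b) α x)) := by
      rw [Finset.sum_comm (f := fun a b => creator (g.val x) (raised g e b x)
        (interior (raised g e a x) (secondNabla g (e a) (e b) α x))), ← Finset.sum_sub_distrib]
      refine Finset.sum_congr rfl fun a _ => ?_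
      rw [← Finset.sum_sub_distrib]
      refine Finset.sum_congr rfl fun b _ => ?_
      rw [← secondNabla_sub_secondNabla g (he.smoothAt a) (he.smoothAt b) ((hα x).diffAt g),
        creatorInterior, interior_sub, creator_sub]
    rw [h1, h3, h4]
    -- The anticommutation rule splits `i^a j^b` into `g^{ab}`, which gives `Δ`, and `-j^b i^a`,
    -- which is the second half of the curvature term.
    simp only [creator, interior_oneFormWedge, Finset.sum_sub_distrib]
    module

end Weitzenboeck

/-! ### Curvature of vector fields and the Ricci tensor. -/

section CurvatureTensor

variable {d : ℕ} {M : Type*} [TopologicalSpace M] [ChartedSpace (EuclideanSpace ℝ (Fin d)) M]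
  [IsManifold (𝓡 d) ∞ M] (g : Metric d M) {x : M}

/-- The covariant derivative at `x` as a linear map in the direction. -/
def leviCivitaLM {Y : VField d M} (hY : FieldDiffAt Y x) :
    TangentSpace (𝓡 d) x →ₗ[ℝ] TangentSpace (𝓡 d) x where
  toFun v := leviCivita g (ext x v) Y x
  map_add' u v := by
    rw [← leviCivita_add_left g (smoothAt_ext u).diffAt (smoothAt_ext v).diffAt hY]
    exact leviCivita_eq_of_eq g (smoothAt_ext _).diffAt
      ((smoothAt_ext u).diffAt.add (smoothAt_ext v).diffAt) hY (by simp)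
  map_smul' c v := by
    have hc : FunDiffAt d (fun _ : M => c) x := mdifferentiableAt_const
    rw [RingHom.id_apply, ← leviCivita_smul_left g hc (smoothAt_ext v).diffAt hY]
    exact leviCivita_eq_of_eq g (smoothAt_ext _).diffAt
      ((smoothAt_ext v).diffAt.smul hc) hY (by simp)

theorem leviCivitaLM_apply {X Y : VField d M} (hY : FieldDiffAt Y x) (hX : FieldDiffAt X x) :
    leviCivitaLM g hY (X x) = leviCivita g X Y x :=
  leviCivita_eq_of_eq g (smoothAt_ext _).diffAt hX hY (ext_self _)

theorem curvatureField_apply (X Y Z : VField d M) :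
    curvatureField g X Y Z x = leviCivita g X (leviCivita g Y Z) x
      - leviCivita g Y (leviCivita g X Z) x - leviCivita g (bracket X Y) Z x := rfl

theorem curvatureField_swap {X Y Z : VField d M} (hX : SmoothAt X x) (hY : SmoothAt Y x)
    (hZ : SmoothAt Z x) : curvatureField g X Y Z x = -curvatureField g Y X Z x := by
  rw [curvatureField_apply, curvatureField_apply,
    ← leviCivitaLM_apply g hZ.diffAt (bracket_smoothAt hX hY).diffAt,
    ← leviCivitaLM_apply g hZ.diffAt (bracket_smoothAt hY hX).diffAt, bracket_swap, map_neg]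
  abel

theorem curvatureField_congr {X X' Y Y' Z Z' : VField d M} (hX : X =ᶠ[𝓝 x] X')
    (hY : Y =ᶠ[𝓝 x] Y') (hZ : Z =ᶠ[𝓝 x] Z') :
    curvatureField g X Y Z x = curvatureField g X' Y' Z' x := by
  have hb : bracket X Y =ᶠ[𝓝 x] bracket X' Y' := hX.mlieBracket_vectorField hY
  rw [curvatureField_apply, curvatureField_apply,
    leviCivita_congr g hX (leviCivita_eventuallyEq g hY hZ),
    leviCivita_congr g hY (leviCivita_eventuallyEq g hX hZ), leviCivita_congr g hb hZ]

/-- Differentiating `f ∇_X Z` along `Y` yields `-Y(f) ∇_X Z`, which the `-Y(f) X` in `[fX, Y]`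
compensates. -/
theorem curvatureField_tensorialAt_first {Y Z : VField d M} (hY : SmoothAt Y x)
    (hZ : SmoothAt Z x) : SmoothTensorialAt (fun X => curvatureField g X Y Z x) x where
  smul {f X} hf hX := by
    have h1 : leviCivita g (f • X) Z =ᶠ[𝓝 x] f • leviCivita g X Z := by
      filter_upwards [hf.eventually, hX.eventually, hZ.eventually] with y h1 h2 h3
      exact leviCivita_smul_left g h1 h2 h3
    simp only [curvatureField_apply]
    rw [leviCivita_smul_left g hf.diffAt hX.diffAt (leviCivita_smoothAt g hY hZ).diffAt,
      leviCivita_congr g (X' := Y) Filter.EventuallyEq.rfl h1,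
      leviCivita_smul_right g hf.diffAt hY.diffAt (leviCivita_smoothAt g hX hZ).diffAt,
      ← leviCivitaLM_apply g hZ.diffAt (bracket_smoothAt (SmoothAt.smul hf hX) hY).diffAt,
      bracket_smul_left hf.diffAt hX.diffAt, map_add, map_smul, map_smul,
      leviCivitaLM_apply g hZ.diffAt hX.diffAt,
      leviCivitaLM_apply g hZ.diffAt (bracket_smoothAt hX hY).diffAt]
    module
  add {X X'} hX hX' := by
    have h1 : leviCivita g (X + X') Z =ᶠ[𝓝 x] leviCivita g X Z + leviCivita g X' Z := by
      filter_upwards [hX.eventually, hX'.eventually, hZ.eventually] with y h1 h2 h3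
      exact leviCivita_add_left g h1 h2 h3
    simp only [curvatureField_apply]
    rw [leviCivita_add_left g hX.diffAt hX'.diffAt (leviCivita_smoothAt g hY hZ).diffAt,
      leviCivita_congr g (X' := Y) Filter.EventuallyEq.rfl h1,
      leviCivita_add_right g hY.diffAt (leviCivita_smoothAt g hX hZ).diffAt
        (leviCivita_smoothAt g hX' hZ).diffAt,
      ← leviCivitaLM_apply g hZ.diffAt (bracket_smoothAt (hX.add hX') hY).diffAt,
      bracket_add_left hX.diffAt hX'.diffAt, map_add,
      leviCivitaLM_apply g hZ.diffAt (bracket_smoothAt hX' hY).diffAt,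
      leviCivitaLM_apply g hZ.diffAt (bracket_smoothAt hX hY).diffAt]
    module
  congr h := curvatureField_congr g h Filter.EventuallyEq.rfl Filter.EventuallyEq.rfl

theorem curvatureField_tensorialAt_second {X Z : VField d M} (hX : SmoothAt X x)
    (hZ : SmoothAt Z x) : SmoothTensorialAt (fun Y => curvatureField g X Y Z x) x where
  smul {f Y} hf hY := by
    have h := (curvatureField_tensorialAt_first g hX hZ).smul hf hY
    beta_reduce at h ⊢
    rw [curvatureField_swap g hX (SmoothAt.smul hf hY) hZ, h, curvatureField_swap g hX hY hZ]
    module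
  add {Y Y'} hY hY' := by
    have h := (curvatureField_tensorialAt_first g hX hZ).add hY hY'
    beta_reduce at h ⊢
    rw [curvatureField_swap g hX (hY.add hY') hZ, h, curvatureField_swap g hX hY hZ,
      curvatureField_swap g hX hY' hZ]
    module
  congr h := curvatureField_congr g Filter.EventuallyEq.rfl h Filter.EventuallyEq.rfl

/-- First derivatives of `f` cancel in pairs, and the second derivatives combine to `X(Y(f)) -
Y(X(f)) - [X, Y](f) = 0`. -/
theorem curvatureField_tensorialAt_third {X Y : VField d M} (hX : SmoothAt X x)
    (hY : SmoothAt Y x) : SmoothTensorialAt (fun Z => curvatureField g X Y Z x) x where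
  smul {f Z} hf hZ := by
    have key {A B : VField d M} (hA : SmoothAt A x) (hB : SmoothAt B x) :
        leviCivita g A (leviCivita g B (f • Z)) x
          = f x • leviCivita g A (leviCivita g B Z) x + dirDeriv A f x • leviCivita g B Z x
            + dirDeriv B f x • leviCivita g A Z x + dirDeriv A (dirDeriv B f) x • Z x := by
      have h1 : leviCivita g B (f • Z) =ᶠ[𝓝 x] f • leviCivita g B Z + dirDeriv B f • Z := by
        filter_upwards [hf.eventually, hB.eventually, hZ.eventually] with y h1 h2 h3
        exact leviCivita_smul_right g h1 h2 h3
      have hBZ := leviCivita_smoothAt g hB hZ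
      have hBf := dirDeriv_smoothAt g hB hf
      rw [leviCivita_congr g (X' := A) Filter.EventuallyEq.rfl h1,
        leviCivita_add_right g hA.diffAt (SmoothAt.smul hf hBZ).diffAt
          (SmoothAt.smul hBf hZ).diffAt,
        leviCivita_smul_right g hf.diffAt hA.diffAt hBZ.diffAt,
        leviCivita_smul_right g hBf.diffAt hA.diffAt hZ.diffAt]
      module
    simp only [curvatureField_apply]
    rw [key hX hY, key hY hX,
      leviCivita_smul_right g hf.diffAt (bracket_smoothAt hX hY).diffAt hZ.diffAt,
      dirDeriv_bracket g hX hY hf]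
    module
  add {Z Z'} hZ hZ' := by
    have key {A B : VField d M} (hA : SmoothAt A x) (hB : SmoothAt B x) :
        leviCivita g A (leviCivita g B (Z + Z')) x
          = leviCivita g A (leviCivita g B Z) x + leviCivita g A (leviCivita g B Z') x := by
      have h1 : leviCivita g B (Z + Z') =ᶠ[𝓝 x] leviCivita g B Z + leviCivita g B Z' := by
        filter_upwards [hB.eventually, hZ.eventually, hZ'.eventually] with y h1 h2 h3
        exact leviCivita_add_right g h1 h2 h3
      rw [leviCivita_congr g (X' := A) Filter.EventuallyEq.rfl h1,
        leviCivita_add_right g hA.diffAt (leviCivita_smoothAt g hB hZ).diffAt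
          (leviCivita_smoothAt g hB hZ').diffAt]
    simp only [curvatureField_apply]
    rw [key hX hY, key hY hX,
      leviCivita_add_right g (bracket_smoothAt hX hY).diffAt hZ.diffAt hZ'.diffAt]
    module
  congr h := curvatureField_congr g Filter.EventuallyEq.rfl Filter.EventuallyEq.rfl h

theorem curvatureField_eq_of_eq {X X' Y Y' Z Z' : VField d M} (hX : SmoothAt X x)
    (hX' : SmoothAt X' x) (hY : SmoothAt Y x) (hY' : SmoothAt Y' x) (hZ : SmoothAt Z x)
    (hZ' : SmoothAt Z' x) (h1 : X x = X' x) (h2 : Y x = Y' x) (h3 : Z x = Z' x) :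
    curvatureField g X Y Z x = curvatureField g X' Y' Z' x :=
  (((curvatureField_tensorialAt_first g hY hZ).eq_of_eq g hX hX' h1).trans
    ((curvatureField_tensorialAt_second g hX' hZ).eq_of_eq g hY hY' h2)).trans
    ((curvatureField_tensorialAt_third g hX' hY').eq_of_eq g hZ hZ' h3)

/-- The linear map `w ↦ R(w, v) u` at a point. -/
def ricciLM (U V : VField d M) (hU : SmoothAt U x) (hV : SmoothAt V x) :
    TangentSpace (𝓡 d) x →ₗ[ℝ] TangentSpace (𝓡 d) x where
  toFun w := curvatureField g (ext x w) V U x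
  map_add' w w' := by
    have hT := curvatureField_tensorialAt_first g hV hU
    rw [← hT.add (smoothAt_ext w) (smoothAt_ext w')]
    exact hT.eq_of_eq g (smoothAt_ext _) ((smoothAt_ext w).add (smoothAt_ext w'))
      (by simp)
  map_smul' c w := by
    have hT := curvatureField_tensorialAt_first g hV hU
    rw [RingHom.id_apply, ← hT.smul (FunSmoothAt.const c) (smoothAt_ext w)]
    exact hT.eq_of_eq g (smoothAt_ext _) (SmoothAt.smul (FunSmoothAt.const c) (smoothAt_ext w))
      (by simp)

theorem trace_eq_sum {e : Fin d → VField d M} (he : IsFrameAt e x)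
    (A : TangentSpace (𝓡 d) x →ₗ[ℝ] TangentSpace (𝓡 d) x) :
    LinearMap.trace ℝ _ A = ∑ a, g.val x (raised g e a x) (A (e a x)) := by
  obtain ⟨b, hb⟩ := he.exists_basis
  have hd := he.isDualFrame g
  rw [LinearMap.trace_eq_matrix_trace ℝ b, Matrix.trace]
  refine Finset.sum_congr rfl fun a _ => ?_
  rw [Matrix.diag_apply, LinearMap.toMatrix_apply, show b a = e a x from congrFun hb a]
  have h1 : ∀ v, b.repr v a = g.val x (raised g e a x) v := fun v => by
    conv_rhs => rw [← b.sum_repr v]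
    simp [map_sum, hb, hd.apply_eq]
  exact h1 _

/-- The Ricci tensor in a frame. -/
theorem ricci_eq_sum {e : Fin d → VField d M} (he : IsFrameAt e x) {U V : VField d M}
    (hU : SmoothAt U x) (hV : SmoothAt V x) :
    ricci g x (U x) (V x)
      = ∑ a, g.val x (raised g e a x) (curvatureField g (e a) V U x) := by
  have hex : ∃ A : TangentSpace (𝓡 d) x →ₗ[ℝ] TangentSpace (𝓡 d) x,
      ∀ U' V' W : VField d M, SmoothAt U' x → SmoothAt V' x → SmoothAt W x →
        U' x = U x → V' x = V x → A (W x) = curvatureField g W V' U' x :=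
    ⟨ricciLM g U V hU hV, fun U' V' W hU' hV' hW h1 h2 =>
      curvatureField_eq_of_eq g (smoothAt_ext _) hW hV hV' hU hU' (ext_self _) h2.symm h1.symm⟩
  have h := Classical.epsilon_spec hex
  rw [ricci, trace_eq_sum g he]
  exact Finset.sum_congr rfl fun a _ =>
    congrArg _ (h U V (e a) hU hV (he.smoothAt a) rfl rfl)

end CurvatureTensor

/-! ### One-forms: the curvature term is the Ricci tensor. -/

section OneForms

variable {d : ℕ} {M : Type*} [TopologicalSpace M] [ChartedSpace (EuclideanSpace ℝ (Fin d)) M]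
  [IsManifold (𝓡 d) ∞ M] (g : Metric d M) (o : ManifoldOrientation d M) {x : M} {α : DForm d M 1}

theorem vec_single_eq {V : Type*} (v : V) : ![v] = fun _ : Fin 1 => v := by
  funext i
  rw [Subsingleton.elim i 0]
  rfl

theorem sharp_spec (α : (TangentSpace (𝓡 d) x) [⋀^Fin 1]→L[ℝ] ℝ) (v : TangentSpace (𝓡 d) x) :
    g.val x (sharp (g.val x) α) v = α ![v] := by
  have hex : ∃ s, ∀ v, g.val x s v = α ![v] := by
    obtain ⟨e, he⟩ := exists_isFrameAt (d := d) x
    have hd := he.isDualFrame g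
    let φ : TangentSpace (𝓡 d) x →ₗ[ℝ] ℝ :=
      { toFun := fun v => α ![v]
        map_add' := fun u v => by
          have h := α.map_update_add ![0] 0 u v
          simp only [Function.update_eq_const_of_subsingleton] at h
          simp only [vec_single_eq]
          exact h
        map_smul' := fun c v => by
          have h := α.map_update_smul ![0] 0 c v
          simp only [Function.update_eq_const_of_subsingleton] at h
          simp only [vec_single_eq]
          exact h }
    refine ⟨∑ a, φ (e a x) • raised g e a x, fun w => ?_⟩
    have h1 : α ![w] = φ (∑ a, g.val x (raised g e a x) w • e a x) := by rw [hd.sum_eq]; rfl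
    rw [h1]
    simp [map_sum, sum_apply, mul_comm]
  exact Classical.epsilon_spec hex v

theorem nabla_oneForm_apply {X Z : VField d M} (hX : FieldDiffAt X x) (hZ : FieldDiffAt Z x)
    (hα : FormDiffAt α x) : nabla g X α x ![Z x]
      = dirDeriv X (fun y => α y ![Z y]) x - α x ![leviCivita g X Z x] := by
  have h := nabla_apply g hX hα (Y := fun _ => Z) fun _ => hZ
  simp only [vec_single_eq, Finset.univ_unique, Finset.sum_singleton,
    Function.update_eq_const_of_subsingleton] at h ⊢
  exact h

theorem sharp_smoothAt (hα : FormSmoothAt α x) :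
    SmoothAt (fun y => sharp (g.val y) (α y)) x := by
  obtain ⟨e, he⟩ := exists_isFrameAt (d := d) x
  refine he.smoothAt_of_pairing g fun a => ?_
  refine ContMDiffAt.congr_of_eventuallyEq (hα (fun _ => e a) fun _ => he.smoothAt a)
    (Filter.Eventually.of_forall fun y => ?_)
  change g.val y (e a y) (sharp (g.val y) (α y)) = α y fun _ => e a y
  rw [g.symm, sharp_spec, vec_single_eq]

/-- The musical isomorphism is parallel. -/
theorem leviCivita_pairing_eq_nabla {A X : VField d M} (hA : SmoothAt A x) (hX : SmoothAt X x)
    (hα : FormSmoothAt α x) (h : ∀ᶠ y in 𝓝 x, ∀ v, g.val y (A y) v = α y ![v]) :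
    ∀ᶠ y in 𝓝 x, ∀ v, g.val y (leviCivita g X A y) v = nabla g X α y ![v] := by
  filter_upwards [hA.eventually, hX.eventually, hα.eventually g, h.eventually_nhds]
    with y h1 h2 h3 h4 v
  have hV : FieldDiffAt (ext y v) y := (smoothAt_ext v).diffAt
  have h5 := nabla_oneForm_apply g h2 hV h3
  have h6 := leviCivita_metric g h2 h1 hV
  rw [dirDeriv_congr (h4.mono fun z hz => hz _)] at h6
  rw [h6, ← h4.self_of_nhds, ext_self] at h5
  rw [h5]
  ring

/-- The musical isomorphism commutes with `∇` on a neighbourhood, hence with iterated derivatives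
and with the curvature operator. -/
theorem curvature_oneForm_apply {X Y : VField d M} (hX : SmoothAt X x) (hY : SmoothAt Y x)
    (hα : FormSmoothAt α x) (v : TangentSpace (𝓡 d) x) :
    curvature g X Y α x ![v]
      = g.val x (curvatureField g X Y (fun y => sharp (g.val y) (α y)) x) v := by
  have hA := sharp_smoothAt g hα
  have h0 : ∀ᶠ y in 𝓝 x, ∀ v, g.val y (sharp (g.val y) (α y)) v = α y ![v] :=
    Filter.Eventually.of_forall fun y v => sharp_spec g (α y) v
  have hYA := leviCivita_pairing_eq_nabla g hA hY hα h0
  have hXA := leviCivita_pairing_eq_nabla g hA hX hα h0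
  have h1 := leviCivita_pairing_eq_nabla g (leviCivita_smoothAt g hY hA) hX
    (nabla_smoothAt g hY hα) hYA
  have h2 := leviCivita_pairing_eq_nabla g (leviCivita_smoothAt g hX hA) hY
    (nabla_smoothAt g hX hα) hXA
  have h3 := leviCivita_pairing_eq_nabla g hA (bracket_smoothAt hX hY) hα h0
  rw [curvatureField_apply, map_sub, map_sub, sub_apply, sub_apply, h1.self_of_nhds,
    h2.self_of_nhds, h3.self_of_nhds]
  rfl

/-- With `A = ♯α`, the sum over `a` contracts `e_a` to `u` and leaves `∑ g(e^b, R(u, e_b) A)`.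
Antisymmetry of the curvature turns this into minus the trace of `w ↦ R(w, u) A`. -/
theorem curvatureTerm_oneForm {e : Fin d → VField d M} (he : IsFrameAt e x)
    (hα : FormSmoothAt α x) (u : TangentSpace (𝓡 d) x) :
    curvatureTerm g e α x ![u] = -ricci g x (sharp (g.val x) (α x)) u := by
  set A : VField d M := fun y => sharp (g.val y) (α y) with hAdef
  have hA : SmoothAt A x := sharp_smoothAt g hα
  have hd := he.isDualFrame g
  set U := ext x u with hUdef
  have hU : SmoothAt U x := smoothAt_ext u
  have hUx : U x = u := ext_self u
  have h1 : ricci g x (sharp (g.val x) (α x)) u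
      = ∑ b, g.val x (raised g e b x) (curvatureField g (e b) U A x) := by
    rw [← ricci_eq_sum g he hA hU, hUx]
  have h2 : ∀ a b, creatorInterior (g.val x) (raised g e a x) (raised g e b x)
      (curvature g (e a) (e b) α x) ![u] = g.val x (raised g e a x) u *
        g.val x (raised g e b x) (curvatureField g (e a) (e b) A x) := fun a b => by
    rw [creatorInterior, creator, oneFormWedge_apply, Fin.sum_univ_one, interior_apply,
      g.symm x (raised g e b x), ← curvature_oneForm_apply g (he.smoothAt a) (he.smoothAt b) hα]
    have h3 : (Fin.cons (raised g e b x) (Fin.removeNth 0 ![u]) : Fin 1 → TangentSpace (𝓡 d) x)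
        = ![raised g e b x] :=
      funext fun i => Fin.cases rfl (fun j => j.elim0) i
    rw [h3]
    simp
  have h4 : ∀ b, curvatureField g U (e b) A x
      = ∑ a, g.val x (raised g e a x) u • curvatureField g (e a) (e b) A x := fun b => by
    rw [(curvatureField_tensorialAt_first g (he.smoothAt b) hA).expansion g he hU, hUx]
  rw [h1, curvatureTerm, ContinuousAlternatingMap.sum_apply, ← Finset.sum_neg_distrib]
  simp only [ContinuousAlternatingMap.sum_apply, h2]
  rw [Finset.sum_comm]
  refine Finset.sum_congr rfl fun b _ => ?_
  rw [curvatureField_swap g (he.smoothAt b) hU hA, map_neg, neg_neg, h4, map_sum]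
  simp only [map_smul, smul_eq_mul]

end OneForms

end PseudoRiemannian

end

theorem mainTheorem8 {d : ℕ} {M : Type*} [TopologicalSpace M]
    [ChartedSpace (EuclideanSpace ℝ (Fin d)) M] [IsManifold (𝓡 d) ∞ M]
    (g : PseudoRiemannian.Metric d M) (o : PseudoRiemannian.ManifoldOrientation d M) :
    (∀ (p : ℕ) (α : PseudoRiemannian.DForm d M p), α.IsSmooth →
      ∀ (e : Fin d → PseudoRiemannian.VField d M) (s : Set M),
        PseudoRiemannian.IsFrameOn e s → ∀ x ∈ s,
          PseudoRiemannian.laplaceDeRham g o α x =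
            PseudoRiemannian.laplaceBeltrami g α x + PseudoRiemannian.curvatureTerm g e α x) ∧
    (∀ α : PseudoRiemannian.DForm d M 1, α.IsSmooth →
      ∀ (x : M) (u : TangentSpace (𝓡 d) x),
        PseudoRiemannian.laplaceDeRham g o α x ![u] =
          PseudoRiemannian.laplaceBeltrami g α x ![u]
            - PseudoRiemannian.ricci g x (PseudoRiemannian.sharp (g.val x) (α x)) u) := by
  refine ⟨fun p α hα e s hes x hx =>
    PseudoRiemannian.weitzenboeck g o hes hx fun y => hα.formSmoothAt g y, fun α hα x u => ?_⟩
  -- The one-form identity mentions no frame, so any frame around `x` may be used.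
  obtain ⟨e, s, hes, hx⟩ := PseudoRiemannian.exists_isFrameOn (d := d) x
  rw [PseudoRiemannian.weitzenboeck g o hes hx fun y => hα.formSmoothAt g y,
    PseudoRiemannian.form_add_apply,
    PseudoRiemannian.curvatureTerm_oneForm g (hes.isFrameAt hx) (hα.formSmoothAt g x) u,
    sub_eq_add_neg]
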